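/- Let $d\ge 2$ and let $\beta_+,\beta_-\in\mathbb R$ satisfy $\beta_++\beta_-=\tfrac12$ and $\beta_->\tfrac{2-d}{2}$. Let $\sigma$ be the surface measure on $\mathbb S^{d-1}$, write $|\mathbb S^{n}|$ for the total surface measure of $\mathbb S^{n}$ (so $|\mathbb S^0|=2$), and for $f\in L^2(\mathbb R^d\times\mathbb S^{d-1},\mathrm dx\,\mathrm d\sigma(v))$ let $$\rho f(x,t)=\int_{\mathbb S^{d-1}}f(x-tv,v)\,\mathrm d\sigma(v),\qquad (x,t)\in\mathbb R^d\times\mathbb R .$$ Let $D_+^{\beta_+}D_-^{\beta_-}$ be the Fourier multiplier operator on $\mathbb R^d\times\mathbb R$ with multiplier $(|\xi|+|\tau|)^{\beta_+}\,\big||\xi|-|\tau|\big|^{\beta_-}$, where $\widehat g(\xi,\tau)=\int g(x,t)e^{-i(x\cdot\xi+t\tau)}\,\mathrm dx\,\mathrm dt$ (extended to tempered distributions). Let $L^2_{\mathrm{rad}(x)}$ be the set of $f\in L^2(\mathbb R^d\times\mathbb S^{d-1})$ of the form $f(x,v)=f_0(|x|,v)$ almost everywhere, and $L^2_{\mathrm{rad}(x,v)}$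 the set of those of the form $f(x,v)=f_0(|x|)$ almost everywhere. Then $D_+^{\beta_+}D_-^{\beta_-}\rho f\in L^2(\mathbb R^d\times\mathbb R)$ for every $f\in L^2_{\mathrm{rad}(x)}$, and the optimal (that is, smallest) constant $\mathbf C_0$ such that $$\|D_+^{\beta_+}D_-^{\beta_-}\rho f\|_{L^2(\mathbb R^d\times\mathbb R)}^2\le \mathbf C_0\,\|f\|_{L^2(\mathbb R^d\times\mathbb S^{d-1})}^2\qquad\text{for all } f\in L^2_{\mathrm{rad}(x)}$$ is $$\mathbf C_0=2^{2d-2}\,\pi\,\frac{|\mathbb S^{d-2}|^2}{|\mathbb S^{d-1}|}\,\mathrm B\big(\tfrac12;\,2\beta_-+d-2,\,2\beta_++d-2\big),$$ where $\mathrm B(x;a,b)=\int_0^x\lambda^{a-1}(1-\lambda)^{b-1}\,\mathrm d\lambda$. Moreover, for $f\in L^2_{\mathrm{rad}(x)}$, equality holds in this estimate with constant $\mathbf C_0$ if and only if $f\in L^2_{\mathrm{rad}(x,v)}$. -/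

import Mathlib

open MeasureTheory Set
open scoped SchwartzMap RealInnerProductSpace

noncomputable section

namespace KineticTransport

/-- The space `ℝ^d` with its Euclidean norm. -/
abbrev Space (d : ℕ) : Type := EuclideanSpace ℝ (Fin d)

/-- The unit sphere of `ℝ^d`. -/
abbrev UnitSphere (d : ℕ) : Type := Metric.sphere (0 : Space d) 1

/-- The surface measure (induced Lebesgue measure) on the unit sphere of `ℝ^d`. -/
def surfaceMeasure (d : ℕ) : Measure (UnitSphere d) := (volume : Measure (Space d)).toSphere

/-- The total surface area of the unit sphere of `ℝ^d`; it is `2` for `d = 1`. -/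
def sphereArea (d : ℕ) : ℝ := (surfaceMeasure d).real univ

/-- The measure `dx dσ(v)` on `ℝ^d × S^{d-1}`. -/
def phaseMeasure (d : ℕ) : Measure (Space d × UnitSphere d) :=
  (volume : Measure (Space d)).prod (surfaceMeasure d)

/-- The incomplete beta function `B(x; a, b) = ∫_0^x λ^(a-1) (1-λ)^(b-1) dλ`. -/
def incompleteBeta (x a b : ℝ) : ℝ := ∫ l in (0 : ℝ)..x, l ^ (a - 1) * (1 - l) ^ (b - 1)

/-- The velocity average `ρ f (x, t) = ∫ f (x - t v, v) dσ(v)` over the unit sphere. -/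
def velocityAverage {d : ℕ} (f : Space d × UnitSphere d → ℂ) (z : Space d × ℝ) : ℂ :=
  ∫ v : UnitSphere d, f (z.1 - z.2 • (v : Space d), v) ∂(surfaceMeasure d)

/-- The space-time Fourier transform `φ̂(ξ, τ) = ∫ φ(x, t) e^{-i (x·ξ + t τ)} dx dt` of a
Schwartz function. -/
def spaceTimeFourier {d : ℕ} (φ : 𝓢(Space d × ℝ, ℂ)) (ζ : Space d × ℝ) : ℂ :=
  ∫ z : Space d × ℝ,
    φ z * Complex.exp (-(Complex.I * (((⟪z.1, ζ.1⟫ + z.2 * ζ.2 : ℝ)) : ℂ)))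

/-- The functions `u` and `U` on `ℝ^d × ℝ` define tempered distributions by integration, and the
distributional Fourier transform of `u` is `U`: `∫ u φ̂ = ∫ U φ` for every Schwartz function `φ`.
(`U` is then locally integrable, and it is determined by `u` up to null sets.) -/
def HasFourierTransform {d : ℕ} (u U : Space d × ℝ → ℂ) : Prop :=
  ∀ φ : 𝓢(Space d × ℝ, ℂ),
    Integrable (fun z => u z * spaceTimeFourier φ z) ∧
    Integrable (fun ζ => U ζ * φ ζ) ∧
    ∫ z, u z * spaceTimeFourier φ z = ∫ ζ, U ζ * φ ζ

/-- The Fourier multiplier `(|ξ| + |τ|)^{β₊} ||ξ| - |τ||^{β₋}`. -/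
def hyperbolicMultiplier {d : ℕ} (βp βm : ℝ) (ζ : Space d × ℝ) : ℝ :=
  (‖ζ.1‖ + |ζ.2|) ^ βp * (abs (‖ζ.1‖ - |ζ.2|)) ^ βm

/-- `w ∈ L²(ℝ^d × ℝ)` and `w = D₊^{β₊} D₋^{β₋} u`: the Fourier transform of `u` is a function, and
its product with `(|ξ| + |τ|)^{β₊} ||ξ| - |τ||^{β₋}` is the Fourier transform of `w`.
(Up to null sets, `u` determines `w`.) -/
def IsHyperbolicDerivative {d : ℕ} (βp βm : ℝ) (u w : Space d × ℝ → ℂ) : Prop :=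
  MemLp w 2 ∧ ∃ U : Space d × ℝ → ℂ, HasFourierTransform u U ∧
    HasFourierTransform w (fun ζ => (hyperbolicMultiplier βp βm ζ : ℂ) * U ζ)

/-- The functions in `L²(ℝ^d × S^{d-1})` that are radial in `x`. -/
def L2RadX (d : ℕ) : Set (Space d × UnitSphere d → ℂ) :=
  {f | MemLp f 2 (phaseMeasure d) ∧
    ∃ f₀ : ℝ → UnitSphere d → ℂ, ∀ᵐ p ∂(phaseMeasure d), f p = f₀ ‖p.1‖ p.2}

/-- The functions in `L²(ℝ^d × S^{d-1})` that are radial in `x` and independent of `v`. -/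
def L2RadXV (d : ℕ) : Set (Space d × UnitSphere d → ℂ) :=
  {f | MemLp f 2 (phaseMeasure d) ∧
    ∃ f₀ : ℝ → ℂ, ∀ᵐ p ∂(phaseMeasure d), f p = f₀ ‖p.1‖}

/-- The squared `L²` norm (used for square integrable functions only). -/
def sqNorm {α : Type*} [MeasurableSpace α] (μ : Measure α) (g : α → ℂ) : ℝ := ∫ a, ‖g a‖ ^ 2 ∂μ

/-- `2^{2d-2} π |S^{d-2}|² / |S^{d-1}| · B(1/2; 2β₋+d-2, 2β₊+d-2)`. -/
def sharpRadialConstant (d : ℕ) (βp βm : ℝ) : ℝ :=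
  2 ^ (2 * d - 2) * Real.pi * (sphereArea (d - 1) ^ 2 / sphereArea d) *
    incompleteBeta (1 / 2) (2 * βm + d - 2) (2 * βp + d - 2)

end KineticTransport

end

/-! On the Fourier side free transport lives on hyperplanes: if `g(ξ,v)` is the transform of `f` in
`x`, then the space-time transform of `ρf` is `2π ∫ g(ξ,v) δ(τ + v·ξ) dσ(v)`. The delta is made
precise by disintegration. For `ξ ≠ 0` the law of `-v·ξ` under `σ` has a density `N(ξ,τ)`
(`sliceDensity`), and the transform equals `2π N(ξ,τ) E(ξ,τ)`, where `E` is the conditional mean of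
`g(ξ,·)` given `-v·ξ = τ` (`map_sliceMap`, `hasFourierTransform_velocityAverage`).

Let `m` be the multiplier. Since `β₊ + β₋ = 1/2`, the product `m² N` is homogeneous of degree zero,
hence a function `W(τ/|ξ|)`. So `∫ |m · 2πNE|² = (2π)² ∫ W |E|² N dξ dτ`. On each slice `|E|²` is
the conditional mean of `|g|²` minus a variance, which turns this into `(2π)² (∫ W(-v·ξ/|ξ|) |g|² dξ
dσ - defect)`. When `f` is radial in `x`, `|g|²` depends only on `|ξ|` and `v`, so the direction of
`ξ` integrates out and leaves a constant times `‖g‖²`. The result is an exact identity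
(`energy_identity`), not merely an inequality. Its constant is an integral over `(-1,1)` that
becomes the incomplete beta integral under `|s| = 1 - 2λ` (`angularConstant_eq`).

Equality therefore means that the defect vanishes. As `W > 0` almost everywhere, for almost every
radius `r` the function `g(r,·)` depends on `v` only through `v·ω`, for almost every axis `ω`. A
function on the sphere that is zonal about almost every axis is constant (`ae_eq_const_of_zonal`),
so `g`, and with it `f`, does not depend on `v`. Conversely, independence of `v` kills the variance,
and any nonzero such `f` shows that the constant is optimal. -/

open MeasureTheory Set
open scoped SchwartzMap RealInnerProductSpace

noncomputable section

namespace KineticTransport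

/-! ### Polar coordinates and rotation invariance of the surface measure. -/

section Sphere

variable {E : Type*} [NormedAddCommGroup E] [InnerProductSpace ℝ E] [MeasurableSpace E]
  [BorelSpace E] [FiniteDimensional ℝ E]

/-- The polar coordinate map `(ω, r) ↦ r ω`. -/
def polarMap (E : Type*) [NormedAddCommGroup E] [InnerProductSpace ℝ E]
    (p : Metric.sphere (0 : E) 1 × Ioi (0 : ℝ)) : E := (p.2 : ℝ) • (p.1 : E)

lemma measurableEmbedding_polarMap : MeasurableEmbedding (polarMap E) := by
  have h := (MeasurableEmbedding.subtype_coe (measurableSet_singleton (0 : E)).compl).comp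
    (homeomorphUnitSphereProd E).symm.measurableEmbedding
  convert! h using 1

lemma measurePreserving_polarMap [Nontrivial E] (μ : Measure E) [μ.IsAddHaarMeasure] :
    MeasurePreserving (polarMap E)
      (μ.toSphere.prod (Measure.volumeIoiPow (Module.finrank ℝ E - 1))) μ := by
  have h1 := (μ.measurePreserving_homeomorphUnitSphereProd).symm
    (homeomorphUnitSphereProd E).toMeasurableEquiv
  have h2 : MeasurePreserving (Subtype.val : ({0}ᶜ : Set E) → E) (μ.comap Subtype.val) μ := by
    refine ⟨measurable_subtype_coe, ?_⟩
    rw [map_comap_subtype_coe (measurableSet_singleton (0 : E)).compl, restrict_compl_singleton]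
  exact h2.comp h1

lemma lintegral_volumeIoiPow (n : ℕ) {f : ℝ → ENNReal} (hf : Measurable f) :
    ∫⁻ r : Ioi (0 : ℝ), f r ∂(Measure.volumeIoiPow n) =
      ∫⁻ r in Ioi (0 : ℝ), ENNReal.ofReal (r ^ n) * f r := by
  rw [Measure.volumeIoiPow, lintegral_withDensity_eq_lintegral_mul _ (by fun_prop) (by fun_prop)]
  rw [← lintegral_subtype_comap measurableSet_Ioi]
  rfl

lemma lintegral_polar [Nontrivial E] (μ : Measure E) [μ.IsAddHaarMeasure] {f : E → ENNReal}
    (hf : Measurable f) :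
    ∫⁻ x, f x ∂μ = ∫⁻ ω : Metric.sphere (0 : E) 1, ∫⁻ r in Ioi (0 : ℝ),
      ENNReal.ofReal (r ^ (Module.finrank ℝ E - 1)) * f (r • (ω : E)) ∂volume ∂μ.toSphere := by
  rw [← (measurePreserving_polarMap μ).lintegral_comp hf, lintegral_prod]
  · refine lintegral_congr fun ω => ?_
    exact lintegral_volumeIoiPow _ (f := fun r => f (r • (ω : E))) (by fun_prop)
  · exact (hf.comp (measurePreserving_polarMap μ).measurable).aemeasurable

/-- The action of a linear isometry on the unit sphere. -/
def sphereMap (L : E ≃ₗᵢ[ℝ] E) (v : Metric.sphere (0 : E) 1) : Metric.sphere (0 : E) 1 :=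
  ⟨L v, by simp⟩

-- The surface measure of `s` is a dimensional multiple of the volume of the cone `(0,1) • s`, and a
-- linear isometry maps cones to cones and preserves volume.
open scoped Pointwise in
lemma measurePreserving_sphereMap (L : E ≃ₗᵢ[ℝ] E) :
    MeasurePreserving (sphereMap L) (volume : Measure E).toSphere
      (volume : Measure E).toSphere := by
  have hm : Measurable (sphereMap L) :=
    (L.continuous.comp continuous_subtype_val).subtype_mk _ |>.measurable
  refine ⟨hm, Measure.ext fun s hs => ?_⟩
  rw [Measure.map_apply hm hs, Measure.toSphere_apply' _ hs, Measure.toSphere_apply' _ (hm hs)]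
  congr 1
  have : Ioo (0 : ℝ) 1 • ((↑) '' (sphereMap L ⁻¹' s) : Set E) =
      L ⁻¹' (Ioo (0 : ℝ) 1 • ((↑) '' s : Set E)) := by
    ext x
    simp only [Set.mem_smul, mem_image, mem_preimage]
    constructor
    · rintro ⟨r, hr, _, ⟨v, hv, rfl⟩, rfl⟩
      exact ⟨r, hr, _, ⟨_, hv, rfl⟩, by simp [sphereMap]⟩
    · rintro ⟨r, hr, _, ⟨v, hv, rfl⟩, h⟩
      refine ⟨r, hr, L.symm v, ⟨sphereMap L.symm v, ?_, rfl⟩, ?_⟩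
      · convert hv
        simp [sphereMap]
      · apply L.injective
        rw [← h]; simp
  rw [this]
  exact L.measurePreserving.measure_preimage_equiv (f := L.toMeasurableEquiv) _

-- The reflection in the hyperplane that bisects `x` and `y` does it.
omit [MeasurableSpace E] [BorelSpace E] [FiniteDimensional ℝ E] in
lemma exists_isometry_map_eq {x y : E} (h : ‖x‖ = ‖y‖) : ∃ L : E ≃ₗᵢ[ℝ] E, L x = y :=
  ⟨_, Submodule.reflection_sub h⟩

/-- The integral of a zonal function does not depend on its axis. -/
lemma lintegral_zonal_eq {x y : E} (h : ‖x‖ = ‖y‖) (k : ℝ → ENNReal) (hk : Measurable k) :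
    ∫⁻ v : Metric.sphere (0 : E) 1, k ⟪(v : E), x⟫ ∂(volume : Measure E).toSphere =
      ∫⁻ v : Metric.sphere (0 : E) 1, k ⟪(v : E), y⟫ ∂(volume : Measure E).toSphere := by
  obtain ⟨L, rfl⟩ := exists_isometry_map_eq h
  rw [← (measurePreserving_sphereMap L).lintegral_comp
    (f := fun v : Metric.sphere (0 : E) 1 => k ⟪(v : E), L x⟫) (by fun_prop)]
  simp [sphereMap]

end Sphere

/-! ### The law of one coordinate on the sphere. -/

instance (d : ℕ) : IsFiniteMeasure (surfaceMeasure d) :=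
  inferInstanceAs (IsFiniteMeasure (volume : Measure (Space d)).toSphere)

lemma lintegral_succ (n : ℕ) {f : Space (n + 1) → ENNReal} (hf : Measurable f) :
    ∫⁻ x, f x = ∫⁻ a : ℝ, ∫⁻ y : Space n, f (WithLp.toLp 2 (Fin.cons a y)) := by
  rw [← (PiLp.volume_preserving_toLp (Fin (n + 1))).lintegral_comp hf]
  rw [← ((volume_preserving_piFinSuccAbove (fun _ : Fin (n + 1) => ℝ) 0).symm
    (MeasurableEquiv.piFinSuccAbove (fun _ => ℝ) 0)).lintegral_comp
      (f := fun a => f (WithLp.toLp 2 a))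
      (hf.comp (PiLp.volume_preserving_toLp (Fin (n + 1))).measurable)]
  have hm : Measurable fun a : ℝ × (Fin n → ℝ) => f (WithLp.toLp 2
      ((MeasurableEquiv.piFinSuccAbove (fun _ : Fin (n + 1) => ℝ) 0).symm a)) :=
    hf.comp ((PiLp.volume_preserving_toLp (Fin (n + 1))).measurable.comp
      (MeasurableEquiv.measurable _))
  rw [Measure.volume_eq_prod, lintegral_prod _ hm.aemeasurable]
  refine lintegral_congr fun a => ?_
  rw [← (PiLp.volume_preserving_ofLp (Fin n)).lintegral_comp (by exact hm.comp (by fun_prop))]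
  refine lintegral_congr fun y => ?_
  simp [MeasurableEquiv.piFinSuccAbove, Fin.insertNthEquiv]

/-- The density of the pushforward of the surface measure of `S^{d-1}` under `v ↦ ⟪v, e⟫`. -/
def zonalDensity (d : ℕ) (s : ℝ) : ℝ :=
  sphereArea (d - 1) * (Ioo (-1 : ℝ) 1).indicator (fun s => (1 - s ^ 2) ^ (((d : ℝ) - 3) / 2)) s

lemma measurable_zonalDensity (d : ℕ) : Measurable (zonalDensity d) :=
  measurable_const.mul (Measurable.indicator (by fun_prop) measurableSet_Ioo)

/-- Planar polar coordinates, cut down by the sign of `sin θ`. Here `a` plays the coordinate along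
an axis and `ρ` the distance from it. -/
lemma lintegral_halfplane {F : ℝ × ℝ → ENNReal} (hF : Measurable F) :
    ∫⁻ a : ℝ, ∫⁻ ρ in Ioi (0 : ℝ), F (a, ρ) =
      ∫⁻ r in Ioi (0 : ℝ), ∫⁻ θ in Ioo 0 Real.pi,
        ENNReal.ofReal r * F (r * Real.cos θ, r * Real.sin θ) := by
  have hm : Measurable ((univ ×ˢ Ioi (0 : ℝ)).indicator F) :=
    hF.indicator (MeasurableSet.univ.prod measurableSet_Ioi)
  calc ∫⁻ a : ℝ, ∫⁻ ρ in Ioi (0 : ℝ), F (a, ρ)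
      = ∫⁻ p : ℝ × ℝ, (univ ×ˢ Ioi (0 : ℝ)).indicator F p := by
        rw [Measure.volume_eq_prod, lintegral_prod _ hm.aemeasurable]
        refine lintegral_congr fun a => ?_
        rw [← lintegral_indicator measurableSet_Ioi]
        refine lintegral_congr fun ρ => ?_
        by_cases h : ρ ∈ Ioi (0 : ℝ) <;> simp [indicator, h]
    _ = ∫⁻ r in Ioi (0 : ℝ), ∫⁻ θ in Ioo (-Real.pi) Real.pi, ENNReal.ofReal r *
          (univ ×ˢ Ioi (0 : ℝ)).indicator F (r * Real.cos θ, r * Real.sin θ) := by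
        rw [← lintegral_comp_polarCoord_symm, polarCoord_target, Measure.volume_eq_prod,
          ← Measure.prod_restrict, lintegral_prod]
        · rfl
        · refine Measurable.aemeasurable ?_
          refine Measurable.smul (f := fun p : ℝ × ℝ => ENNReal.ofReal p.1)
            (ENNReal.measurable_ofReal.comp measurable_fst) (hm.comp ?_)
          change Measurable fun p : ℝ × ℝ => (p.1 * Real.cos p.2, p.1 * Real.sin p.2)
          fun_prop
    _ = _ := by
        refine setLIntegral_congr_fun measurableSet_Ioi fun r hr => ?_
        have hr : 0 < r := hr
        have hsub : Ioo 0 Real.pi ⊆ Ioo (-Real.pi) Real.pi :=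
          Ioo_subset_Ioo_left (by linarith [Real.pi_pos])
        rw [← lintegral_indicator measurableSet_Ioo, ← lintegral_indicator measurableSet_Ioo]
        refine lintegral_congr fun θ => ?_
        by_cases h1 : θ ∈ Ioo 0 Real.pi
        · rw [indicator_of_mem h1, indicator_of_mem (hsub h1), indicator_of_mem]
          simpa using mul_pos hr (Real.sin_pos_of_mem_Ioo h1)
        · rw [indicator_of_notMem h1]
          by_cases h2 : θ ∈ Ioo (-Real.pi) Real.pi
          · rw [indicator_of_mem h2, indicator_of_notMem, mul_zero]
            have h3 : θ ≤ 0 := by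
              by_contra h
              exact h1 ⟨not_le.1 h, h2.2⟩
            have := Real.sin_nonpos_of_nonpos_of_neg_pi_le h3 h2.1.le
            simpa using mul_nonpos_of_nonneg_of_nonpos hr.le this
          · rw [indicator_of_notMem h2]

/-- Put `s = cos θ`. The Jacobian absorbs one power of `sin θ`, and the other `n - 2` are powers of
`√(1 - s²)`. -/
lemma lintegral_cos_substitution {n : ℕ} (hn : 1 ≤ n) (k : ℝ → ENNReal) :
    ∫⁻ θ in Ioo 0 Real.pi, ENNReal.ofReal (Real.sin θ ^ (n - 1)) * k (Real.cos θ) =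
      ∫⁻ s in Ioo (-1 : ℝ) 1, ENNReal.ofReal ((1 - s ^ 2) ^ (((n : ℝ) - 2) / 2)) * k s := by
  have himg : Real.cos '' Ioo 0 Real.pi = Ioo (-1 : ℝ) 1 := by
    ext s
    constructor
    · rintro ⟨θ, hθ, rfl⟩
      constructor
      · rw [← Real.cos_pi]
        exact Real.cos_lt_cos_of_nonneg_of_le_pi hθ.1.le le_rfl hθ.2
      · rw [← Real.cos_zero]
        exact Real.cos_lt_cos_of_nonneg_of_le_pi le_rfl hθ.2.le hθ.1
    · intro hs
      refine ⟨Real.arccos s, ⟨Real.arccos_pos.2 hs.2, ?_⟩, Real.cos_arccos hs.1.le hs.2.le⟩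
      refine lt_of_le_of_ne (Real.arccos_le_pi s) fun h => ?_
      exact absurd (Real.arccos_eq_pi.1 h) (not_le.2 hs.1)
  rw [← himg, lintegral_image_eq_lintegral_abs_deriv_mul measurableSet_Ioo
    (fun x _ => (Real.hasDerivAt_cos x).hasDerivWithinAt)
    (Real.injOn_cos.mono Ioo_subset_Icc_self)]
  refine setLIntegral_congr_fun measurableSet_Ioo fun θ hθ => ?_
  have hs := Real.sin_pos_of_mem_Ioo hθ
  rw [← mul_assoc, ← ENNReal.ofReal_mul (abs_nonneg _)]
  congr 2
  have h1 : 1 - Real.cos θ ^ 2 = Real.sin θ ^ (2 : ℝ) := by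
    rw [Real.rpow_two, Real.sin_sq]
  rw [abs_neg, abs_of_pos hs, h1, ← Real.rpow_mul hs.le, ← Real.rpow_natCast]
  nth_rewrite 2 [← Real.rpow_one (Real.sin θ)]
  rw [← Real.rpow_add hs, Nat.cast_sub hn]
  congr 1
  push_cast
  ring

/-- The integral of `k (x 0 / ‖x‖)` over the unit ball is computed twice. Spherical coordinates give
the left side times `c = ∫₀¹ rⁿ dr`. Cylindrical coordinates about the first axis, followed by polar
coordinates in the half plane, give the right side times the same `c`, which is positive and finite
and cancels. -/
lemma lintegral_zonal_aux {n : ℕ} (hn : 1 ≤ n) {k : ℝ → ENNReal} (hk : Measurable k) :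
    ∫⁻ v, k ⟪(v : Space (n + 1)), EuclideanSpace.single 0 1⟫ ∂(surfaceMeasure (n + 1)) =
      ∫⁻ s, ENNReal.ofReal (zonalDensity (n + 1) s) * k s := by
  have : NeZero n := ⟨by omega⟩
  set c : ENNReal := ∫⁻ r in Ioi (0 : ℝ), ENNReal.ofReal (r ^ n) * (Iio (1 : ℝ)).indicator 1 r
    with hc
  have hc' : c = ∫⁻ r in Ioo (0 : ℝ) 1, ENNReal.ofReal (r ^ n) := by
    rw [hc, ← Ioi_inter_Iio, inter_comm, ← Measure.restrict_restrict measurableSet_Iio,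
      ← lintegral_indicator measurableSet_Iio]
    refine lintegral_congr fun r => ?_
    by_cases h : r ∈ Iio (1 : ℝ) <;> simp [h]
  have hc0 : c ≠ 0 := by
    rw [hc', ← pos_iff_ne_zero, setLIntegral_pos_iff (by fun_prop)]
    refine lt_of_lt_of_le (by simp) (measure_mono (s := Ioo (0 : ℝ) 1) ?_)
    exact fun r hr => ⟨by simpa using pow_pos hr.1 n, hr⟩
  have hctop : c ≠ ⊤ := by
    rw [hc']
    refine ne_top_of_le_ne_top (b := ∫⁻ r in Ioo (0 : ℝ) 1, 1) (by simp) ?_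
    refine setLIntegral_mono measurable_const fun r hr => ?_
    rw [ENNReal.ofReal_le_one]
    exact pow_le_one₀ hr.1.le hr.2.le
  set f : Space (n + 1) → ENNReal := fun x => k (x 0 / ‖x‖) * (Iio (1 : ℝ)).indicator 1 ‖x‖
    with hf
  have hfm : Measurable f := by
    refine Measurable.mul (by fun_prop) ?_
    exact (measurable_one.indicator measurableSet_Iio).comp measurable_norm
  have h1 : ∫⁻ x, f x =
      (∫⁻ v, k ⟪(v : Space (n + 1)), EuclideanSpace.single 0 1⟫ ∂(surfaceMeasure (n + 1))) * c := by
    rw [lintegral_polar _ hfm, ← lintegral_mul_const _ (by fun_prop)]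
    refine lintegral_congr fun v => ?_
    rw [hc, ← lintegral_const_mul]
    · refine setLIntegral_congr_fun measurableSet_Ioi fun r hr => ?_
      have hr : 0 < r := hr
      have hv : ‖(v : Space (n + 1))‖ = 1 := by simp
      simp [hf, norm_smul, abs_of_pos hr, hv, mul_div_cancel_left₀ _ hr.ne',
        EuclideanSpace.inner_single_right]
      ring
    · exact (by fun_prop : Measurable fun r : ℝ => ENNReal.ofReal (r ^ n)).mul
        (measurable_one.indicator measurableSet_Iio)
  have h2 : ∫⁻ x, f x = (∫⁻ s, ENNReal.ofReal (zonalDensity (n + 1) s) * k s) * c := by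
    set F : ℝ × ℝ → ENNReal := fun p => k (p.1 / √(p.1 ^ 2 + p.2 ^ 2)) *
      (Iio (1 : ℝ)).indicator 1 √(p.1 ^ 2 + p.2 ^ 2) with hF
    have hFm : Measurable F := by
      refine Measurable.mul (by fun_prop) ?_
      exact (measurable_one.indicator measurableSet_Iio).comp (by fun_prop)
    have hnorm : ∀ (a : ℝ) (y : Space n),
        ‖(WithLp.toLp 2 (Fin.cons a y) : Space (n + 1))‖ = √(a ^ 2 + ‖y‖ ^ 2) := by
      intro a y
      rw [EuclideanSpace.norm_eq, Fin.sum_univ_succ, EuclideanSpace.norm_sq_eq]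
      simp
    have hA : surfaceMeasure n univ = ENNReal.ofReal (sphereArea n) := by
      rw [sphereArea, ofReal_measureReal]
    calc ∫⁻ x, f x = ∫⁻ a : ℝ, ∫⁻ y : Space n, F (a, ‖y‖) := by
          rw [lintegral_succ n hfm]
          refine lintegral_congr fun a => lintegral_congr fun y => ?_
          simp only [hf, hnorm, hF]
          simp
      _ = ∫⁻ a : ℝ, ∫⁻ ρ in Ioi (0 : ℝ), ENNReal.ofReal (sphereArea n) *
            (ENNReal.ofReal (ρ ^ (n - 1)) * F (a, ρ)) := by
          refine lintegral_congr fun a => ?_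
          rw [lintegral_polar _ (by fun_prop : Measurable fun y : Space n => F (a, ‖y‖)),
            lintegral_const_mul _ (by fun_prop), ← hA]
          have : ∀ ω : UnitSphere n, ∫⁻ r in Ioi (0 : ℝ),
              ENNReal.ofReal (r ^ (Module.finrank ℝ (Space n) - 1)) *
                F (a, ‖r • (ω : Space n)‖) =
              ∫⁻ ρ in Ioi (0 : ℝ), ENNReal.ofReal (ρ ^ (n - 1)) * F (a, ρ) := by
            intro ω
            refine setLIntegral_congr_fun measurableSet_Ioi fun r hr => ?_
            have hr : 0 < r := hr
            simp [norm_smul, abs_of_pos hr]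
          simp_rw [this]
          rw [lintegral_const, mul_comm]
          rfl
      _ = ∫⁻ r in Ioi (0 : ℝ), ∫⁻ θ in Ioo 0 Real.pi, ENNReal.ofReal r *
            (ENNReal.ofReal (sphereArea n) * (ENNReal.ofReal ((r * Real.sin θ) ^ (n - 1)) *
              F (r * Real.cos θ, r * Real.sin θ))) :=
          lintegral_halfplane (F := fun p => ENNReal.ofReal (sphereArea n) *
            (ENNReal.ofReal (p.2 ^ (n - 1)) * F p)) (by fun_prop)
      _ = ∫⁻ r in Ioi (0 : ℝ), (ENNReal.ofReal (r ^ n) * (Iio (1 : ℝ)).indicator 1 r) *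
            (ENNReal.ofReal (sphereArea n) * ∫⁻ θ in Ioo 0 Real.pi,
              ENNReal.ofReal (Real.sin θ ^ (n - 1)) * k (Real.cos θ)) := by
          refine setLIntegral_congr_fun measurableSet_Ioi fun r hr => ?_
          have hr : 0 < r := hr
          rw [← lintegral_const_mul _ (by fun_prop), ← lintegral_const_mul _ (by fun_prop)]
          refine setLIntegral_congr_fun measurableSet_Ioo fun θ hθ => ?_
          have hsq : √((r * Real.cos θ) ^ 2 + (r * Real.sin θ) ^ 2) = r := by
            rw [mul_pow, mul_pow, ← mul_add, Real.cos_sq_add_sin_sq, mul_one, Real.sqrt_sq hr.le]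
          simp only [hF, hsq, mul_div_cancel_left₀ _ hr.ne']
          rw [mul_pow]
          rw [ENNReal.ofReal_mul (by positivity)]
          have : r ^ n = r * r ^ (n - 1) := by rw [← pow_succ', Nat.sub_add_cancel hn]
          rw [this, ENNReal.ofReal_mul hr.le]
          ring
      _ = _ := by
          have hm : Measurable fun r : ℝ => ENNReal.ofReal (r ^ n) *
              (Iio (1 : ℝ)).indicator 1 r :=
            (by fun_prop : Measurable fun r : ℝ => ENNReal.ofReal (r ^ n)).mul
              (measurable_one.indicator measurableSet_Iio)
          rw [lintegral_mul_const _ hm, ← hc, mul_comm c, lintegral_cos_substitution hn k,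
            ← lintegral_const_mul (ENNReal.ofReal (sphereArea n)) (by fun_prop),
            ← lintegral_indicator measurableSet_Ioo]
          congr 1
          refine lintegral_congr fun s => ?_
          by_cases hs : s ∈ Ioo (-1 : ℝ) 1
          · rw [indicator_of_mem hs, zonalDensity, indicator_of_mem hs, ← mul_assoc,
              ← ENNReal.ofReal_mul (by exact measureReal_nonneg)]
            congr 3
            push_cast
            ring_nf
          · simp [indicator_of_notMem hs, zonalDensity]
  exact (ENNReal.mul_left_inj hc0 hctop).1 (h1.symm.trans h2)

lemma lintegral_zonal {d : ℕ} (hd : 2 ≤ d) {k : ℝ → ENNReal} (hk : Measurable k) (e : Space d)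
    (he : ‖e‖ = 1) :
    ∫⁻ v, k ⟪(v : Space d), e⟫ ∂(surfaceMeasure d) =
      ∫⁻ s, ENNReal.ofReal (zonalDensity d s) * k s := by
  obtain ⟨n, rfl⟩ : ∃ n, d = n + 1 := ⟨d - 1, by omega⟩
  rw [← lintegral_zonal_aux (by omega) hk]
  exact lintegral_zonal_eq (by simp [he]) k hk

open scoped FourierTransform

/-! ### Schwartz functions determine a function almost everywhere. -/

section Uniqueness

variable {E : Type*} [NormedAddCommGroup E] [NormedSpace ℝ E] [FiniteDimensional ℝ E]
  [MeasurableSpace E] [BorelSpace E] {μ : Measure E}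

/-- A smooth real function of compact support, as a complex Schwartz function. -/
def schwartzOfCompactSupport {g : E → ℝ} (hg : ContDiff ℝ (↑(⊤ : ℕ∞)) g)
    (hc : HasCompactSupport g) : 𝓢(E, ℂ) :=
  HasCompactSupport.toSchwartzMap (f := fun x => (g x : ℂ))
    (hc.comp_left Complex.ofReal_zero) (Complex.ofRealCLM.contDiff.comp hg)

omit [FiniteDimensional ℝ E] [MeasurableSpace E] [BorelSpace E] in
@[simp]
lemma schwartzOfCompactSupport_apply {g : E → ℝ} (hg : ContDiff ℝ (↑(⊤ : ℕ∞)) g)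
    (hc : HasCompactSupport g) (x : E) : schwartzOfCompactSupport hg hc x = g x := rfl

/-- Test against a bump function that equals `1` on a ball containing the compact set. -/
lemma locallyIntegrable_of_integrable_mul_schwartz {U : E → ℂ}
    (h : ∀ φ : 𝓢(E, ℂ), Integrable (fun x => U x * φ x) μ) : LocallyIntegrable U μ := by
  rw [locallyIntegrable_iff]
  intro K hK
  obtain ⟨R, hR0, hR⟩ : ∃ R > 0, K ⊆ Metric.closedBall (0 : E) R := by
    obtain ⟨R, hR⟩ := hK.isBounded.subset_closedBall (0 : E)
    exact ⟨max R 1, by positivity, hR.trans (Metric.closedBall_subset_closedBall (le_max_left _ _))⟩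
  let b : ContDiffBump (0 : E) := ⟨R, R + 1, hR0, by linarith⟩
  have hb := h (schwartzOfCompactSupport (b.contDiff (n := (⊤ : ℕ∞))) b.hasCompactSupport)
  refine (hb.integrableOn (s := K)).congr ?_
  filter_upwards [ae_restrict_mem hK.measurableSet] with x hx
  simp [b.one_of_mem_closedBall (hR hx)]

lemma ae_eq_zero_of_integral_mul_schwartz {U : E → ℂ}
    (h : ∀ φ : 𝓢(E, ℂ), Integrable (fun x => U x * φ x) μ)
    (h0 : ∀ φ : 𝓢(E, ℂ), ∫ x, U x * φ x ∂μ = 0) : U =ᵐ[μ] 0 := by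
  refine ae_eq_zero_of_integral_contDiff_smul_eq_zero
    (locallyIntegrable_of_integrable_mul_schwartz h) fun g hg hc => ?_
  rw [← h0 (schwartzOfCompactSupport hg hc)]
  refine integral_congr_ae (ae_of_all _ fun x => ?_)
  simp [mul_comm]

lemma ae_eq_of_integral_mul_schwartz {U V : E → ℂ}
    (hU : ∀ φ : 𝓢(E, ℂ), Integrable (fun x => U x * φ x) μ)
    (hV : ∀ φ : 𝓢(E, ℂ), Integrable (fun x => V x * φ x) μ)
    (h : ∀ φ : 𝓢(E, ℂ), ∫ x, U x * φ x ∂μ = ∫ x, V x * φ x ∂μ) : U =ᵐ[μ] V := by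
  have h1 : ∀ φ : 𝓢(E, ℂ), (fun x => (U - V) x * φ x) = fun x => U x * φ x - V x * φ x := by
    intro φ
    ext x
    simp [sub_mul]
  have := ae_eq_zero_of_integral_mul_schwartz (U := U - V) (μ := μ)
    (fun φ => by rw [h1]; exact (hU φ).sub (hV φ))
    (fun φ => by rw [h1, integral_sub (hU φ) (hV φ), h φ, sub_self])
  filter_upwards [this] with x hx
  exact sub_eq_zero.1 hx

end Uniqueness

/-! ### The `L²` Fourier transform with kernel `e^{-iξ·x}`. -/

section Fourier

variable {E : Type*} [NormedAddCommGroup E] [InnerProductSpace ℝ E] [MeasurableSpace E]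
  [BorelSpace E] [FiniteDimensional ℝ E]

/-- The Fourier transform `∫ φ(ξ) e^{-i ξ·x} dξ`. -/
def angFourier (φ : E → ℂ) (x : E) : ℂ := ∫ ξ, φ ξ * Complex.exp (-(Complex.I * ((⟪ξ, x⟫ : ℝ) : ℂ)))

lemma angFourier_eq (φ : E → ℂ) (x : E) : angFourier φ x = 𝓕 φ ((2 * Real.pi)⁻¹ • x) := by
  rw [angFourier, Real.fourier_eq']
  refine integral_congr_ae (ae_of_all _ fun ξ => ?_)
  have : (-2 * Real.pi * ⟪ξ, (2 * Real.pi)⁻¹ • x⟫ : ℝ) = - ⟪ξ, x⟫ := by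
    rw [inner_smul_right]
    field_simp
  simp only [this, smul_eq_mul]
  rw [mul_comm]
  congr 2
  push_cast
  ring

/-- The Fourier transform of a Schwartz function as a Schwartz function. -/
def angFourierSchwartz (φ : 𝓢(E, ℂ)) : 𝓢(E, ℂ) :=
  SchwartzMap.compCLMOfContinuousLinearEquiv ℂ
    (ContinuousLinearEquiv.smulLeft (Units.mk0 ((2 * Real.pi)⁻¹ : ℝ) (by positivity))) (𝓕 φ)

lemma angFourierSchwartz_apply (φ : 𝓢(E, ℂ)) (x : E) : angFourierSchwartz φ x = angFourier φ x := by
  rw [angFourier_eq]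
  rfl

lemma lintegral_comp_smul_pos (f : E → ENNReal) {c : ℝ} (hc : 0 < c) :
    ∫⁻ x, f (c • x) = ENNReal.ofReal ((c ^ Module.finrank ℝ E)⁻¹) * ∫⁻ x, f x := by
  have hemb : MeasurableEmbedding fun x : E => c • x :=
    (Homeomorph.smulOfNeZero c hc.ne').measurableEmbedding
  have := Measure.map_addHaar_smul (volume : Measure E) hc.ne'
  rw [← hemb.lintegral_map, this, lintegral_smul_measure, abs_of_pos (by positivity)]
  rfl

lemma memLp_comp_smul_pos {f : E → ℂ} (hf : MemLp f 2) {c : ℝ} (hc : 0 < c) :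
    MemLp (fun x => f (c • x)) 2 := by
  have hemb : MeasurableEmbedding fun x : E => c • x :=
    (Homeomorph.smulOfNeZero c hc.ne').measurableEmbedding
  have := Measure.map_addHaar_smul (volume : Measure E) hc.ne'
  refine (hemb.memLp_map_measure_iff (g := f)).1 ?_
  rw [this]
  exact hf.smul_measure ENNReal.ofReal_ne_top

/-- `h` and `k` are square integrable and `k` is the Fourier transform of `h`. -/
def IsL2Fourier (h k : E → ℂ) : Prop :=
  MemLp h 2 ∧ MemLp k 2 ∧ ∀ φ : 𝓢(E, ℂ), ∫ x, k x * φ x = ∫ x, h x * angFourier φ x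

lemma integrable_mul_schwartz {F : Type*} [NormedAddCommGroup F] [NormedSpace ℝ F]
    [FiniteDimensional ℝ F] [MeasurableSpace F] [BorelSpace F] {μ : Measure F}
    [μ.HasTemperateGrowth] {h : F → ℂ} (hh : MemLp h 2 μ) (φ : 𝓢(F, ℂ)) :
    Integrable (fun x => h x * φ x) μ :=
  MemLp.integrable_mul hh (φ.memLp 2 μ)

lemma lintegral_enorm_sq_eq_norm {α : Type*} [MeasurableSpace α] {μ : Measure α} {f : α → ℂ}
    (hf : MemLp f 2 μ) : ∫⁻ x, ‖f x‖ₑ ^ 2 ∂μ = ENNReal.ofReal (‖hf.toLp f‖ ^ 2) := by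
  rw [Lp.norm_toLp, ENNReal.ofReal_pow (by positivity), ENNReal.ofReal_toReal hf.2.ne,
    eLpNorm_eq_lintegral_rpow_enorm_toReal (by simp) (by simp)]
  simp only [ENNReal.toReal_ofNat, ENNReal.rpow_ofNat, one_div]
  rw [← ENNReal.rpow_natCast, ← ENNReal.rpow_mul]
  simp

/-- The transform `𝓕` has kernel `e^{-2πi x·ξ}`, and substituting `x ↦ 2πx` converts one
normalisation into the other. The duality is that of `𝓕` on tempered distributions. In the norm
identity the factor is `(2π)^{2n}` from the prefactor times `(2π)^{-n}` from the dilation. -/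
lemma isL2Fourier_of_fourier_Lp {h k : E → ℂ} (hh : MemLp h 2) (hk : MemLp k 2)
    (hkh : k =ᵐ[volume] fun x => ((2 * Real.pi : ℝ) ^ Module.finrank ℝ E : ℂ) *
      (𝓕 ((memLp_comp_smul_pos hh Real.two_pi_pos).toLp _) : Lp ℂ 2 (volume : Measure E)) x) :
    IsL2Fourier h k ∧ ∫⁻ x, ‖k x‖ₑ ^ 2 =
      ENNReal.ofReal ((2 * Real.pi) ^ Module.finrank ℝ E) * ∫⁻ x, ‖h x‖ₑ ^ 2 := by
  set n := Module.finrank ℝ E with hn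
  have hH := memLp_comp_smul_pos hh Real.two_pi_pos
  set H := hH.toLp _ with hHdef
  refine ⟨⟨hh, hk, fun φ => ?_⟩, ?_⟩
  · calc ∫ x, k x * φ x = ∫ x, ((2 * Real.pi : ℝ) ^ n : ℂ) *
          (φ x • (𝓕 H : Lp ℂ 2 (volume : Measure E)) x) := by
          refine integral_congr_ae ?_
          filter_upwards [hkh] with x hx
          rw [hx, smul_eq_mul]
          ring
      _ = ((2 * Real.pi : ℝ) ^ n : ℂ) * ∫ x, (φ x • (𝓕 H : Lp ℂ 2 (volume : Measure E)) x) :=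
          integral_const_mul _ _
      _ = ((2 * Real.pi : ℝ) ^ n : ℂ) * ∫ x, (𝓕 φ) x • H x := by
          congr 1
          rw [← Lp.toTemperedDistribution_apply, ← Lp.fourier_toTemperedDistribution_eq,
            TemperedDistribution.fourier_apply, Lp.toTemperedDistribution_apply]
      _ = ((2 * Real.pi : ℝ) ^ n : ℂ) * ∫ x, h ((2 * Real.pi) • x) *
            angFourier φ ((2 * Real.pi) • x) := by
          congr 1
          refine integral_congr_ae ?_
          filter_upwards [hH.coeFn_toLp] with x hx
          rw [hHdef, hx, angFourier_eq, smul_smul, inv_mul_cancel₀ (by positivity), one_smul,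
            SchwartzMap.fourier_coe, smul_eq_mul, mul_comm]
      _ = _ := by
          rw [Measure.integral_comp_smul volume (fun x => h x * angFourier φ x),
            abs_of_pos (by positivity), Complex.real_smul, ← mul_assoc, ← hn]
          push_cast
          rw [mul_inv_cancel₀ (by simp [Real.pi_ne_zero]), one_mul]
  · have h1 : ∫⁻ x, ‖(𝓕 H : Lp ℂ 2 (volume : Measure E)) x‖ₑ ^ 2 =
        ENNReal.ofReal (((2 * Real.pi) ^ n)⁻¹) * ∫⁻ x, ‖h x‖ₑ ^ 2 := by
      rw [lintegral_enorm_sq_eq_norm (Lp.memLp _), Lp.toLp_coeFn, Lp.norm_fourier_eq, hHdef,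
        ← lintegral_enorm_sq_eq_norm, lintegral_comp_smul_pos (fun x => ‖h x‖ₑ ^ 2) Real.two_pi_pos]
    rw [lintegral_congr_ae (g := fun x => ENNReal.ofReal ((2 * Real.pi) ^ n) ^ 2 *
      ‖(𝓕 H : Lp ℂ 2 (volume : Measure E)) x‖ₑ ^ 2), lintegral_const_mul', h1, ← mul_assoc,
      ← ENNReal.ofReal_pow (by positivity), ← ENNReal.ofReal_mul (by positivity)]
    · congr 2
      field_simp
    · simp
    · filter_upwards [hkh] with x hx
      rw [hx, enorm_mul, mul_pow]
      congr 2
      rw [← Complex.ofReal_pow, ← ofReal_norm, Complex.norm_real, Real.norm_of_nonneg]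
      positivity

lemma exists_isL2Fourier {h : E → ℂ} (hh : MemLp h 2) :
    ∃ k, IsL2Fourier h k ∧ ∫⁻ x, ‖k x‖ₑ ^ 2 =
      ENNReal.ofReal ((2 * Real.pi) ^ Module.finrank ℝ E) * ∫⁻ x, ‖h x‖ₑ ^ 2 :=
  ⟨_, isL2Fourier_of_fourier_Lp hh ((Lp.memLp _).const_mul _) Filter.EventuallyEq.rfl⟩

lemma exists_isL2Fourier_symm {k : E → ℂ} (hk : MemLp k 2) : ∃ h, IsL2Fourier h k := by
  set c : ℂ := ((2 * Real.pi : ℝ) ^ Module.finrank ℝ E : ℂ) with hc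
  have hc0 : c ≠ 0 := by simp [hc, Real.pi_ne_zero]
  set G : Lp ℂ 2 (volume : Measure E) := 𝓕⁻ ((hk.const_mul c⁻¹).toLp _) with hG
  have hh : MemLp (fun x => G ((2 * Real.pi)⁻¹ • x)) 2 :=
    memLp_comp_smul_pos (Lp.memLp G) (inv_pos.2 Real.two_pi_pos)
  refine ⟨_, (isL2Fourier_of_fourier_Lp hh hk ?_).1⟩
  have h1 : (memLp_comp_smul_pos hh Real.two_pi_pos).toLp _ = G := by
    apply Lp.ext
    filter_upwards [MemLp.coeFn_toLp (memLp_comp_smul_pos hh Real.two_pi_pos)] with x hx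
    rw [hx, smul_smul, inv_mul_cancel₀ (by positivity), one_smul]
  rw [h1, hG, FourierTransform.fourier_fourierInv_eq]
  filter_upwards [MemLp.coeFn_toLp (hk.const_mul c⁻¹)] with x hx
  rw [hx, ← hc, ← mul_assoc, mul_inv_cancel₀ hc0, one_mul]

lemma IsL2Fourier.ae_eq {h k k' : E → ℂ} (h1 : IsL2Fourier h k) (h2 : IsL2Fourier h k') :
    k =ᵐ[volume] k' :=
  ae_eq_of_integral_mul_schwartz (integrable_mul_schwartz h1.2.1)
    (integrable_mul_schwartz h2.2.1) fun φ => (h1.2.2 φ).trans (h2.2.2 φ).symm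

lemma IsL2Fourier.lintegral_eq {h k : E → ℂ} (hk : IsL2Fourier h k) : ∫⁻ x, ‖k x‖ₑ ^ 2 =
    ENNReal.ofReal ((2 * Real.pi) ^ Module.finrank ℝ E) * ∫⁻ x, ‖h x‖ₑ ^ 2 := by
  obtain ⟨k', hk', h'⟩ := exists_isL2Fourier hk.1
  rw [← h']
  refine lintegral_congr_ae ?_
  filter_upwards [hk.ae_eq hk'] with x hx
  rw [hx]

lemma IsL2Fourier.integrable_right {h k : E → ℂ} (hk : IsL2Fourier h k) (φ : 𝓢(E, ℂ)) :
    Integrable fun x => h x * angFourier φ x := by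
  simp_rw [← angFourierSchwartz_apply]
  exact integrable_mul_schwartz hk.1 _

lemma IsL2Fourier.sub {h k h' k' : E → ℂ} (h1 : IsL2Fourier h k) (h2 : IsL2Fourier h' k') :
    IsL2Fourier (h - h') (k - k') := by
  refine ⟨h1.1.sub h2.1, h1.2.1.sub h2.2.1, fun φ => ?_⟩
  simp only [Pi.sub_apply, sub_mul]
  rw [integral_sub (integrable_mul_schwartz h1.2.1 φ) (integrable_mul_schwartz h2.2.1 φ),
    integral_sub (h1.integrable_right φ) (h2.integrable_right φ), h1.2.2, h2.2.2]

lemma IsL2Fourier.congr {h k h' k' : E → ℂ} (h1 : IsL2Fourier h k) (hh : h =ᵐ[volume] h')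
    (hk : k =ᵐ[volume] k') : IsL2Fourier h' k' := by
  refine ⟨h1.1.ae_eq hh, h1.2.1.ae_eq hk, fun φ => ?_⟩
  calc ∫ x, k' x * φ x = ∫ x, k x * φ x :=
        integral_congr_ae (hk.mono fun x hx => by simp only [hx])
    _ = ∫ x, h x * angFourier φ x := h1.2.2 φ
    _ = _ := integral_congr_ae (hh.mono fun x hx => by simp only [hx])

/-- Plancherel applied to `h - h'`, whose transform is zero. -/
lemma IsL2Fourier.ae_eq_left {h h' k : E → ℂ} (h1 : IsL2Fourier h k) (h2 : IsL2Fourier h' k) :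
    h =ᵐ[volume] h' := by
  have h3 := (h1.sub h2).lintegral_eq
  simp only [sub_self, Pi.zero_apply, enorm_zero, ne_eq, OfNat.ofNat_ne_zero, not_false_eq_true,
    zero_pow, lintegral_zero] at h3
  have h4 := (mul_eq_zero.1 h3.symm).resolve_left
    (ENNReal.ofReal_pos.2 (by positivity)).ne'
  rw [lintegral_eq_zero_iff' ((h1.1.sub h2.1).1.enorm.pow_const 2)] at h4
  filter_upwards [h4] with x hx
  simpa [sub_eq_zero] using hx

lemma norm_exp_neg_I_mul (a : ℝ) : ‖Complex.exp (-(Complex.I * (a : ℂ)))‖ = 1 := by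
  rw [Complex.norm_exp]
  simp

lemma continuous_angFourier {h : E → ℂ} (h1 : Integrable h) : Continuous (angFourier h) := by
  refine continuous_of_dominated (bound := fun ξ => ‖h ξ‖) (fun x => ?_) (fun x => ?_) h1.norm ?_
  · exact h1.1.mul (Continuous.aestronglyMeasurable (by fun_prop))
  · refine ae_of_all _ fun ξ => ?_
    rw [norm_mul, norm_exp_neg_I_mul, mul_one]
  · exact ae_of_all _ fun ξ => by fun_prop

lemma norm_angFourier_le {h : E → ℂ} (x : E) : ‖angFourier h x‖ ≤ ∫ ξ, ‖h ξ‖ := by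
  refine (norm_integral_le_integral_norm _).trans_eq ?_
  refine integral_congr_ae (ae_of_all _ fun ξ => ?_)
  simp only [norm_mul, norm_exp_neg_I_mul, mul_one]

lemma integral_angFourier_mul {h φ : E → ℂ} (h1 : Integrable h) (hφ : Integrable φ) :
    ∫ x, angFourier h x * φ x = ∫ x, h x * angFourier φ x := by
  have hint : Integrable (Function.uncurry fun x ξ : E =>
      h ξ * Complex.exp (-(Complex.I * ((⟪ξ, x⟫ : ℝ) : ℂ))) * φ x) (volume.prod volume) := by
    refine (hφ.mul_prod h1).mono ?_ (ae_of_all _ fun p => ?_)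
    · refine (AEStronglyMeasurable.mul (h1.1.comp_snd) ?_).mul hφ.1.comp_fst
      exact Continuous.aestronglyMeasurable (by fun_prop)
    · simp only [Function.uncurry, norm_mul, norm_exp_neg_I_mul]
      rw [mul_one, mul_comm]
  simp only [angFourier, ← integral_mul_const, ← integral_const_mul]
  rw [integral_integral_swap hint]
  refine integral_congr_ae (ae_of_all _ fun ξ => integral_congr_ae (ae_of_all _ fun x => ?_))
  simp only
  rw [real_inner_comm]
  ring

/-- For integrable functions the `L²` Fourier transform is given by the integral. -/
lemma isL2Fourier_angFourier {h : E → ℂ} (hh : MemLp h 2) (h1 : Integrable h) :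
    IsL2Fourier h (angFourier h) := by
  obtain ⟨k, hk, -⟩ := exists_isL2Fourier hh
  refine hk.congr Filter.EventuallyEq.rfl (ae_eq_of_integral_mul_schwartz
    (integrable_mul_schwartz hk.2.1) (fun φ => ?_) fun φ => ?_)
  · exact φ.integrable.bdd_mul (continuous_angFourier h1).aestronglyMeasurable
      (ae_of_all _ norm_angFourier_le)
  · rw [hk.2.2, integral_angFourier_mul h1 φ.integrable]

end Fourier

/-! ### Fourier transform and Plancherel on space-time. -/

section SpaceTime

variable {d : ℕ}

instance : (volume : Measure (Space d × ℝ)).IsAddHaarMeasure :=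
  inferInstanceAs ((volume : Measure (Space d)).prod (volume : Measure ℝ)).IsAddHaarMeasure

/-- Space-time with its Euclidean norm. -/
abbrev SpaceTime (d : ℕ) : Type := WithLp 2 (Space d × ℝ)

/-- The identity map between the Euclidean and the maximum norm on space-time. -/
def spaceTimeEquiv (d : ℕ) : SpaceTime d ≃L[ℝ] Space d × ℝ :=
  WithLp.prodContinuousLinearEquiv 2 ℝ (Space d) ℝ

lemma measurePreserving_spaceTimeEquiv : MeasurePreserving (spaceTimeEquiv d) volume volume :=
  WithLp.volume_preserving_ofLp (Space d) ℝ

lemma measurableEmbedding_spaceTimeEquiv : MeasurableEmbedding (spaceTimeEquiv d) :=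
  (spaceTimeEquiv d).toHomeomorph.measurableEmbedding

lemma finrank_spaceTime : Module.finrank ℝ (SpaceTime d) = d + 1 := by
  rw [(spaceTimeEquiv d).toLinearEquiv.finrank_eq]
  simp

/-- The product `Space d × ℝ` carries the maximum norm and no inner product. This identity carries
the `L²` theory over from the Euclidean copy `SpaceTime d`. -/
lemma spaceTimeFourier_eq_angFourier (φ : 𝓢(Space d × ℝ, ℂ)) (x : SpaceTime d) :
    spaceTimeFourier φ (spaceTimeEquiv d x) = angFourier (fun y => φ (spaceTimeEquiv d y)) x := by
  rw [spaceTimeFourier, angFourier, ← measurePreserving_spaceTimeEquiv.integral_comp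
    measurableEmbedding_spaceTimeEquiv]
  refine integral_congr_ae (ae_of_all _ fun y => ?_)
  simp [spaceTimeEquiv, WithLp.prod_inner_apply, mul_comm]

/-- Composition of a Schwartz function with the identity from the Euclidean norm. -/
def toSpaceTime (φ : 𝓢(Space d × ℝ, ℂ)) : 𝓢(SpaceTime d, ℂ) :=
  SchwartzMap.compCLMOfContinuousLinearEquiv ℂ (spaceTimeEquiv d) φ

/-- Composition of a Schwartz function with the identity to the Euclidean norm. -/
def ofSpaceTime (φ : 𝓢(SpaceTime d, ℂ)) : 𝓢(Space d × ℝ, ℂ) :=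
  SchwartzMap.compCLMOfContinuousLinearEquiv ℂ (spaceTimeEquiv d).symm φ

/-- The space-time Fourier transform of a Schwartz function as a Schwartz function. -/
def spaceTimeFourierSchwartz (φ : 𝓢(Space d × ℝ, ℂ)) : 𝓢(Space d × ℝ, ℂ) :=
  ofSpaceTime (angFourierSchwartz (toSpaceTime φ))

lemma spaceTimeFourierSchwartz_apply (φ : 𝓢(Space d × ℝ, ℂ)) (z : Space d × ℝ) :
    spaceTimeFourierSchwartz φ z = spaceTimeFourier φ z := by
  obtain ⟨x, rfl⟩ := (spaceTimeEquiv d).surjective z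
  rw [spaceTimeFourier_eq_angFourier]
  simp only [spaceTimeFourierSchwartz, ofSpaceTime,
    SchwartzMap.compCLMOfContinuousLinearEquiv_apply, Function.comp_apply,
    ContinuousLinearEquiv.symm_apply_apply, angFourierSchwartz_apply]
  rfl

lemma memLp_comp_spaceTimeEquiv {f : Space d × ℝ → ℂ} :
    MemLp (fun x => f (spaceTimeEquiv d x)) 2 ↔ MemLp f 2 := by
  have := measurableEmbedding_spaceTimeEquiv.memLp_map_measure_iff (μ := volume) (g := f) (p := 2)
  rw [measurePreserving_spaceTimeEquiv.map_eq] at this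
  exact this.symm

lemma hasFourierTransform_of_isL2Fourier {w V : Space d × ℝ → ℂ}
    (h : IsL2Fourier (fun x => w (spaceTimeEquiv d x)) fun x => V (spaceTimeEquiv d x)) :
    HasFourierTransform w V := by
  intro φ
  refine ⟨?_, integrable_mul_schwartz (memLp_comp_spaceTimeEquiv.1 h.2.1) φ, ?_⟩
  · simp_rw [← spaceTimeFourierSchwartz_apply]
    exact integrable_mul_schwartz (memLp_comp_spaceTimeEquiv.1 h.1) _
  · rw [← measurePreserving_spaceTimeEquiv.integral_comp measurableEmbedding_spaceTimeEquiv,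
      ← measurePreserving_spaceTimeEquiv.integral_comp measurableEmbedding_spaceTimeEquiv]
    simp_rw [spaceTimeFourier_eq_angFourier]
    exact (h.2.2 (toSpaceTime φ)).symm

/-- The transform chosen inside `IsHyperbolicDerivative` is existential. By uniqueness it may be
replaced by the explicit one. -/
lemma HasFourierTransform.ae_eq {u U V : Space d × ℝ → ℂ} (h1 : HasFourierTransform u U)
    (h2 : HasFourierTransform u V) : U =ᵐ[volume] V :=
  ae_eq_of_integral_mul_schwartz (fun φ => (h1 φ).2.1) (fun φ => (h2 φ).2.1)
    fun φ => (h1 φ).2.2.symm.trans (h2 φ).2.2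

lemma HasFourierTransform.congr_right {u U V : Space d × ℝ → ℂ} (h : HasFourierTransform u U)
    (hUV : U =ᵐ[volume] V) : HasFourierTransform u V := by
  intro φ
  have h1 : (fun ζ => U ζ * φ ζ) =ᵐ[volume] fun ζ => V ζ * φ ζ :=
    hUV.mono fun x hx => by simp only [hx]
  exact ⟨(h φ).1, (h φ).2.1.congr h1, (h φ).2.2.trans (integral_congr_ae h1)⟩

/-- Plancherel's theorem on space-time. -/
lemma HasFourierTransform.lintegral_eq {w V : Space d × ℝ → ℂ} (hw : MemLp w 2)
    (h : HasFourierTransform w V) :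
    ∫⁻ ζ, ‖V ζ‖ₑ ^ 2 = ENNReal.ofReal ((2 * Real.pi) ^ (d + 1)) * ∫⁻ z, ‖w z‖ₑ ^ 2 := by
  obtain ⟨k, hk, hnorm⟩ := exists_isL2Fourier (memLp_comp_spaceTimeEquiv.2 hw)
  have hk' : k = fun x => (k ∘ (spaceTimeEquiv d).symm) (spaceTimeEquiv d x) := by
    ext x
    simp
  rw [hk'] at hk hnorm
  have h2 := hasFourierTransform_of_isL2Fourier hk
  have hemb := measurableEmbedding_spaceTimeEquiv (d := d)
  rw [finrank_spaceTime, measurePreserving_spaceTimeEquiv.lintegral_comp_emb hemb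
      (fun z => ‖(k ∘ (spaceTimeEquiv d).symm) z‖ₑ ^ 2),
    measurePreserving_spaceTimeEquiv.lintegral_comp_emb hemb (fun z => ‖w z‖ₑ ^ 2)] at hnorm
  rw [← hnorm]
  exact lintegral_congr_ae ((h.ae_eq h2).mono fun x hx => by simp only [hx])

lemma exists_hasFourierTransform {V : Space d × ℝ → ℂ} (hV : MemLp V 2) :
    ∃ w, MemLp w 2 ∧ HasFourierTransform w V := by
  obtain ⟨h, hh⟩ := exists_isL2Fourier_symm (memLp_comp_spaceTimeEquiv.2 hV)
  have h' : h = fun x => (h ∘ (spaceTimeEquiv d).symm) (spaceTimeEquiv d x) := by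
    ext x
    simp
  rw [h'] at hh
  exact ⟨_, memLp_comp_spaceTimeEquiv.1 hh.1, hasFourierTransform_of_isL2Fourier hh⟩

end SpaceTime

/-! ### Radial profiles and the Fourier transform in `x`. -/

section PartialFourier

variable {d : ℕ}

lemma surfaceMeasure_ne_zero [NeZero d] : surfaceMeasure d ≠ 0 :=
  Measure.toSphere_ne_zero _

lemma measurePreserving_polarMap_space [NeZero d] : MeasurePreserving (polarMap (Space d))
    ((surfaceMeasure d).prod (Measure.volumeIoiPow (d - 1))) volume := by
  have := measurePreserving_polarMap (volume : Measure (Space d))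
  rwa [finrank_euclideanSpace, Fintype.card_fin] at this

lemma norm_polarMap (p : UnitSphere d × Ioi (0 : ℝ)) : ‖polarMap (Space d) p‖ = p.2 := by
  have : (0 : ℝ) < p.2 := p.2.2
  simp [polarMap, norm_smul, abs_of_pos this]

/-- A function in `L2RadX` has a measurable radial profile. -/
lemma exists_measurable_profile [NeZero d] {f : Space d × UnitSphere d → ℂ} (hf : f ∈ L2RadX d) :
    ∃ F : ℝ × UnitSphere d → ℂ, Measurable F ∧
      f =ᵐ[phaseMeasure d] fun p => F (‖p.1‖, p.2) := by
  obtain ⟨hf2, f₀, hf₀⟩ := hf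
  set fm := hf2.1.mk f with hfm
  have hfmm : Measurable fm := hf2.1.stronglyMeasurable_mk.measurable
  have h1 : ∀ᵐ p ∂(phaseMeasure d), fm p = f₀ ‖p.1‖ p.2 := by
    filter_upwards [hf₀, hf2.1.ae_eq_mk] with p h1 h2
    rw [← h1, h2]
  have hQ : MeasurePreserving (Prod.map (polarMap (Space d)) (id : UnitSphere d → UnitSphere d))
      (((surfaceMeasure d).prod (Measure.volumeIoiPow (d - 1))).prod (surfaceMeasure d))
      (phaseMeasure d) := measurePreserving_polarMap_space.prod (MeasurePreserving.id _)
  have hassoc := measurePreserving_prodAssoc (surfaceMeasure d) (Measure.volumeIoiPow (d - 1))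
    (surfaceMeasure d)
  have hQ' := hQ.comp (hassoc.symm MeasurableEquiv.prodAssoc)
  have h2 := hQ'.quasiMeasurePreserving.ae h1
  have h3 := Measure.ae_ae_of_ae_prod h2
  have : NeZero (surfaceMeasure d) := ⟨surfaceMeasure_ne_zero⟩
  -- The given profile `f₀` need not be measurable. Freezing one good direction `ω₀` replaces it by
  -- the restriction of the measurable `fm` to a ray.
  obtain ⟨ω₀, hω₀⟩ := h3.exists
  refine ⟨fun q => fm (q.1 • (ω₀ : Space d), q.2), hfmm.comp (by fun_prop), ?_⟩
  have h4 : fm =ᵐ[phaseMeasure d] fun p => fm (‖p.1‖ • (ω₀ : Space d), p.2) := by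
    rw [← hQ'.map_eq, Filter.EventuallyEq, ae_map_iff hQ'.measurable.aemeasurable]
    · have h5 := (Measure.quasiMeasurePreserving_snd (μ := surfaceMeasure d)
        (ν := (Measure.volumeIoiPow (d - 1)).prod (surfaceMeasure d))).ae hω₀
      filter_upwards [h2, h5] with q hq1 hq2
      rw [hq1]
      simp only [Function.comp, MeasurableEquiv.prodAssoc, MeasurableEquiv.symm_mk,
        MeasurableEquiv.coe_mk, Equiv.prodAssoc_symm_apply, Prod.map, norm_polarMap, id] at hq2 ⊢
      exact hq2.symm
    · exact measurableSet_eq_fun hfmm (hfmm.comp (by fun_prop))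
  exact hf2.1.ae_eq_mk.trans h4

lemma angFourier_radial {h : ℝ → ℂ} {ξ ξ' : Space d} (hξ : ‖ξ‖ = ‖ξ'‖) :
    angFourier (fun x : Space d => h ‖x‖) ξ = angFourier (fun x : Space d => h ‖x‖) ξ' := by
  obtain ⟨L, rfl⟩ := exists_isometry_map_eq hξ
  rw [angFourier, angFourier, ← L.measurePreserving.integral_comp
    L.toHomeomorph.measurableEmbedding
    (fun x => h ‖x‖ * Complex.exp (-(Complex.I * ((⟪x, L ξ⟫ : ℝ) : ℂ))))]
  simp

/-- The partial Fourier transform in `x` of a square integrable function radial in `x`. -/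
lemma exists_partialFourier [NeZero d] {F : ℝ × UnitSphere d → ℂ} (hF : Measurable F)
    (hF2 : MemLp (fun p : Space d × UnitSphere d => F (‖p.1‖, p.2)) 2 (phaseMeasure d)) :
    ∃ G : ℝ × UnitSphere d → ℂ, Measurable G ∧ ∀ᵐ v ∂(surfaceMeasure d),
      IsL2Fourier (fun x : Space d => F (‖x‖, v)) (fun ξ : Space d => G (‖ξ‖, v)) := by
  have hfin : ∫⁻ p : Space d × UnitSphere d, ‖F (‖p.1‖, p.2)‖ₑ ^ 2 ∂(phaseMeasure d) < ⊤ := by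
    rw [lintegral_enorm_sq_eq_norm hF2]
    exact ENNReal.ofReal_lt_top
  -- A slicewise `L²` transform is defined only up to null sets and carries no joint measurability
  -- in `(ξ,v)`. Truncation to `‖x‖ ≤ n` makes almost every slice integrable, and the transforms are
  -- then honest parameter integrals, which are jointly measurable.
  set Fn : ℕ → ℝ × UnitSphere d → ℂ := fun n q => (Iic (n : ℝ)).indicator 1 q.1 * F q with hFn
  have hFnm : ∀ n, Measurable (Fn n) := fun n =>
    ((measurable_one.indicator measurableSet_Iic).comp measurable_fst).mul hF
  have hdiff : ∀ n q, ‖F q - Fn n q‖ₑ ^ 2 ≤ ‖F q‖ₑ ^ 2 := by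
    intro n q
    by_cases h : q.1 ∈ Iic (n : ℝ) <;> simp [hFn, h]
  have hdiffm : ∀ n, Measurable fun p : Space d × UnitSphere d =>
      ‖F (‖p.1‖, p.2) - Fn n (‖p.1‖, p.2)‖ₑ ^ 2 := fun n =>
    ((hF.sub (hFnm n)).comp (by fun_prop : Measurable fun p : Space d × UnitSphere d =>
      (‖p.1‖, p.2))).enorm.pow_const 2
  have hlim : Filter.Tendsto (fun n => ∫⁻ p : Space d × UnitSphere d,
      ‖F (‖p.1‖, p.2) - Fn n (‖p.1‖, p.2)‖ₑ ^ 2 ∂(phaseMeasure d)) Filter.atTop (nhds 0) := by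
    have := tendsto_lintegral_of_dominated_convergence (μ := phaseMeasure d)
      (F := fun n (p : Space d × UnitSphere d) => ‖F (‖p.1‖, p.2) - Fn n (‖p.1‖, p.2)‖ₑ ^ 2)
      (f := fun _ => 0) (fun p => ‖F (‖p.1‖, p.2)‖ₑ ^ 2) hdiffm
      (fun n => ae_of_all _ fun p => hdiff n _) hfin.ne (ae_of_all _ fun p => ?_)
    · simpa using this
    · refine tendsto_const_nhds.congr' ?_
      obtain ⟨m, hm⟩ := exists_nat_ge ‖p.1‖
      filter_upwards [Filter.eventually_ge_atTop m] with n hn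
      have : ‖p.1‖ ∈ Iic (n : ℝ) := hm.trans (by exact_mod_cast hn)
      simp [hFn, this]
  -- Summable errors along a subsequence give convergence almost everywhere, so that a pointwise
  -- limit can serve as `G`.
  have hex : ∀ k : ℕ, ∃ n, ∫⁻ p : Space d × UnitSphere d,
      ‖F (‖p.1‖, p.2) - Fn n (‖p.1‖, p.2)‖ₑ ^ 2 ∂(phaseMeasure d) ≤ (2⁻¹ : ENNReal) ^ k := by
    intro k
    exact (hlim.eventually_le_const (ENNReal.pow_pos (by simp) k)).exists
  choose N hN using hex
  set g : ℕ → ℝ × UnitSphere d → ℂ := fun k q =>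
    angFourier (fun x : Space d => Fn (N k) (‖x‖, q.2)) (q.1 • EuclideanSpace.single 0 1) with hg
  have hgm : ∀ k, StronglyMeasurable (g k) := by
    intro k
    refine StronglyMeasurable.integral_prod_right'
      (f := fun q : (ℝ × UnitSphere d) × Space d => Fn (N k) (‖q.2‖, q.1.2) *
        Complex.exp (-(Complex.I * ((⟪q.2, q.1.1 • EuclideanSpace.single 0 1⟫ : ℝ) : ℂ)))) ?_
    refine (((hFnm (N k)).comp (by fun_prop : Measurable fun q : (ℝ × UnitSphere d) × Space d =>
      (‖q.2‖, q.1.2))).mul ?_).stronglyMeasurable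
    exact (by fun_prop : Continuous fun q : (ℝ × UnitSphere d) × Space d => Complex.exp
      (-(Complex.I * ((⟪q.2, q.1.1 • EuclideanSpace.single 0 1⟫ : ℝ) : ℂ)))).measurable
  have hgrad : ∀ k (ξ : Space d) v,
      angFourier (fun x : Space d => Fn (N k) (‖x‖, v)) ξ = g k (‖ξ‖, v) := by
    intro k ξ v
    exact angFourier_radial (h := fun r => Fn (N k) (r, v)) (by simp [norm_smul])
  refine ⟨fun q => Filter.limUnder Filter.atTop fun k => g k q,
    (StronglyMeasurable.limUnder hgm).measurable, ?_⟩
  have hfin' : ∀ᵐ v ∂(surfaceMeasure d), ∫⁻ x : Space d, ‖F (‖x‖, v)‖ₑ ^ 2 < ⊤ := by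
    have hm : Measurable fun p : Space d × UnitSphere d => ‖F (‖p.1‖, p.2)‖ₑ ^ 2 :=
      (hF.comp (by fun_prop)).enorm.pow_const 2
    rw [phaseMeasure, lintegral_prod_symm' _ hm] at hfin
    exact ae_lt_top hm.lintegral_prod_left' hfin.ne
  have hsum : ∀ᵐ v ∂(surfaceMeasure d), ∑' k, ∫⁻ x : Space d,
      ‖F (‖x‖, v) - Fn (N k) (‖x‖, v)‖ₑ ^ 2 < ⊤ := by
    refine ae_lt_top (Measurable.tsum fun k => (hdiffm (N k)).lintegral_prod_left') ?_
    rw [lintegral_tsum fun k => (hdiffm (N k)).lintegral_prod_left'.aemeasurable]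
    refine ne_top_of_le_ne_top ?_ (ENNReal.tsum_le_tsum fun k => (le_of_eq ?_).trans (hN k))
    · rw [ENNReal.tsum_geometric]
      simp
    · rw [phaseMeasure, lintegral_prod_symm' _ (hdiffm (N k))]
  filter_upwards [hfin', hsum] with v hv1 hv2
  have hFv : MemLp (fun x : Space d => F (‖x‖, v)) 2 := by
    refine ⟨(hF.comp (by fun_prop)).aestronglyMeasurable, ?_⟩
    rw [eLpNorm_lt_top_iff_lintegral_rpow_enorm_lt_top (by simp) (by simp)]
    simpa using hv1
  have hFnv : ∀ k, MemLp (fun x : Space d => Fn (N k) (‖x‖, v)) 2 := by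
    intro k
    refine hFv.mono ((hFnm (N k)).comp (by fun_prop)).aestronglyMeasurable (ae_of_all _ fun x => ?_)
    by_cases h : ‖x‖ ∈ Iic (N k : ℝ)
    · simp only [hFn, indicator_of_mem h]; simp
    · simp only [hFn, indicator_of_notMem h]; simp
  have hFnv1 : ∀ k, Integrable (fun x : Space d => Fn (N k) (‖x‖, v)) := by
    intro k
    have : (fun x : Space d => Fn (N k) (‖x‖, v)) =
        (Metric.closedBall (0 : Space d) (N k)).indicator fun x => Fn (N k) (‖x‖, v) := by
      ext x
      by_cases h : ‖x‖ ∈ Iic (N k : ℝ)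
      · rw [indicator_of_mem (by simpa using h)]
      · rw [indicator_of_notMem (by simpa using h)]
        simp only [hFn, indicator_of_notMem h]; simp
    rw [this, integrable_indicator_iff measurableSet_closedBall]
    have : IsFiniteMeasure (volume.restrict (Metric.closedBall (0 : Space d) (N k))) :=
      isFiniteMeasure_restrict.2 measure_closedBall_lt_top.ne
    exact ((hFnv k).restrict _).integrable (by norm_num)
  obtain ⟨κ, hκ, -⟩ := exists_isL2Fourier hFv
  refine hκ.congr Filter.EventuallyEq.rfl ?_
  -- Plancherel in the slice transfers the summable errors to the transforms, so for almost every
  -- `ξ` the sequence `g k (‖ξ‖, v)` tends to `κ ξ`.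
  have hdist : ∀ k, ∫⁻ ξ, ‖κ ξ - g k (‖ξ‖, v)‖ₑ ^ 2 = ENNReal.ofReal
      ((2 * Real.pi) ^ Module.finrank ℝ (Space d)) *
        ∫⁻ x : Space d, ‖F (‖x‖, v) - Fn (N k) (‖x‖, v)‖ₑ ^ 2 := by
    intro k
    have := (hκ.sub (isL2Fourier_angFourier (hFnv k) (hFnv1 k))).lintegral_eq
    simpa only [Pi.sub_apply, hgrad] using this
  have hκm : ∀ k, AEMeasurable fun ξ : Space d => ‖κ ξ - g k (‖ξ‖, v)‖ₑ ^ 2 := fun k =>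
    (hκ.2.1.1.sub ((hgm k).comp_measurable
      (by fun_prop : Measurable fun ξ : Space d => (‖ξ‖, v))).aestronglyMeasurable).enorm.pow_const 2
  have hsum2 : ∀ᵐ ξ : Space d, ∑' k, ‖κ ξ - g k (‖ξ‖, v)‖ₑ ^ 2 < ⊤ := by
    refine ae_lt_top' (AEMeasurable.tsum hκm) ?_
    rw [lintegral_tsum hκm]
    simp_rw [hdist]
    rw [ENNReal.tsum_mul_left]
    exact ENNReal.mul_ne_top ENNReal.ofReal_ne_top hv2.ne
  filter_upwards [hsum2] with ξ hξ
  symm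
  refine Filter.Tendsto.limUnder_eq ?_
  have h0 := ENNReal.tendsto_atTop_zero_of_tsum_ne_top hξ.ne
  rw [tendsto_iff_edist_tendsto_0]
  have h1 := h0.ennrpow_const (1 / 2)
  simp only [edist_comm _ (κ ξ), edist_eq_enorm_sub]
  convert h1 using 2 with k
  · rw [← ENNReal.rpow_natCast, ← ENNReal.rpow_mul]
    simp
  · simp

end PartialFourier

/-! ### Disintegration of the phase measure over the slices `-v·ξ = τ`. -/

section Disintegration

open ProbabilityTheory

variable {d : ℕ}

instance : StandardBorelSpace (UnitSphere d) :=
  (Metric.isClosed_sphere (x := (0 : Space d)) (ε := 1)).measurableSet.standardBorel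

/-- The law of `(-v·ξ, v)` under the surface measure, as a kernel in `ξ`. -/
def sliceKernel (d : ℕ) : Kernel (Space d) (ℝ × UnitSphere d) :=
  (Kernel.id ×ₖ Kernel.const (Space d) (surfaceMeasure d)).map
    fun q => (-⟪(q.2 : Space d), q.1⟫, q.2)

instance : IsFiniteKernel (sliceKernel d) := by
  unfold sliceKernel
  infer_instance

lemma lintegral_sliceKernel (ξ : Space d) {f : ℝ × UnitSphere d → ENNReal} (hf : Measurable f) :
    ∫⁻ q, f q ∂(sliceKernel d ξ) =
      ∫⁻ v, f (-⟪(v : Space d), ξ⟫, v) ∂(surfaceMeasure d) := by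
  have hm : Measurable fun q : Space d × UnitSphere d => (-⟪(q.2 : Space d), q.1⟫, q.2) := by
    fun_prop
  rw [sliceKernel, Kernel.map_apply _ hm, lintegral_map hf hm,
    Kernel.prod_apply, Kernel.id_apply, Kernel.const_apply, lintegral_prod _ (by fun_prop),
    lintegral_dirac' _ ?_]
  exact (hf.comp hm).lintegral_prod_right'

lemma zonalDensity_neg (s : ℝ) : zonalDensity d (-s) = zonalDensity d s := by
  have : -s ∈ Ioo (-1 : ℝ) 1 ↔ s ∈ Ioo (-1 : ℝ) 1 := by
    constructor <;> rintro ⟨h1, h2⟩ <;> constructor <;> linarith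
  by_cases h : s ∈ Ioo (-1 : ℝ) 1
  · rw [zonalDensity, zonalDensity, indicator_of_mem h, indicator_of_mem (this.2 h), neg_sq]
  · rw [zonalDensity, zonalDensity, indicator_of_notMem h, indicator_of_notMem (fun h' => h (this.1 h'))]

lemma zonalDensity_nonneg (s : ℝ) : 0 ≤ zonalDensity d s := by
  refine mul_nonneg measureReal_nonneg (indicator_nonneg (fun x hx => ?_) s)
  exact Real.rpow_nonneg (by nlinarith [hx.1, hx.2]) _

/-- The density of `-v·ξ` under the surface measure. -/
def sliceDensity (d : ℕ) (ζ : Space d × ℝ) : ℝ := zonalDensity d (ζ.2 / ‖ζ.1‖) / ‖ζ.1‖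

lemma measurable_sliceDensity : Measurable (sliceDensity d) :=
  ((measurable_zonalDensity d).comp (by fun_prop)).div (by fun_prop)

lemma sliceDensity_nonneg (ζ : Space d × ℝ) : 0 ≤ sliceDensity d ζ :=
  div_nonneg (zonalDensity_nonneg _) (norm_nonneg _)

/-- The cosine `s = v·ξ/‖ξ‖` has the even density `zonalDensity`, and `-v·ξ = -‖ξ‖ s` rescales it.
At `ξ = 0` the law is a point mass and has no density. -/
lemma lintegral_sliceKernel_fst (hd : 2 ≤ d) {ξ : Space d} (hξ : ξ ≠ 0) {f : ℝ → ENNReal}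
    (hf : Measurable f) : ∫⁻ τ, f τ ∂((sliceKernel d).fst ξ) =
      ∫⁻ τ, ENNReal.ofReal (sliceDensity d (ξ, τ)) * f τ := by
  have hpos : 0 < ‖ξ‖ := norm_pos_iff.2 hξ
  rw [Kernel.lintegral_fst _ _ hf, lintegral_sliceKernel ξ (f := fun q => f q.1) (hf.comp measurable_fst)]
  have h1 : ∀ v : UnitSphere d, f (-⟪(v : Space d), ξ⟫) =
      (fun s => f (‖ξ‖ * -s)) ⟪(v : Space d), ‖ξ‖⁻¹ • ξ⟫ := by
    intro v
    simp only [inner_smul_right]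
    congr 1
    field_simp
  simp_rw [h1]
  rw [lintegral_zonal hd (k := fun s => f (‖ξ‖ * -s)) (by fun_prop) (‖ξ‖⁻¹ • ξ)
    (by rw [norm_smul, norm_inv, norm_norm, inv_mul_cancel₀ hpos.ne'])]
  rw [← lintegral_neg_eq_self]
  have h2 := lintegral_comp_smul_pos (E := ℝ)
    (fun τ => ENNReal.ofReal (zonalDensity d (τ / ‖ξ‖)) * f τ) hpos
  have h3 : ∀ s : ℝ, ENNReal.ofReal (zonalDensity d (-s)) * f (‖ξ‖ * - -s) =
      ENNReal.ofReal (zonalDensity d ((‖ξ‖ • s) / ‖ξ‖)) * f (‖ξ‖ • s) := by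
    intro s
    rw [zonalDensity_neg, neg_neg, smul_eq_mul, mul_div_cancel_left₀ _ hpos.ne']
  simp_rw [h3]
  rw [h2, ← lintegral_const_mul' _ _ ENNReal.ofReal_ne_top]
  refine lintegral_congr fun τ => ?_
  rw [← mul_assoc, ← ENNReal.ofReal_mul (by positivity), sliceDensity, Module.finrank_self, pow_one,
    div_eq_inv_mul (zonalDensity d _)]

/-- The law of `(ξ, -v·ξ)` under the phase measure. -/
def sliceMeasure (d : ℕ) : Measure (Space d × ℝ) :=
  volume.withDensity fun ζ => ENNReal.ofReal (sliceDensity d ζ)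

instance : SFinite (sliceMeasure d) := by
  unfold sliceMeasure
  infer_instance

instance [NeZero d] : Nonempty (UnitSphere d) :=
  ⟨⟨EuclideanSpace.single 0 1, by simp⟩⟩

/-- The conditional law of `v` given `(ξ, -v·ξ)`. -/
def velocityKernel (d : ℕ) [NeZero d] : Kernel (Space d × ℝ) (UnitSphere d) :=
  (sliceKernel d).condKernel

instance [NeZero d] : IsMarkovKernel (velocityKernel d) := by
  unfold velocityKernel
  infer_instance

instance [NeZero d] : (sliceKernel d).IsCondKernel (velocityKernel d) :=
  inferInstanceAs ((sliceKernel d).IsCondKernel (sliceKernel d).condKernel)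

/-- The map `(ξ, v) ↦ ((ξ, -v·ξ), v)`. -/
def sliceMap (p : Space d × UnitSphere d) : (Space d × ℝ) × UnitSphere d :=
  ((p.1, -⟪(p.2 : Space d), p.1⟫), p.2)

lemma measurable_sliceMap : Measurable (sliceMap (d := d)) := by
  unfold sliceMap
  fun_prop

/-- The rigorous form of inserting `δ(τ + v·ξ)`: for each `ξ ≠ 0` the law of `(-v·ξ, v)` is
disintegrated over its first coordinate, and the results are integrated in `ξ`. -/
lemma map_sliceMap [NeZero d] (hd : 2 ≤ d) :
    (phaseMeasure d).map sliceMap = (sliceMeasure d) ⊗ₘ (velocityKernel d) := by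
  refine Measure.ext_of_lintegral _ fun f hf => ?_
  have hN : Measurable fun ζ => ENNReal.ofReal (sliceDensity d ζ) :=
    measurable_sliceDensity.ennreal_ofReal
  have hinner : Measurable fun ζ : Space d × ℝ => ∫⁻ v, f (ζ, v) ∂(velocityKernel d ζ) :=
    hf.lintegral_kernel_prod_right'
  rw [lintegral_map hf measurable_sliceMap, phaseMeasure,
    lintegral_prod (fun p => f (sliceMap p)) (hf.comp measurable_sliceMap).aemeasurable, Measure.lintegral_compProd hf,
    sliceMeasure, lintegral_withDensity_eq_lintegral_mul _ hN hinner, Measure.volume_eq_prod,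
    lintegral_prod _ (hN.mul hinner).aemeasurable]
  refine lintegral_congr_ae ?_
  have h0 : ∀ᵐ ξ : Space d, ξ ≠ 0 := by
    simp [ae_iff]
  filter_upwards [h0] with ξ hξ
  have hfξ : Measurable fun q : ℝ × UnitSphere d => f ((ξ, q.1), q.2) := by fun_prop
  have h1 := lintegral_sliceKernel ξ hfξ
  rw [← (sliceKernel d).disintegrate (velocityKernel d), Kernel.lintegral_compProd _ _ _ hfξ] at h1
  have h2 : Measurable fun τ : ℝ => ∫⁻ v, f ((ξ, τ), v) ∂(velocityKernel d (ξ, τ)) :=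
    hinner.comp measurable_prodMk_left
  rw [lintegral_sliceKernel_fst hd hξ h2] at h1
  exact h1.symm

end Disintegration

/-! ### Integrable weights that dominate Schwartz functions. -/

section Decay

variable {d : ℕ}

/-- An integrable weight on `ℝ^d`. -/
def spaceWeight (x : Space d) : ℝ := (1 + ‖x‖) ^ (-((d : ℝ) + 1))

/-- An integrable weight on `ℝ`. -/
def timeWeight (t : ℝ) : ℝ := (1 + ‖t‖) ^ (-2 : ℝ)

lemma spaceWeight_nonneg (x : Space d) : 0 ≤ spaceWeight x := Real.rpow_nonneg (by positivity) _

lemma spaceWeight_le_one (x : Space d) : spaceWeight x ≤ 1 :=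
  Real.rpow_le_one_of_one_le_of_nonpos (by simp) (by linarith [(Nat.cast_nonneg d : (0 : ℝ) ≤ d)])

lemma integrable_spaceWeight : Integrable (spaceWeight (d := d)) :=
  integrable_one_add_norm (by simp)

lemma integrable_timeWeight : Integrable timeWeight :=
  integrable_one_add_norm (by simp)

lemma memLp_spaceWeight : MemLp (fun p : Space d × UnitSphere d => (spaceWeight p.1 : ℂ)) 2
    (phaseMeasure d) := by
  have h1 : MemLp (spaceWeight (d := d)) 2 := by
    rw [memLp_two_iff_integrable_sq integrable_spaceWeight.1]
    refine integrable_spaceWeight.mono (integrable_spaceWeight.1.pow 2) (ae_of_all _ fun x => ?_)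
    rw [norm_pow, Real.norm_of_nonneg (spaceWeight_nonneg x)]
    exact pow_le_of_le_one (spaceWeight_nonneg x) (spaceWeight_le_one x) two_ne_zero
  exact h1.ofReal.comp_fst (surfaceMeasure d)

/-- The slack factor `2` lets one bound serve sheared points `(ξ, τ - ξ·v)` and points `(x + tv, t)`
on a characteristic, uniformly in the unit vector `v`. The order `d + 3` is the sum of the exponents
`d + 1` and `2` of the two weights. -/
lemma exists_schwartz_bound (φ : 𝓢(Space d × ℝ, ℂ)) : ∃ C : ℝ, 0 ≤ C ∧
    ∀ (z : Space d × ℝ) (x : Space d) (t : ℝ), ‖x‖ ≤ 2 * ‖z‖ → ‖t‖ ≤ 2 * ‖z‖ →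
      ‖φ z‖ ≤ C * (spaceWeight x * timeWeight t) := by
  set B := 2 ^ (d + 3) * ((Finset.Iic (d + 3, 0)).sup fun m => SchwartzMap.seminorm ℂ m.1 m.2) φ
  refine ⟨2 ^ (d + 3) * B, by positivity, fun z x t hx ht => ?_⟩
  have h1 := SchwartzMap.one_add_le_sup_seminorm_apply (𝕜 := ℂ) (m := (d + 3, 0)) (k := d + 3)
    (n := 0) le_rfl le_rfl φ z
  rw [norm_iteratedFDeriv_zero] at h1
  have hw : spaceWeight x = ((1 + ‖x‖) ^ (d + 1))⁻¹ := by
    rw [spaceWeight, Real.rpow_neg (by positivity)]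
    norm_cast
  have ht' : timeWeight t = ((1 + ‖t‖) ^ 2)⁻¹ := by
    rw [timeWeight, Real.rpow_neg (by positivity)]
    norm_cast
  rw [hw, ht', ← mul_inv, ← div_eq_mul_inv, le_div_iff₀ (by positivity)]
  have h2 : (1 + ‖x‖) ^ (d + 1) * (1 + ‖t‖) ^ 2 ≤ 2 ^ (d + 3) * (1 + ‖z‖) ^ (d + 3) := by
    calc (1 + ‖x‖) ^ (d + 1) * (1 + ‖t‖) ^ 2
        ≤ (2 * (1 + ‖z‖)) ^ (d + 1) * (2 * (1 + ‖z‖)) ^ 2 := by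
          gcongr <;> linarith [norm_nonneg z]
      _ = _ := by rw [← pow_add, mul_pow]
  calc ‖φ z‖ * ((1 + ‖x‖) ^ (d + 1) * (1 + ‖t‖) ^ 2)
      ≤ ‖φ z‖ * (2 ^ (d + 3) * (1 + ‖z‖) ^ (d + 3)) := by gcongr
    _ = 2 ^ (d + 3) * ((1 + ‖z‖) ^ (d + 3) * ‖φ z‖) := by ring
    _ ≤ _ := by exact mul_le_mul_of_nonneg_left h1 (by positivity)

end Decay

/-! ### Integrals of a Fourier transform along characteristic lines. -/

section Inversion

open scoped FourierTransform

/-- Fourier inversion at the origin. -/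
lemma integral_angFourier {E : Type*} [NormedAddCommGroup E] [InnerProductSpace ℝ E]
    [MeasurableSpace E] [BorelSpace E] [FiniteDimensional ℝ E] {A : E → ℂ} (hA : Integrable A)
    (hc : Continuous A) (hA' : Integrable (angFourier A)) :
    ∫ t, angFourier A t = ((2 * Real.pi : ℝ) ^ Module.finrank ℝ E : ℂ) * A 0 := by
  have h1 : angFourier A = fun t => 𝓕 A ((2 * Real.pi)⁻¹ • t) := funext (angFourier_eq A)
  have h2 : Integrable (𝓕 A) := by
    rw [h1] at hA'
    exact (integrable_comp_smul_iff volume _ (by positivity)).1 hA'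
  have h3 := hA.fourierInv_fourier_eq h2 (hc.continuousAt (x := 0))
  rw [Real.fourierInv_eq'] at h3
  simp only [inner_zero_right, mul_zero, Complex.ofReal_zero, zero_mul, Complex.exp_zero,
    one_smul] at h3
  rw [h1, Measure.integral_comp_smul volume (𝓕 A), h3, abs_of_pos (by positivity),
    Complex.real_smul]
  push_cast
  rw [← inv_pow, inv_inv]

variable {d : ℕ}

lemma norm_inner_le (ξ : Space d) (v : UnitSphere d) : |⟪ξ, (v : Space d)⟫| ≤ ‖ξ‖ := by
  simpa using abs_real_inner_le_norm ξ (v : Space d)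

lemma norm_time_le_shear (ξ : Space d) (τ : ℝ) (v : UnitSphere d) :
    ‖τ‖ ≤ 2 * ‖((ξ, τ - ⟪ξ, (v : Space d)⟫) : Space d × ℝ)‖ := by
  have h1 := norm_fst_le ((ξ, τ - ⟪ξ, (v : Space d)⟫) : Space d × ℝ)
  have h2 := norm_snd_le ((ξ, τ - ⟪ξ, (v : Space d)⟫) : Space d × ℝ)
  have h3 := norm_inner_le ξ v
  simp only [Real.norm_eq_abs] at h1 h2 ⊢
  have h4 := abs_add_le (τ - ⟪ξ, (v : Space d)⟫) ⟪ξ, (v : Space d)⟫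
  rw [sub_add_cancel] at h4
  linarith

lemma norm_le_line (x : Space d) (t : ℝ) (v : UnitSphere d) :
    ‖x‖ ≤ 2 * ‖((x + t • (v : Space d), t) : Space d × ℝ)‖ := by
  have h1 := norm_fst_le ((x + t • (v : Space d), t) : Space d × ℝ)
  have h2 := norm_snd_le ((x + t • (v : Space d), t) : Space d × ℝ)
  have h4 := norm_sub_le (x + t • (v : Space d)) (t • (v : Space d))
  rw [add_sub_cancel_right, norm_smul, norm_eq_of_mem_sphere, mul_one] at h4
  simp only at h1 h2
  linarith

lemma norm_le_two_mul (ξ : Space d) (τ : ℝ) : ‖ξ‖ ≤ 2 * ‖((ξ, τ) : Space d × ℝ)‖ := by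
  have h1 := norm_fst_le ((ξ, τ) : Space d × ℝ)
  simp only at h1
  linarith [norm_nonneg ((ξ, τ) : Space d × ℝ)]

lemma norm_time_le_two_mul (ξ : Space d) (τ : ℝ) : ‖τ‖ ≤ 2 * ‖((ξ, τ) : Space d × ℝ)‖ := by
  have h1 := norm_snd_le ((ξ, τ) : Space d × ℝ)
  simp only at h1
  linarith [norm_nonneg ((ξ, τ) : Space d × ℝ)]

lemma integrable_shear (φ : 𝓢(Space d × ℝ, ℂ)) (v : UnitSphere d) :
    Integrable (fun p : Space d × ℝ => φ (p.1, p.2 - ⟪p.1, (v : Space d)⟫))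
      (volume.prod volume) := by
  obtain ⟨C, hC, hb⟩ := exists_schwartz_bound φ
  refine ((integrable_spaceWeight.mul_prod integrable_timeWeight).const_mul C).mono'
    (φ.continuous.comp (by fun_prop)).aestronglyMeasurable (ae_of_all _ fun p => ?_)
  exact hb _ _ _ (norm_le_two_mul _ _) (norm_time_le_shear _ _ _)

/-- The integral of the Fourier transform of `φ` along a characteristic line. -/
lemma integral_spaceTimeFourier_line (φ : 𝓢(Space d × ℝ, ℂ)) (v : UnitSphere d) (x : Space d) :
    ∫ t : ℝ, spaceTimeFourier φ (x + t • (v : Space d), t) =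
      (2 * Real.pi : ℝ) * angFourier (fun ξ => φ (ξ, -⟪ξ, (v : Space d)⟫)) x := by
  set e : Space d → ℂ := fun ξ => Complex.exp (-(Complex.I * ((⟪ξ, x⟫ : ℝ) : ℂ))) with he
  -- The one-dimensional transform of `A` at `t` is `φ̂(x + tv, t)`, so Fourier inversion at the
  -- origin evaluates its integral over `t` as `2π A(0)`. The continuity of `A` makes the inversion
  -- valid at that point.
  set A : ℝ → ℂ := fun τ => ∫ ξ, φ (ξ, τ - ⟪ξ, (v : Space d)⟫) * e ξ with hA
  have hec : Continuous e := by fun_prop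
  have hB : Integrable (fun p : Space d × ℝ => φ (p.1, p.2 - ⟪p.1, (v : Space d)⟫) * e p.1)
      (volume.prod volume) := by
    refine (integrable_shear φ v).mul_bdd (c := 1) (hec.comp continuous_fst).aestronglyMeasurable
      (ae_of_all _ fun p => ?_)
    simp only [he, norm_exp_neg_I_mul, le_refl]
  have hAi : Integrable A := hB.integral_prod_right
  have hAc : Continuous A := by
    obtain ⟨C, hC, hb⟩ := exists_schwartz_bound φ
    refine continuous_of_dominated (bound := fun ξ => C * (spaceWeight ξ * timeWeight 0))
      (fun τ => ?_) (fun τ => ae_of_all _ fun ξ => ?_) ?_ (ae_of_all _ fun ξ => ?_)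
    · exact ((φ.continuous.comp (by fun_prop)).mul hec).aestronglyMeasurable
    · rw [norm_mul, he, norm_exp_neg_I_mul, mul_one]
      exact hb _ _ _ (norm_le_two_mul _ _) (by simp)
    · exact (integrable_spaceWeight.mul_const _).const_mul _
    · exact (φ.continuous.comp (by fun_prop)).mul continuous_const
  have hFA : ∀ t, angFourier A t = spaceTimeFourier φ (x + t • (v : Space d), t) := by
    intro t
    set k : ℝ → ℂ := fun τ => Complex.exp (-(Complex.I * ((τ * t : ℝ) : ℂ))) with hk
    have hkc : Continuous k := by fun_prop
    have hint : Integrable (fun p : Space d × ℝ =>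
        φ (p.1, p.2 - ⟪p.1, (v : Space d)⟫) * e p.1 * k p.2) (volume.prod volume) := by
      refine hB.mul_bdd (c := 1) (hkc.comp continuous_snd).aestronglyMeasurable
        (ae_of_all _ fun p => ?_)
      simp only [hk, norm_exp_neg_I_mul, le_refl]
    have hint2 : Integrable (fun z : Space d × ℝ => φ z * Complex.exp
        (-(Complex.I * (((⟪z.1, x + t • (v : Space d)⟫ + z.2 * t : ℝ)) : ℂ))))
        (volume.prod volume) := by
      refine (φ.integrable (μ := volume)).mul_bdd (c := 1)
        (Continuous.aestronglyMeasurable (by fun_prop)) (ae_of_all _ fun p => ?_)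
      rw [norm_exp_neg_I_mul]
    calc angFourier A t = ∫ τ, ∫ ξ, φ (ξ, τ - ⟪ξ, (v : Space d)⟫) * e ξ * k τ := by
          rw [angFourier]
          refine integral_congr_ae (ae_of_all _ fun τ => ?_)
          simp only [hA, ← integral_mul_const, hk]
          congr! 7
          simp [mul_comm]
      _ = ∫ ξ, ∫ τ, φ (ξ, τ - ⟪ξ, (v : Space d)⟫) * e ξ * k τ :=
          (integral_integral_swap (f := fun ξ τ => φ (ξ, τ - ⟪ξ, (v : Space d)⟫) * e ξ * k τ)
            hint).symm
      _ = ∫ ξ, ∫ τ, φ (ξ, τ) * Complex.exp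
            (-(Complex.I * (((⟪ξ, x + t • (v : Space d)⟫ + τ * t : ℝ)) : ℂ))) := by
          refine integral_congr_ae (ae_of_all _ fun ξ => ?_)
          symm
          simp only
          -- After the shift of `τ` by `ξ·v` the phase `ξ·(x + tv) + τt` loses its term `t ξ·v` and
          -- splits into `ξ·x + τt`.
          rw [← integral_sub_right_eq_self _ ⟪ξ, (v : Space d)⟫]
          refine integral_congr_ae (ae_of_all _ fun τ => ?_)
          simp only [he, hk]
          rw [mul_assoc, ← Complex.exp_add]
          congr 2
          rw [inner_add_right, inner_smul_right]
          push_cast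
          ring
      _ = _ := by
          rw [spaceTimeFourier, Measure.volume_eq_prod, integral_prod _ hint2]
  have hFAi : Integrable (angFourier A) := by
    obtain ⟨C, hC, hb⟩ := exists_schwartz_bound (spaceTimeFourierSchwartz φ)
    have : angFourier A = fun t => spaceTimeFourierSchwartz φ (x + t • (v : Space d), t) := by
      ext t
      rw [hFA, spaceTimeFourierSchwartz_apply]
    rw [this]
    refine ((integrable_timeWeight.const_mul (spaceWeight (0 : Space d))).const_mul C).mono'
      ((SchwartzMap.continuous _).comp (by fun_prop)).aestronglyMeasurable
      (ae_of_all _ fun t => ?_)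
    exact hb _ _ _ (by simp) (norm_time_le_two_mul _ _)
  have := integral_angFourier hAi hAc hFAi
  simp_rw [hFA] at this
  rw [this, Module.finrank_self, pow_one]
  simp only [hA, zero_sub, angFourier, he]

end Inversion

/-! ### The Fourier transform of a velocity average. -/

section VelocityAverage

variable {d : ℕ}

lemma integrable_mul_spaceWeight {f : Space d × UnitSphere d → ℂ}
    (hf : MemLp f 2 (phaseMeasure d)) :
    Integrable (fun p => f p * (spaceWeight p.1 : ℂ)) (phaseMeasure d) :=
  MemLp.integrable_mul hf memLp_spaceWeight

lemma quasiMeasurePreserving_position_velocity :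
    Measure.QuasiMeasurePreserving (fun q : UnitSphere d × (Space d × ℝ) => (q.2.1, q.1))
      ((surfaceMeasure d).prod volume) (phaseMeasure d) := by
  have h1 : Measure.QuasiMeasurePreserving
      (fun q : UnitSphere d × (Space d × ℝ) => ((q.1, q.2.1), q.2.2))
      ((surfaceMeasure d).prod (volume.prod volume))
      (((surfaceMeasure d).prod volume).prod volume) :=
    ((measurePreserving_prodAssoc (surfaceMeasure d) (volume : Measure (Space d))
      (volume : Measure ℝ)).symm MeasurableEquiv.prodAssoc).quasiMeasurePreserving
  exact (Measure.measurePreserving_swap.quasiMeasurePreserving.comp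
    Measure.quasiMeasurePreserving_fst).comp h1

/-- Along characteristics `χ` is bounded by a product weight in `(x,t)`. The spatial weight is
square integrable on phase space, so Cauchy–Schwarz pairs it with `f`, and the time weight is
integrable. -/
lemma integrable_line {f : Space d × UnitSphere d → ℂ} (hf : MemLp f 2 (phaseMeasure d))
    (χ : 𝓢(Space d × ℝ, ℂ)) : Integrable (fun q : UnitSphere d × (Space d × ℝ) =>
      f (q.2.1, q.1) * χ (q.2.1 + q.2.2 • (q.1 : Space d), q.2.2))
      ((surfaceMeasure d).prod volume) := by
  obtain ⟨C, hC, hb⟩ := exists_schwartz_bound χ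
  have h1 := ((integrable_mul_spaceWeight hf).swap.norm.mul_prod integrable_timeWeight)
  have h2 := (((measurePreserving_prodAssoc (surfaceMeasure d) (volume : Measure (Space d))
    (volume : Measure ℝ)).symm MeasurableEquiv.prodAssoc).integrable_comp h1.1).2 h1
  refine (h2.const_mul C).mono' ?_ (ae_of_all _ fun q => ?_)
  · exact (hf.1.comp_quasiMeasurePreserving quasiMeasurePreserving_position_velocity).mul
      (χ.continuous.comp (by fun_prop)).aestronglyMeasurable
  · have := hb _ _ _ (norm_le_line q.2.1 q.2.2 q.1) (norm_time_le_two_mul _ q.2.2)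
    calc _ = ‖f (q.2.1, q.1)‖ * ‖χ (q.2.1 + q.2.2 • (q.1 : Space d), q.2.2)‖ := norm_mul _ _
      _ ≤ ‖f (q.2.1, q.1)‖ * (C * (spaceWeight q.2.1 * timeWeight q.2.2)) := by gcongr
      _ = C * (‖f (q.2.1, q.1) * (spaceWeight q.2.1 : ℂ)‖ * timeWeight q.2.2) := by
          rw [norm_mul, Complex.norm_real, Real.norm_of_nonneg (spaceWeight_nonneg _)]
          ring

lemma measurePreserving_line (v : Space d) :
    MeasurePreserving (fun z : Space d × ℝ => (z.1 - z.2 • v, z.2)) volume volume := by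
  have h1 : MeasurePreserving (fun z : ℝ × Space d => (z.1, z.2 - z.1 • v))
      ((volume : Measure ℝ).prod (volume : Measure (Space d)))
      ((volume : Measure ℝ).prod (volume : Measure (Space d))) :=
    (MeasurePreserving.id _).skew_product (g := fun t x => x - t • v) (by fun_prop)
      (ae_of_all _ fun t => (measurePreserving_sub_right volume (t • v)).map_eq)
  exact (Measure.measurePreserving_swap.comp h1).comp Measure.measurePreserving_swap

lemma measurePreserving_transport : MeasurePreserving
    (fun q : UnitSphere d × (Space d × ℝ) => (q.1, (q.2.1 - q.2.2 • (q.1 : Space d), q.2.2)))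
    ((surfaceMeasure d).prod volume) ((surfaceMeasure d).prod volume) :=
  (MeasurePreserving.id _).skew_product
    (g := fun (v : UnitSphere d) (z : Space d × ℝ) => (z.1 - z.2 • (v : Space d), z.2))
    (by fun_prop) (ae_of_all _ fun v => (measurePreserving_line (v : Space d)).map_eq)

/-- The adjoint of `ρ` integrates a test function along characteristics: for fixed `v` the shear
`(x,t) ↦ (x - tv, t)` preserves measure, and Fubini does the rest. -/
lemma velocityAverage_pairing {f : Space d × UnitSphere d → ℂ} (hf : MemLp f 2 (phaseMeasure d))
    (χ : 𝓢(Space d × ℝ, ℂ)) :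
    Integrable (fun z => velocityAverage f z * χ z) ∧
    ∫ z, velocityAverage f z * χ z = ∫ v : UnitSphere d, (∫ x : Space d, f (x, v) *
      ∫ t : ℝ, χ (x + t • (v : Space d), t)) ∂(surfaceMeasure d) := by
  have hA := integrable_line hf χ
  have hB := (measurePreserving_transport.integrable_comp hA.1).2 hA
  have hBA := integral_map (measurePreserving_transport (d := d)).measurable.aemeasurable
    (by rw [(measurePreserving_transport (d := d)).map_eq]; exact hA.1)
  rw [(measurePreserving_transport (d := d)).map_eq] at hBA
  simp only [Function.comp_def, sub_add_cancel, Prod.mk.eta] at hB hBA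
  have hρ : (fun z => velocityAverage f z * χ z) = fun z : Space d × ℝ =>
      ∫ v : UnitSphere d, f (z.1 - z.2 • (v : Space d), v) * χ z ∂(surfaceMeasure d) := by
    ext z
    rw [velocityAverage, integral_mul_const]
  rw [hρ]
  refine ⟨hB.integral_prod_right, ?_⟩
  rw [← integral_prod_symm _ hB, ← hBA, integral_prod _ hA]
  refine integral_congr_ae ?_
  filter_upwards [hA.prod_right_ae] with v hv
  rw [Measure.volume_eq_prod, integral_prod _ hv]
  refine integral_congr_ae (ae_of_all _ fun x => ?_)
  simp only
  rw [integral_const_mul]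

lemma exists_phase_bound (φ : 𝓢(Space d × ℝ, ℂ)) : ∃ C : ℝ, ∀ p : Space d × UnitSphere d,
    ‖φ (p.1, -⟪(p.2 : Space d), p.1⟫)‖ ≤ C * ‖(spaceWeight p.1 : ℂ)‖ := by
  obtain ⟨C, hC, hb⟩ := exists_schwartz_bound φ
  refine ⟨C * timeWeight 0, fun p => (hb _ p.1 0 (norm_le_two_mul _ _) (by simp)).trans_eq ?_⟩
  rw [Complex.norm_real, Real.norm_of_nonneg (spaceWeight_nonneg _)]
  ring

lemma integrable_phase_pairing {g : Space d × UnitSphere d → ℂ}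
    (hg : MemLp g 2 (phaseMeasure d)) (φ : 𝓢(Space d × ℝ, ℂ)) :
    Integrable (fun p => g p * φ (p.1, -⟪(p.2 : Space d), p.1⟫)) (phaseMeasure d) := by
  obtain ⟨C, hb⟩ := exists_phase_bound φ
  refine ((integrable_mul_spaceWeight hg).norm.const_mul C).mono'
    (hg.1.mul (φ.continuous.comp (by fun_prop)).aestronglyMeasurable) (ae_of_all _ fun p => ?_)
  calc _ = ‖g p‖ * ‖φ (p.1, -⟪(p.2 : Space d), p.1⟫)‖ := norm_mul _ _
    _ ≤ ‖g p‖ * (C * ‖(spaceWeight p.1 : ℂ)‖) := by gcongr; exact hb p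
    _ = _ := by rw [norm_mul]; ring

/-- The restriction of a Schwartz function to the hyperplane `τ = -v·ξ`. -/
lemma exists_schwartz_restrict (φ : 𝓢(Space d × ℝ, ℂ)) (v : UnitSphere d) :
    ∃ ψ : 𝓢(Space d, ℂ), ∀ ξ, ψ ξ = φ (ξ, -⟪ξ, (v : Space d)⟫) := by
  let L : Space d →L[ℝ] Space d × ℝ :=
    (ContinuousLinearMap.id ℝ (Space d)).prod (-(innerSL ℝ (v : Space d)))
  refine ⟨SchwartzMap.compCLM ℂ (g := L) L.hasTemperateGrowth ⟨1, 1, fun x => ?_⟩ φ, fun ξ => ?_⟩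
  · have := norm_fst_le (L x)
    simp only [one_mul, pow_one]
    have h : (L x).1 = x := rfl
    rw [h] at this
    linarith
  · simp [L, real_inner_comm]

/-- The average of `g(ξ, ·)` given the value of `-v·ξ`. -/
def sliceAverage [NeZero d] (g : Space d × UnitSphere d → ℂ) (ζ : Space d × ℝ) : ℂ :=
  ∫ v, g (ζ.1, v) ∂(velocityKernel d ζ)

/-- The Fourier transform of the velocity average of a function with partial Fourier
transform `g`. -/
def averageFourier [NeZero d] (g : Space d × UnitSphere d → ℂ) (ζ : Space d × ℝ) : ℂ :=
  ((2 * Real.pi * sliceDensity d ζ : ℝ) : ℂ) * sliceAverage g ζ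

lemma measurable_sliceAverage [NeZero d] {g : Space d × UnitSphere d → ℂ} (hg : Measurable g) :
    Measurable (sliceAverage g) :=
  (StronglyMeasurable.integral_kernel_prod_right' (κ := velocityKernel d)
    (f := fun q : (Space d × ℝ) × UnitSphere d => g (q.1.1, q.2))
    (hg.comp (by fun_prop)).stronglyMeasurable).measurable

lemma measurable_averageFourier [NeZero d] {g : Space d × UnitSphere d → ℂ} (hg : Measurable g) :
    Measurable (averageFourier g) :=
  (Complex.measurable_ofReal.comp (measurable_const.mul measurable_sliceDensity)).mul
    (measurable_sliceAverage hg)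

/-- After `map_sliceMap` the test function depends only on the slice `ζ` and leaves the conditional
mean. The density of `sliceMeasure` supplies the factor `sliceDensity`. -/
lemma averageFourier_pairing [NeZero d] (hd : 2 ≤ d) {g : Space d × UnitSphere d → ℂ}
    (hgm : Measurable g) (hg : MemLp g 2 (phaseMeasure d)) (φ : 𝓢(Space d × ℝ, ℂ)) :
    Integrable (fun ζ => averageFourier g ζ * φ ζ) ∧
    ∫ ζ, averageFourier g ζ * φ ζ = (2 * Real.pi : ℝ) *
      ∫ p, g p * φ (p.1, -⟪(p.2 : Space d), p.1⟫) ∂(phaseMeasure d) := by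
  set k : (Space d × ℝ) × UnitSphere d → ℂ := fun q => g (q.1.1, q.2) * φ q.1 with hk
  have hkm : StronglyMeasurable k :=
    ((hgm.comp (by fun_prop)).mul (φ.continuous.measurable.comp measurable_fst)).stronglyMeasurable
  have h1 := integrable_phase_pairing hg φ
  have h2 : Integrable k ((sliceMeasure d).compProd (velocityKernel d)) := by
    rw [← map_sliceMap hd, integrable_map_measure hkm.aestronglyMeasurable
      measurable_sliceMap.aemeasurable]
    exact h1
  have h3 : ∫ p, g p * φ (p.1, -⟪(p.2 : Space d), p.1⟫) ∂(phaseMeasure d) =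
      ∫ q, k q ∂((sliceMeasure d).compProd (velocityKernel d)) := by
    rw [← map_sliceMap hd, integral_map measurable_sliceMap.aemeasurable hkm.aestronglyMeasurable]
    rfl
  have h4 : ∀ ζ, ∫ v, k (ζ, v) ∂(velocityKernel d ζ) = sliceAverage g ζ * φ ζ := fun ζ => by
    rw [sliceAverage, ← integral_mul_const]
  have h5 : Integrable (fun ζ => sliceAverage g ζ * φ ζ) (sliceMeasure d) := by
    simp_rw [← h4]
    have h2' := h2
    rw [Measure.compProd] at h2'
    simpa using h2'.integral_compProd
  have h6 : ∀ ζ, (ENNReal.ofReal (sliceDensity d ζ)).toReal • (sliceAverage g ζ * φ ζ) =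
      (sliceDensity d ζ : ℂ) * (sliceAverage g ζ * φ ζ) := fun ζ => by
    rw [ENNReal.toReal_ofReal (sliceDensity_nonneg ζ), Complex.real_smul]
  have h7 : ∀ ζ, averageFourier g ζ * φ ζ =
      ((2 * Real.pi : ℝ) : ℂ) * ((sliceDensity d ζ : ℂ) * (sliceAverage g ζ * φ ζ)) := fun ζ => by
    rw [averageFourier]
    push_cast
    ring
  have hN : Measurable fun ζ => ENNReal.ofReal (sliceDensity d ζ) :=
    measurable_sliceDensity.ennreal_ofReal
  simp_rw [h7]
  constructor
  · rw [sliceMeasure, integrable_withDensity_iff_integrable_smul' hN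
      (ae_of_all _ fun _ => ENNReal.ofReal_lt_top)] at h5
    simp_rw [h6] at h5
    exact h5.const_mul _
  · rw [integral_const_mul, h3, Measure.integral_compProd h2]
    simp_rw [h4]
    rw [sliceMeasure, integral_withDensity_eq_integral_toReal_smul hN
      (ae_of_all _ fun _ => ENNReal.ofReal_lt_top)]
    simp_rw [h6]

/-- The Fourier transform of a velocity average. -/
theorem hasFourierTransform_velocityAverage [NeZero d] (hd : 2 ≤ d)
    {f g : Space d × UnitSphere d → ℂ} (hf : MemLp f 2 (phaseMeasure d)) (hgm : Measurable g)
    (hg : MemLp g 2 (phaseMeasure d)) (hfg : ∀ᵐ v ∂(surfaceMeasure d),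
      IsL2Fourier (fun x => f (x, v)) fun ξ => g (ξ, v)) :
    HasFourierTransform (velocityAverage f) (averageFourier g) := by
  intro φ
  obtain ⟨h1, h2⟩ := velocityAverage_pairing hf (spaceTimeFourierSchwartz φ)
  simp_rw [spaceTimeFourierSchwartz_apply] at h1 h2
  obtain ⟨h3, h4⟩ := averageFourier_pairing hd hgm hg φ
  refine ⟨h1, h3, ?_⟩
  have h5 := integrable_phase_pairing hg φ
  rw [h2, h4, phaseMeasure, integral_prod_symm _ h5, ← integral_const_mul]
  refine integral_congr_ae ?_
  filter_upwards [hfg] with v hv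
  obtain ⟨ψ, hψ⟩ := exists_schwartz_restrict φ v
  have h6 := hv.2.2 ψ
  have hψ' : (ψ : Space d → ℂ) = fun ξ => φ (ξ, -⟪ξ, (v : Space d)⟫) := funext hψ
  rw [hψ'] at h6
  -- The line integral of `φ̂` is `2π` times the transform of `φ` restricted to the hyperplane `τ =
  -- -v·ξ`. Slicewise duality then moves the transform from that restriction to `f(·,v)`.
  simp_rw [integral_spaceTimeFourier_line]
  simp_rw [real_inner_comm _ (v : Space d)] at h6 ⊢
  rw [h6, ← integral_const_mul]
  refine integral_congr_ae (ae_of_all _ fun x => ?_)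
  simp only
  ring

end VelocityAverage

/-! ### The energy identity. -/

section Identity

variable {d : ℕ}

/-- Here radiality pays off: in polar coordinates the direction of `ξ` separates from `‖ξ‖`, and the
angular integral of `W` does not depend on `v`. -/
lemma lintegral_angular (hd : 2 ≤ d) {W Φ : ℝ → ENNReal} (hW : Measurable W) (hΦ : Measurable Φ)
    (v : UnitSphere d) :
    surfaceMeasure d univ * ∫⁻ ξ : Space d, W (-⟪(v : Space d), ξ⟫ / ‖ξ‖) * Φ ‖ξ‖ =
      (∫⁻ s, ENNReal.ofReal (zonalDensity d s) * W s) * ∫⁻ ξ : Space d, Φ ‖ξ‖ := by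
  have : NeZero d := ⟨by omega⟩
  set R := ∫⁻ r in Ioi (0 : ℝ), ENNReal.ofReal (r ^ (d - 1)) * Φ r with hR
  have h1 : ∫⁻ ξ : Space d, Φ ‖ξ‖ = surfaceMeasure d univ * R := by
    rw [lintegral_polar _ (by fun_prop : Measurable fun ξ : Space d => Φ ‖ξ‖)]
    have : ∀ ω : UnitSphere d, ∫⁻ r in Ioi (0 : ℝ),
        ENNReal.ofReal (r ^ (Module.finrank ℝ (Space d) - 1)) * Φ ‖r • (ω : Space d)‖ = R := by
      intro ω
      refine setLIntegral_congr_fun measurableSet_Ioi fun r hr => ?_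
      have hr : 0 < r := hr
      simp [norm_smul, abs_of_pos hr]
    simp_rw [this]
    rw [lintegral_const, mul_comm]
    rfl
  have h2 : ∫⁻ ξ : Space d, W (-⟪(v : Space d), ξ⟫ / ‖ξ‖) * Φ ‖ξ‖ =
      (∫⁻ s, ENNReal.ofReal (zonalDensity d s) * W s) * R := by
    rw [lintegral_polar _ (by fun_prop : Measurable fun ξ : Space d =>
      W (-⟪(v : Space d), ξ⟫ / ‖ξ‖) * Φ ‖ξ‖)]
    have h3 : ∀ ω : UnitSphere d, ∫⁻ r in Ioi (0 : ℝ),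
        ENNReal.ofReal (r ^ (Module.finrank ℝ (Space d) - 1)) *
          (W (-⟪(v : Space d), r • (ω : Space d)⟫ / ‖r • (ω : Space d)‖) *
            Φ ‖r • (ω : Space d)‖) = (fun s => W (-s)) ⟪(ω : Space d), (v : Space d)⟫ * R := by
      intro ω
      rw [hR, ← lintegral_const_mul _ (by fun_prop)]
      refine setLIntegral_congr_fun measurableSet_Ioi fun r hr => ?_
      have hr : 0 < r := hr
      have h4 : -⟪(v : Space d), r • (ω : Space d)⟫ / ‖r • (ω : Space d)‖ =
          -⟪(ω : Space d), (v : Space d)⟫ := by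
        rw [norm_smul, norm_eq_of_mem_sphere, inner_smul_right, real_inner_comm,
          Real.norm_of_nonneg hr.le]
        field_simp
      simp only [h4]
      simp [norm_smul, abs_of_pos hr]
      ring
    simp_rw [h3]
    rw [lintegral_mul_const _ (by fun_prop)]
    congr 1
    have h5 := lintegral_zonal hd (k := fun s => W (-s)) (by fun_prop) (v : Space d) (by simp)
    rw [surfaceMeasure] at h5
    rw [h5, ← lintegral_neg_eq_self]
    simp only [zonalDensity_neg, neg_neg]
  rw [h1, h2]
  ring

/-- The angular weight of the multiplier estimate. -/
def angularWeight (d : ℕ) (βp βm s : ℝ) : ℝ :=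
  ((1 + |s|) ^ βp * abs (1 - |s|) ^ βm) ^ 2 * zonalDensity d s

lemma measurable_angularWeight (βp βm : ℝ) : Measurable (angularWeight d βp βm) := by
  have := measurable_zonalDensity d
  unfold angularWeight
  fun_prop

lemma measurable_hyperbolicMultiplier (βp βm : ℝ) :
    Measurable (hyperbolicMultiplier (d := d) βp βm) := by
  unfold hyperbolicMultiplier
  fun_prop

/-- The squared multiplier is homogeneous of degree `2(β₊ + β₋) = 1` and the density of degree `-1`,
so the product depends on `τ/‖ξ‖` alone. -/
lemma multiplier_sq_mul_sliceDensity {βp βm : ℝ} (hsum : βp + βm = 1 / 2) {ζ : Space d × ℝ}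
    (hζ : ζ.1 ≠ 0) : hyperbolicMultiplier βp βm ζ ^ 2 * sliceDensity d ζ =
      angularWeight d βp βm (ζ.2 / ‖ζ.1‖) := by
  have hpos : 0 < ‖ζ.1‖ := norm_pos_iff.2 hζ
  have h1 : ‖ζ.1‖ + |ζ.2| = ‖ζ.1‖ * (1 + |ζ.2 / ‖ζ.1‖|) := by
    rw [abs_div, abs_norm]
    field_simp
  have h2 : ‖ζ.1‖ - |ζ.2| = ‖ζ.1‖ * (1 - |ζ.2 / ‖ζ.1‖|) := by
    rw [abs_div, abs_norm]
    field_simp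
  have h3 : ‖ζ.1‖ ^ βp * ‖ζ.1‖ ^ βm = √‖ζ.1‖ := by
    rw [← Real.rpow_add hpos, hsum, Real.sqrt_eq_rpow]
  have h4 : hyperbolicMultiplier βp βm ζ ^ 2 = ‖ζ.1‖ *
      ((1 + |ζ.2 / ‖ζ.1‖|) ^ βp * abs (1 - |ζ.2 / ‖ζ.1‖|) ^ βm) ^ 2 := by
    rw [hyperbolicMultiplier, h1, h2, abs_mul, abs_norm, Real.mul_rpow (norm_nonneg _) (by positivity),
      Real.mul_rpow (norm_nonneg _) (abs_nonneg _)]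
    nth_rewrite 5 [← Real.sq_sqrt (norm_nonneg ζ.1)]
    rw [← h3]
    ring
  rw [h4, sliceDensity, angularWeight]
  field_simp

lemma angularWeight_pos (hd : 2 ≤ d) {βp βm s : ℝ} (hs : s ∈ Ioo (-1 : ℝ) 1) :
    0 < angularWeight d βp βm s := by
  have : NeZero (d - 1) := ⟨by omega⟩
  have h1 : |s| < 1 := abs_lt.2 hs
  have h2 : 0 < abs (1 - |s|) := abs_pos.2 (by linarith)
  have h3 : 0 < sphereArea (d - 1) :=
    ENNReal.toReal_pos (by simpa using surfaceMeasure_ne_zero) (measure_ne_top _ _)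
  have h4 : 0 < 1 - s ^ 2 := by nlinarith [hs.1, hs.2]
  rw [angularWeight, zonalDensity, indicator_of_mem hs]
  positivity

lemma ae_space_ne_zero [NeZero d] : ∀ᵐ ξ : Space d, ξ ≠ 0 := by
  simp [ae_iff]

lemma ae_space_time_ne_zero [NeZero d] : ∀ᵐ ζ : Space d × ℝ, ζ.1 ≠ 0 :=
  Measure.quasiMeasurePreserving_fst.ae ae_space_ne_zero

/-- Positivity of the weight is what lets a vanishing defect force a vanishing deviation. It can
fail only if `ξ = 0` or `v` is parallel to `ξ`. -/
lemma ae_phase_angularWeight_pos (hd : 2 ≤ d) (βp βm : ℝ) :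
    ∀ᵐ p ∂(phaseMeasure d), p.1 ≠ 0 ∧
      0 < angularWeight d βp βm (-⟪(p.2 : Space d), p.1⟫ / ‖p.1‖) := by
  have : NeZero d := ⟨by omega⟩
  have hm : Measurable fun p : Space d × UnitSphere d => -⟪(p.2 : Space d), p.1⟫ / ‖p.1‖ := by
    fun_prop
  rw [phaseMeasure, Measure.ae_prod_iff_ae_ae]
  · filter_upwards [ae_space_ne_zero] with ξ hξ
    have hpos : 0 < ‖ξ‖ := norm_pos_iff.2 hξ
    -- The density vanishes outside `(-1,1)`, so the exceptional velocities form a null set.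
    have h1 := lintegral_zonal hd (k := (Ioo (-1 : ℝ) 1)ᶜ.indicator 1)
      (measurable_one.indicator measurableSet_Ioo.compl) (‖ξ‖⁻¹ • ξ)
      (by rw [norm_smul, norm_inv, norm_norm, inv_mul_cancel₀ hpos.ne'])
    have h2 : ∀ s, ENNReal.ofReal (zonalDensity d s) *
        (Ioo (-1 : ℝ) 1)ᶜ.indicator (1 : ℝ → ENNReal) s = 0 := by
      intro s
      by_cases hs : s ∈ Ioo (-1 : ℝ) 1
      · rw [indicator_of_notMem (by simpa using hs), mul_zero]
      · rw [zonalDensity, indicator_of_notMem hs]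
        simp
    simp_rw [h2] at h1
    have h5 : Measurable fun v : UnitSphere d => (Ioo (-1 : ℝ) 1)ᶜ.indicator
        (1 : ℝ → ENNReal) ⟪(v : Space d), ‖ξ‖⁻¹ • ξ⟫ :=
      (measurable_one.indicator measurableSet_Ioo.compl).comp (by fun_prop)
    rw [lintegral_zero, lintegral_eq_zero_iff h5] at h1
    filter_upwards [h1] with v hv
    refine ⟨hξ, angularWeight_pos hd ?_⟩
    have h3 : ⟪(v : Space d), ‖ξ‖⁻¹ • ξ⟫ ∈ Ioo (-1 : ℝ) 1 := by
      by_contra h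
      simp [indicator_of_mem (mem_compl h)] at hv
    rw [inner_smul_right, ← div_eq_inv_mul] at h3
    rw [neg_div]
    exact ⟨by linarith [h3.2], by linarith [h3.1]⟩
  · exact (measurable_fst (measurableSet_singleton 0).compl).inter
      (measurableSet_lt measurable_const ((measurable_angularWeight βp βm).comp hm))

/-- The variance identity for a complex function on a probability space. -/
lemma lintegral_variance {α : Type*} [MeasurableSpace α] {μ : Measure α} [IsProbabilityMeasure μ]
    {h : α → ℂ} (hh : MemLp h 2 μ) : ∫⁻ a, ‖h a‖ₑ ^ 2 ∂μ =
      ‖∫ a, h a ∂μ‖ₑ ^ 2 + ∫⁻ a, ‖h a - ∫ a, h a ∂μ‖ₑ ^ 2 ∂μ := by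
  set m := ∫ a, h a ∂μ with hm
  have hi := hh.integrable (by norm_num)
  have hh' := hh.sub (memLp_const m)
  have key : ∀ {k : α → ℂ}, MemLp k 2 μ → ∫⁻ a, ‖k a‖ₑ ^ 2 ∂μ =
      ENNReal.ofReal (∫ a, ‖k a‖ ^ 2 ∂μ) := by
    intro k hk
    rw [ofReal_integral_eq_lintegral_ofReal ((memLp_two_iff_integrable_sq_norm hk.1).1 hk)
      (ae_of_all _ fun a => by positivity)]
    refine lintegral_congr fun a => ?_
    rw [ENNReal.ofReal_pow (norm_nonneg _), ofReal_norm]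
  have hk := key hh'
  simp only [Pi.sub_apply] at hk
  rw [key hh, hk, ← ofReal_norm, ← ENNReal.ofReal_pow (norm_nonneg _),
    ← ENNReal.ofReal_add (by positivity) (integral_nonneg fun _ => by positivity)]
  congr 1
  have h1 : ∀ a, ‖h a - m‖ ^ 2 = ‖h a‖ ^ 2 - 2 * (h a * (starRingEnd ℂ) m).re + ‖m‖ ^ 2 := by
    intro a
    rw [← Complex.normSq_eq_norm_sq, Complex.normSq_sub, Complex.normSq_eq_norm_sq,
      Complex.normSq_eq_norm_sq]
    ring
  have hi2 := (memLp_two_iff_integrable_sq_norm hh.1).1 hh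
  have hi3 : Integrable (fun a => h a * (starRingEnd ℂ) m) μ := hi.mul_const _
  have hi4 : Integrable (fun a => 2 * (h a * (starRingEnd ℂ) m).re) μ := hi3.re.const_mul 2
  simp_rw [h1]
  have hi5 : Integrable (fun a => ‖h a‖ ^ 2 - 2 * (h a * (starRingEnd ℂ) m).re) μ := hi2.sub hi4
  rw [integral_add hi5 (integrable_const _), integral_sub hi2 hi4,
    integral_const_mul]
  have h2 : ∫ a, (h a * (starRingEnd ℂ) m).re ∂μ = ‖m‖ ^ 2 := by
    have := integral_re hi3
    simp only [RCLike.re_to_complex] at this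
    rw [this, integral_mul_const, ← hm, Complex.mul_conj, Complex.ofReal_re,
      Complex.normSq_eq_norm_sq]
  rw [h2]
  simp
  ring

/-- The deviation of `g` from its averages over the slices `v·ξ = const`. -/
def sliceDefect [NeZero d] (βp βm : ℝ) (g : Space d × UnitSphere d → ℂ) : ENNReal :=
  ∫⁻ p, ENNReal.ofReal (angularWeight d βp βm (-⟪(p.2 : Space d), p.1⟫ / ‖p.1‖)) *
    ‖g p - sliceAverage g (p.1, -⟪(p.2 : Space d), p.1⟫)‖ₑ ^ 2 ∂(phaseMeasure d)

lemma lintegral_phase_eq [NeZero d] (hd : 2 ≤ d) {f : (Space d × ℝ) × UnitSphere d → ENNReal}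
    (hf : Measurable f) : ∫⁻ p, f ((p.1, -⟪(p.2 : Space d), p.1⟫), p.2) ∂(phaseMeasure d) =
      ∫⁻ ζ, ∫⁻ v, f (ζ, v) ∂(velocityKernel d ζ) ∂(sliceMeasure d) := by
  rw [← Measure.lintegral_compProd hf, ← map_sliceMap hd, lintegral_map hf measurable_sliceMap]
  rfl

/-- The weight is constant on each slice, so the variance identity applies slice by slice. The
variances add up to the defect. -/
lemma lintegral_weight_mul_sq [NeZero d] (hd : 2 ≤ d) (βp βm : ℝ)
    {g : Space d × UnitSphere d → ℂ} (hgm : Measurable g) (hg : MemLp g 2 (phaseMeasure d)) :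
    ∫⁻ p, ENNReal.ofReal (angularWeight d βp βm (-⟪(p.2 : Space d), p.1⟫ / ‖p.1‖)) *
        ‖g p‖ₑ ^ 2 ∂(phaseMeasure d) =
      ∫⁻ ζ, ENNReal.ofReal (angularWeight d βp βm (ζ.2 / ‖ζ.1‖)) * ‖sliceAverage g ζ‖ₑ ^ 2
        ∂(sliceMeasure d) + sliceDefect βp βm g := by
  have hH := measurable_sliceAverage hgm
  have hW : Measurable fun ζ : Space d × ℝ =>
      ENNReal.ofReal (angularWeight d βp βm (ζ.2 / ‖ζ.1‖)) :=
    ((measurable_angularWeight βp βm).comp (by fun_prop)).ennreal_ofReal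
  have hWH : Measurable fun ζ : Space d × ℝ =>
      ENNReal.ofReal (angularWeight d βp βm (ζ.2 / ‖ζ.1‖)) * ‖sliceAverage g ζ‖ₑ ^ 2 :=
    hW.mul (hH.enorm.pow_const 2)
  have hgq : Measurable fun q : (Space d × ℝ) × UnitSphere d => g (q.1.1, q.2) :=
    hgm.comp (by fun_prop)
  have hm1 : Measurable fun q : (Space d × ℝ) × UnitSphere d => ‖g (q.1.1, q.2)‖ₑ ^ 2 :=
    hgq.enorm.pow_const 2
  have hm2 : Measurable fun q : (Space d × ℝ) × UnitSphere d =>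
      ‖g (q.1.1, q.2) - sliceAverage g q.1‖ₑ ^ 2 :=
    (hgq.sub (hH.comp measurable_fst)).enorm.pow_const 2
  have hfin : ∀ᵐ ζ ∂(sliceMeasure d), ∫⁻ v, ‖g (ζ.1, v)‖ₑ ^ 2 ∂(velocityKernel d ζ) < ⊤ := by
    refine ae_lt_top hm1.lintegral_kernel_prod_right' ?_
    have := lintegral_phase_eq hd hm1
    rw [← this]
    simp only [Prod.mk.eta]
    rw [lintegral_enorm_sq_eq_norm hg]
    exact ENNReal.ofReal_ne_top
  rw [lintegral_phase_eq hd (f := fun q => ENNReal.ofReal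
      (angularWeight d βp βm (q.1.2 / ‖q.1.1‖)) * ‖g (q.1.1, q.2)‖ₑ ^ 2)
      ((hW.comp measurable_fst).mul hm1), sliceDefect,
    lintegral_phase_eq hd (f := fun q => ENNReal.ofReal (angularWeight d βp βm (q.1.2 / ‖q.1.1‖)) *
      ‖g (q.1.1, q.2) - sliceAverage g q.1‖ₑ ^ 2) ((hW.comp measurable_fst).mul hm2),
    ← lintegral_add_left hWH]
  refine lintegral_congr_ae ?_
  filter_upwards [hfin] with ζ hζ
  have hmem : MemLp (fun v => g (ζ.1, v)) 2 (velocityKernel d ζ) := by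
    refine ⟨(hgm.comp (by fun_prop)).aestronglyMeasurable, ?_⟩
    rw [eLpNorm_lt_top_iff_lintegral_rpow_enorm_lt_top (by simp) (by simp)]
    simpa using hζ
  have hv := lintegral_variance hmem
  rw [lintegral_const_mul' _ _ ENNReal.ofReal_ne_top, lintegral_const_mul' _ _ ENNReal.ofReal_ne_top,
    ← mul_add, hv]
  rfl

/-- The square contains `sliceDensity` twice: one factor joins the squared multiplier to form the
angular weight, the other is the density of `sliceMeasure`. -/
lemma lintegral_multiplier_averageFourier [NeZero d] {βp βm : ℝ} (hsum : βp + βm = 1 / 2)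
    {g : Space d × UnitSphere d → ℂ} (hgm : Measurable g) :
    ∫⁻ ζ, ‖(hyperbolicMultiplier βp βm ζ : ℂ) * averageFourier g ζ‖ₑ ^ 2 =
      ENNReal.ofReal ((2 * Real.pi) ^ 2) *
        ∫⁻ ζ, ENNReal.ofReal (angularWeight d βp βm (ζ.2 / ‖ζ.1‖)) * ‖sliceAverage g ζ‖ₑ ^ 2
          ∂(sliceMeasure d) := by
  have hH := measurable_sliceAverage hgm
  have hW : Measurable fun ζ : Space d × ℝ =>
      ENNReal.ofReal (angularWeight d βp βm (ζ.2 / ‖ζ.1‖)) :=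
    ((measurable_angularWeight βp βm).comp (by fun_prop)).ennreal_ofReal
  have hWH : Measurable fun ζ : Space d × ℝ =>
      ENNReal.ofReal (angularWeight d βp βm (ζ.2 / ‖ζ.1‖)) * ‖sliceAverage g ζ‖ₑ ^ 2 :=
    hW.mul (hH.enorm.pow_const 2)
  rw [sliceMeasure, lintegral_withDensity_eq_lintegral_mul _
    measurable_sliceDensity.ennreal_ofReal hWH,
    ← lintegral_const_mul' _ _ ENNReal.ofReal_ne_top]
  refine lintegral_congr_ae ?_
  filter_upwards [ae_space_time_ne_zero] with ζ hζ
  simp only [Pi.mul_apply]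
  have hr : ∀ z : ℂ, ‖z‖ₑ ^ 2 = ENNReal.ofReal (‖z‖ ^ 2) := fun z => by
    rw [← ofReal_norm, ← ENNReal.ofReal_pow (norm_nonneg _)]
  have hN := sliceDensity_nonneg ζ
  rw [hr, hr, ← multiplier_sq_mul_sliceDensity hsum hζ, ← ENNReal.ofReal_mul (by positivity),
    ← ENNReal.ofReal_mul (by positivity), ← ENNReal.ofReal_mul (by positivity)]
  congr 1
  rw [averageFourier, norm_mul, norm_mul, Complex.norm_real, Complex.norm_real, mul_pow, mul_pow,
    Real.norm_eq_abs, Real.norm_eq_abs, sq_abs, sq_abs]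
  ring

/-- The angular constant. -/
def angularConstant (d : ℕ) (βp βm : ℝ) : ENNReal :=
  ∫⁻ s, ENNReal.ofReal (zonalDensity d s) * ENNReal.ofReal (angularWeight d βp βm s)

/-- The weighted variance identity, with its left side evaluated by `lintegral_angular` for each
`v`. With the defect as a summand and the sphere area as a factor, no subtraction or division in
`ENNReal` occurs. -/
theorem energy_identity [NeZero d] (hd : 2 ≤ d) {βp βm : ℝ} (hsum : βp + βm = 1 / 2)
    {G : ℝ × UnitSphere d → ℂ} (hG : Measurable G)
    (hg : MemLp (fun p : Space d × UnitSphere d => G (‖p.1‖, p.2)) 2 (phaseMeasure d)) :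
    surfaceMeasure d univ * (∫⁻ ζ : Space d × ℝ, ‖(hyperbolicMultiplier βp βm ζ : ℂ) *
        averageFourier (fun p => G (‖p.1‖, p.2)) ζ‖ₑ ^ 2) +
      surfaceMeasure d univ * ENNReal.ofReal ((2 * Real.pi) ^ 2) *
        sliceDefect βp βm (fun p => G (‖p.1‖, p.2)) =
      ENNReal.ofReal ((2 * Real.pi) ^ 2) * angularConstant d βp βm *
        ∫⁻ p : Space d × UnitSphere d, ‖G (‖p.1‖, p.2)‖ₑ ^ 2 ∂(phaseMeasure d) := by
  have hgm : Measurable fun p : Space d × UnitSphere d => G (‖p.1‖, p.2) :=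
    hG.comp (by fun_prop)
  have hW := (measurable_angularWeight (d := d) βp βm).ennreal_ofReal
  have h1 : surfaceMeasure d univ * ∫⁻ p : Space d × UnitSphere d,
      ENNReal.ofReal (angularWeight d βp βm (-⟪(p.2 : Space d), p.1⟫ / ‖p.1‖)) *
        ‖G (‖p.1‖, p.2)‖ₑ ^ 2 ∂(phaseMeasure d) = angularConstant d βp βm *
      ∫⁻ p : Space d × UnitSphere d, ‖G (‖p.1‖, p.2)‖ₑ ^ 2 ∂(phaseMeasure d) := by
    have hm1 : Measurable fun p : Space d × UnitSphere d =>
        ENNReal.ofReal (angularWeight d βp βm (-⟪(p.2 : Space d), p.1⟫ / ‖p.1‖)) *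
          ‖G (‖p.1‖, p.2)‖ₑ ^ 2 := (hW.comp (by fun_prop)).mul (hgm.enorm.pow_const 2)
    have hm2 : Measurable fun p : Space d × UnitSphere d => ‖G (‖p.1‖, p.2)‖ₑ ^ 2 :=
      hgm.enorm.pow_const 2
    rw [phaseMeasure, lintegral_prod_symm' _ hm1, lintegral_prod_symm' _ hm2,
      ← lintegral_const_mul _ hm1.lintegral_prod_left',
      ← lintegral_const_mul _ hm2.lintegral_prod_left']
    refine lintegral_congr fun v => ?_
    exact lintegral_angular hd hW (Φ := fun r => ‖G (r, v)‖ₑ ^ 2)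
      ((hG.comp (by fun_prop)).enorm.pow_const 2) v
  rw [mul_assoc _ (angularConstant d βp βm), ← h1, lintegral_weight_mul_sq hd βp βm hgm hg,
    lintegral_multiplier_averageFourier hsum hgm]
  ring

end Identity

/-! ### Evaluation of the constant. -/

section Constant

variable {d : ℕ}

lemma zonalDensity_mul_angularWeight (βp βm : ℝ) {s : ℝ} (hs : s ∈ Ioo (-1 : ℝ) 1) :
    zonalDensity d s * angularWeight d βp βm s = sphereArea (d - 1) ^ 2 *
      ((1 + |s|) ^ (2 * βp + d - 3) * (1 - |s|) ^ (2 * βm + d - 3)) := by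
  have h1 : |s| < 1 := abs_lt.2 hs
  have h2 : 0 < 1 - |s| := by linarith
  have h3 : 0 < 1 + |s| := by positivity
  have h4 : 1 - s ^ 2 = (1 + |s|) * (1 - |s|) := by
    rw [← sq_abs s]
    ring
  have key : ∀ {x : ℝ} (β : ℝ), 0 < x →
      x ^ (2 * β + d - 3) = (x ^ β) ^ 2 * (x ^ (((d : ℝ) - 3) / 2)) ^ 2 := by
    intro x β hx
    rw [← Real.rpow_natCast, ← Real.rpow_natCast, ← Real.rpow_mul hx.le, ← Real.rpow_mul hx.le,
      ← Real.rpow_add hx]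
    congr 1
    push_cast
    ring
  rw [angularWeight, zonalDensity, indicator_of_mem hs, h4, abs_of_pos h2,
    Real.mul_rpow h3.le h2.le, key βp h3, key βm h2]
  ring

/-- The substitution `|s| = 1 - 2λ` turns `1 - |s|` and `1 + |s|` into `2λ` and `2(1 - λ)`. The
outer `2` counts the two signs of `s`, the inner one is the Jacobian. -/
lemma lintegral_Ioo_even (q : ℝ → ENNReal) : ∫⁻ s in Ioo (-1 : ℝ) 1, q |s| =
    2 * ∫⁻ l in Ioo (0 : ℝ) (1 / 2), ENNReal.ofReal 2 * q (1 - 2 * l) := by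
  have h1 : Ioo (-1 : ℝ) 1 = Ioc (-1) 0 ∪ Ioo 0 1 :=
    (Ioc_union_Ioo_eq_Ioo (by norm_num) (by norm_num)).symm
  have hdisj : Disjoint (Ioc (-1 : ℝ) 0) (Ioo 0 1) := by
    rw [Set.disjoint_left]
    rintro s ⟨_, h⟩ ⟨h', _⟩
    linarith
  rw [h1, lintegral_union measurableSet_Ioo hdisj, Measure.restrict_congr_set Ioo_ae_eq_Ioc.symm, two_mul]
  congr 1
  · have himg : (fun l : ℝ => 2 * l - 1) '' Ioo (0 : ℝ) (1 / 2) = Ioo (-1 : ℝ) 0 := by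
      ext s
      constructor
      · rintro ⟨l, ⟨h, h'⟩, rfl⟩
        constructor <;> simp only <;> linarith
      · rintro ⟨h, h'⟩
        exact ⟨(s + 1) / 2, ⟨by linarith, by linarith⟩, by ring⟩
    rw [← himg, lintegral_image_eq_lintegral_abs_deriv_mul (f' := fun _ => 2) measurableSet_Ioo
      (fun x _ => by simpa using
        (((hasDerivAt_id x).const_mul (2 : ℝ)).sub_const (1 : ℝ)).hasDerivWithinAt)
      (fun x _ y _ h => by linarith [(h : _ = _)])]
    refine setLIntegral_congr_fun measurableSet_Ioo fun l hl => ?_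
    have : |2 * l - 1| = 1 - 2 * l := by
      rw [abs_of_neg (by linarith [hl.2])]
      ring
    simp only [this, abs_two]
  · have himg : (fun l : ℝ => 1 - 2 * l) '' Ioo (0 : ℝ) (1 / 2) = Ioo (0 : ℝ) 1 := by
      ext s
      constructor
      · rintro ⟨l, ⟨h, h'⟩, rfl⟩
        constructor <;> simp only <;> linarith
      · rintro ⟨h, h'⟩
        exact ⟨(1 - s) / 2, ⟨by linarith, by linarith⟩, by ring⟩
    rw [← himg, lintegral_image_eq_lintegral_abs_deriv_mul (f' := fun _ => -2) measurableSet_Ioo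
      (fun x _ => by simpa using
        (((hasDerivAt_id x).const_mul (2 : ℝ)).const_sub (1 : ℝ)).hasDerivWithinAt)
      (fun x _ y _ h => by linarith [(h : _ = _)])]
    refine setLIntegral_congr_fun measurableSet_Ioo fun l hl => ?_
    have : |1 - 2 * l| = 1 - 2 * l := abs_of_pos (by linarith [hl.2])
    simp only [this, abs_neg, abs_two]

/-- No condition on `b` is needed because `1 - l ≥ 1/2` on the range of integration. -/
lemma ofReal_incompleteBeta {a : ℝ} (b : ℝ) (ha : 0 < a) :
    ∫⁻ l in Ioo (0 : ℝ) (1 / 2), ENNReal.ofReal (l ^ (a - 1) * (1 - l) ^ (b - 1)) =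
      ENNReal.ofReal (incompleteBeta (1 / 2) a b) := by
  have hint : IntervalIntegrable (fun l : ℝ => l ^ (a - 1) * (1 - l) ^ (b - 1)) volume 0 (1 / 2) := by
    refine (intervalIntegral.intervalIntegrable_rpow' (by linarith)).mul_continuousOn ?_
    refine ContinuousOn.rpow_const (by fun_prop) fun x hx => Or.inl ?_
    rw [uIcc_of_le (by norm_num)] at hx
    linarith [hx.2]
  rw [incompleteBeta, intervalIntegral.integral_of_le (by norm_num),
    ofReal_integral_eq_lintegral_ofReal
      ((intervalIntegrable_iff_integrableOn_Ioc_of_le (by norm_num)).1 hint),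
    Measure.restrict_congr_set Ioo_ae_eq_Ioc]
  filter_upwards [ae_restrict_mem measurableSet_Ioc] with l hl
  exact mul_nonneg (Real.rpow_nonneg hl.1.le _) (Real.rpow_nonneg (by linarith [hl.2]) _)

lemma incompleteBeta_nonneg (a b : ℝ) : 0 ≤ incompleteBeta (1 / 2) a b := by
  refine intervalIntegral.integral_nonneg (by norm_num) fun l hl => ?_
  exact mul_nonneg (Real.rpow_nonneg hl.1 _) (Real.rpow_nonneg (by linarith [hl.2]) _)

lemma angularConstant_eq (hd : 2 ≤ d) {βp βm : ℝ} (hsum : βp + βm = 1 / 2)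
    (hβ : (2 - (d : ℝ)) / 2 < βm) : angularConstant d βp βm = ENNReal.ofReal
      (2 ^ (2 * d - 3) * sphereArea (d - 1) ^ 2 *
        incompleteBeta (1 / 2) (2 * βm + d - 2) (2 * βp + d - 2)) := by
  set a := 2 * βm + d - 2 with ha
  set b := 2 * βp + d - 2 with hb
  -- The lower bound on `β₋` is exactly integrability of the beta integrand at `0`.
  have ha0 : 0 < a := by linarith
  have h1 : angularConstant d βp βm = ∫⁻ s in Ioo (-1 : ℝ) 1, (fun r => ENNReal.ofReal
      (sphereArea (d - 1) ^ 2 * ((1 + r) ^ (b - 1) * (1 - r) ^ (a - 1)))) |s| := by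
    rw [angularConstant, ← lintegral_indicator measurableSet_Ioo]
    refine lintegral_congr fun s => ?_
    by_cases hs : s ∈ Ioo (-1 : ℝ) 1
    · rw [indicator_of_mem hs, ← ENNReal.ofReal_mul (zonalDensity_nonneg s),
        zonalDensity_mul_angularWeight βp βm hs]
      simp only [ha, hb]
      ring_nf
    · rw [indicator_of_notMem hs, zonalDensity, indicator_of_notMem hs]
      simp
  -- The powers of `2` released by the substitution; `a + b = 2d - 3` because `β₊ + β₋ = 1/2`.
  have hpow : (2 : ℝ) ^ (2 * d - 3) = 2 * (2 * (2 ^ (a - 1) * 2 ^ (b - 1))) := by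
    have h3 : ((2 * d - 3 : ℕ) : ℝ) = 1 + (1 + ((a - 1) + (b - 1))) := by
      rw [Nat.cast_sub (by omega), ha, hb]
      push_cast
      linarith
    rw [← Real.rpow_natCast, h3, Real.rpow_add two_pos, Real.rpow_add two_pos,
      Real.rpow_add two_pos, Real.rpow_one]
  have hA : 0 ≤ sphereArea (d - 1) := measureReal_nonneg
  rw [h1, lintegral_Ioo_even (fun r => ENNReal.ofReal
      (sphereArea (d - 1) ^ 2 * ((1 + r) ^ (b - 1) * (1 - r) ^ (a - 1)))), ENNReal.ofReal_mul (by positivity), ← ofReal_incompleteBeta b ha0,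
    ← lintegral_const_mul' _ _ ENNReal.ofReal_ne_top,
    ← lintegral_const_mul' _ _ (by simp)]
  refine setLIntegral_congr_fun measurableSet_Ioo fun l hl => ?_
  have hl1 : 0 < 1 - l := by linarith [hl.2]
  have h2 : (2 : ENNReal) = ENNReal.ofReal 2 := by simp
  nth_rewrite 1 [h2]
  rw [← ENNReal.ofReal_mul two_pos.le, ← ENNReal.ofReal_mul two_pos.le,
    ← ENNReal.ofReal_mul (by positivity)]
  congr 1
  have h4 : 1 + (1 - 2 * l) = 2 * (1 - l) := by ring
  have h5 : 1 - (1 - 2 * l) = 2 * l := by ring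
  rw [h4, h5, Real.mul_rpow two_pos.le hl1.le, Real.mul_rpow two_pos.le hl.1.le, hpow]
  ring

lemma sphereArea_pos [NeZero d] : 0 < sphereArea d :=
  ENNReal.toReal_pos (by simpa using surfaceMeasure_ne_zero) (measure_ne_top _ _)

/-- The factor `2π` is what remains of `(2π)² (2π)^d`, from the energy identity and Plancherel in
`x`, after division by the `(2π)^{d+1}` of Plancherel in space-time. -/
lemma sharpRadialConstant_mul_sphereArea (hd : 2 ≤ d) {βp βm : ℝ} (hsum : βp + βm = 1 / 2)
    (hβ : (2 - (d : ℝ)) / 2 < βm) :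
    surfaceMeasure d univ * ENNReal.ofReal (sharpRadialConstant d βp βm) =
      ENNReal.ofReal (2 * Real.pi) * angularConstant d βp βm := by
  have : NeZero d := ⟨by omega⟩
  rw [angularConstant_eq hd hsum hβ, ← ofReal_measureReal (s := univ), ← ENNReal.ofReal_mul
    measureReal_nonneg, ← ENNReal.ofReal_mul Real.two_pi_pos.le]
  congr 1
  have h := (sphereArea_pos (d := d)).ne'
  change sphereArea d * _ = _
  rw [sharpRadialConstant]
  have : (2 : ℝ) ^ (2 * d - 2) = 2 * 2 ^ (2 * d - 3) := by
    rw [← pow_succ']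
    congr 1
    omega
  rw [this]
  field_simp

lemma sharpRadialConstant_nonneg (βp βm : ℝ) : 0 ≤ sharpRadialConstant d βp βm := by
  have h1 : 0 ≤ sphereArea d := measureReal_nonneg
  have h2 := Real.pi_pos.le
  have h3 := incompleteBeta_nonneg (2 * βm + d - 2) (2 * βp + d - 2)
  unfold sharpRadialConstant
  positivity

end Constant

/-! ### Functions on the sphere that are zonal about almost every axis. -/

section Rigidity

open scoped FourierTransform Topology

variable {d : ℕ}

lemma exists_angFourierSchwartz_eq {E : Type*} [NormedAddCommGroup E] [InnerProductSpace ℝ E]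
    [MeasurableSpace E] [BorelSpace E] [FiniteDimensional ℝ E] (ψ : 𝓢(E, ℂ)) :
    ∃ φ : 𝓢(E, ℂ), ∀ x, angFourier φ x = ψ x := by
  set e : E ≃L[ℝ] E := ContinuousLinearEquiv.smulLeft
    (Units.mk0 ((2 * Real.pi)⁻¹ : ℝ) (by positivity))
  refine ⟨𝓕⁻ (SchwartzMap.compCLMOfContinuousLinearEquiv ℂ e.symm ψ), fun x => ?_⟩
  rw [← angFourierSchwartz_apply, angFourierSchwartz, FourierTransform.fourier_fourierInv_eq]
  simp only [SchwartzMap.compCLMOfContinuousLinearEquiv_apply, Function.comp_apply]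
  congr 1
  exact e.symm_apply_apply x

/-- The Fourier transform of a density on the sphere. -/
def sphereFourier (h : UnitSphere d → ℂ) (y : Space d) : ℂ :=
  ∫ v, h v * Complex.exp (-(Complex.I * ((⟪(v : Space d), y⟫ : ℝ) : ℂ))) ∂(surfaceMeasure d)

lemma integrable_sphereFourier {h : UnitSphere d → ℂ} (hh : Integrable h (surfaceMeasure d))
    (y : Space d) : Integrable (fun v : UnitSphere d =>
      h v * Complex.exp (-(Complex.I * ((⟪(v : Space d), y⟫ : ℝ) : ℂ)))) (surfaceMeasure d) := by
  refine hh.mul_bdd (c := 1) (Continuous.aestronglyMeasurable (by fun_prop))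
    (ae_of_all _ fun v => ?_)
  rw [norm_exp_neg_I_mul]

lemma continuous_sphereFourier {h : UnitSphere d → ℂ} (hh : Integrable h (surfaceMeasure d)) :
    Continuous (sphereFourier h) := by
  refine continuous_of_dominated (bound := fun v => ‖h v‖)
    (fun y => (integrable_sphereFourier hh y).1) (fun y => ae_of_all _ fun v => ?_) hh.norm
    (ae_of_all _ fun v => by fun_prop)
  rw [norm_mul, norm_exp_neg_I_mul, mul_one]

/-- Every Schwartz function is a Fourier transform, so by Fubini `k dσ` annihilates all of them. The
uniqueness lemma is then used on `ℝ^d` with the pushed-forward surface measure and `k` extended by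
zero. -/
lemma ae_eq_zero_of_sphereFourier_eq_zero {k : UnitSphere d → ℂ}
    (hk : Integrable k (surfaceMeasure d)) (h0 : ∀ y, sphereFourier k y = 0) :
    k =ᵐ[surfaceMeasure d] 0 := by
  have hemb : MeasurableEmbedding (Subtype.val : UnitSphere d → Space d) :=
    MeasurableEmbedding.subtype_coe Metric.isClosed_sphere.measurableSet
  have hext : ∀ v : UnitSphere d, Function.extend Subtype.val k 0 (v : Space d) = k v := fun v =>
    Subtype.val_injective.extend_apply _ _ _
  have hint : ∀ φ : 𝓢(Space d, ℂ), Integrable (fun v : UnitSphere d => k v * φ v)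
      (surfaceMeasure d) := by
    intro φ
    obtain ⟨C, hC⟩ := φ.decay 0 0
    refine hk.mul_bdd (c := C) (φ.continuous.comp continuous_subtype_val).aestronglyMeasurable
      (ae_of_all _ fun v => ?_)
    simpa using hC.2 v
  have hzero : ∀ ψ : 𝓢(Space d, ℂ), ∫ v : UnitSphere d, k v * ψ v ∂(surfaceMeasure d) = 0 := by
    intro ψ
    obtain ⟨φ, hφ⟩ := exists_angFourierSchwartz_eq ψ
    have hprod : Integrable (Function.uncurry fun (v : UnitSphere d) (y : Space d) =>
        k v * (φ y * Complex.exp (-(Complex.I * ((⟪y, (v : Space d)⟫ : ℝ) : ℂ)))))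
        ((surfaceMeasure d).prod volume) := by
      refine (hk.mul_prod (φ.integrable (μ := volume))).mono ?_ (ae_of_all _ fun p => ?_)
      · refine hk.1.comp_fst.mul (AEStronglyMeasurable.mul φ.integrable.1.comp_snd ?_)
        exact Continuous.aestronglyMeasurable (by fun_prop)
      · simp only [Function.uncurry, norm_mul, norm_exp_neg_I_mul, mul_one, le_refl]
    calc ∫ v : UnitSphere d, k v * ψ v ∂(surfaceMeasure d)
        = ∫ v : UnitSphere d, (∫ y, k v * (φ y * Complex.exp
            (-(Complex.I * ((⟪y, (v : Space d)⟫ : ℝ) : ℂ))))) ∂(surfaceMeasure d) := by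
          refine integral_congr_ae (ae_of_all _ fun v => ?_)
          simp only
          rw [integral_const_mul, ← hφ v]
          rfl
      _ = ∫ y, ∫ v : UnitSphere d, k v * (φ y * Complex.exp
            (-(Complex.I * ((⟪y, (v : Space d)⟫ : ℝ) : ℂ)))) ∂(surfaceMeasure d) :=
          integral_integral_swap hprod
      _ = ∫ y, φ y * sphereFourier k y := by
          refine integral_congr_ae (ae_of_all _ fun y => ?_)
          simp only
          rw [sphereFourier, ← integral_const_mul]
          refine integral_congr_ae (ae_of_all _ fun v => ?_)
          simp only
          rw [real_inner_comm]
          ring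
      _ = 0 := by simp [h0]
  have := ae_eq_zero_of_integral_mul_schwartz (μ := (surfaceMeasure d).map Subtype.val)
    (U := Function.extend Subtype.val k 0) (fun φ => by
      rw [hemb.integrable_map_iff]
      simpa only [Function.comp_def, hext] using hint φ) (fun φ => by
      rw [hemb.integral_map]
      simpa only [hext] using hzero φ)
  rw [Filter.EventuallyEq, hemb.ae_map_iff] at this
  filter_upwards [this] with v hv
  rw [hext] at hv
  exact hv

/-- A density on the sphere that is zonal about almost every axis has a Fourier transform that is
constant on parallels about these axes. -/
lemma sphereFourier_eq_of_zonal {h : UnitSphere d → ℂ} {ω : UnitSphere d} {H : ℝ → ℂ}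
    (hH : ∀ᵐ v : UnitSphere d ∂(surfaceMeasure d), h v = H ⟪(v : Space d), (ω : Space d)⟫) {y y' : Space d}
    (hn : ‖y‖ = ‖y'‖) (hi : ⟪y, (ω : Space d)⟫ = ⟪y', (ω : Space d)⟫) :
    sphereFourier h y = sphereFourier h y' := by
  -- This reflection exchanges `y` and `y'` because their norms agree, and fixes `ω` because `ω ⊥ y
  -- - y'`. It therefore leaves `h` invariant.
  set L : Space d ≃ₗᵢ[ℝ] Space d := (ℝ ∙ (y - y'))ᗮ.reflection with hL
  have hLy : L y = y' := Submodule.reflection_sub hn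
  have hLω : L (ω : Space d) = ω := by
    apply Submodule.reflection_mem_subspace_eq_self
    rw [Submodule.mem_orthogonal_singleton_iff_inner_right, inner_sub_left, hi, sub_self]
  have hmp : MeasurePreserving (sphereMap L) (surfaceMeasure d) (surfaceMeasure d) :=
    measurePreserving_sphereMap L
  have hinv : ∀ᵐ v ∂(surfaceMeasure d), h (sphereMap L v) = h v := by
    filter_upwards [hH, hmp.quasiMeasurePreserving.ae hH] with v h1 h2
    rw [h1, h2]
    congr 1
    change ⟪L (v : Space d), (ω : Space d)⟫ = _
    nth_rewrite 1 [← hLω]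
    exact L.inner_map_map _ _
  have hLL : ∀ v, sphereMap L (sphereMap L v) = v := fun v =>
    Subtype.ext (Submodule.reflection_reflection _ _)
  have hemb : MeasurableEmbedding (sphereMap L) :=
    (MeasurableEquiv.mk ⟨sphereMap L, sphereMap L, hLL, hLL⟩ hmp.measurable
      hmp.measurable).measurableEmbedding
  rw [← hLy, sphereFourier, sphereFourier, ← hmp.integral_comp hemb (fun v =>
    h v * Complex.exp (-(Complex.I * ((⟪(v : Space d), L y⟫ : ℝ) : ℂ))))]
  refine integral_congr_ae ?_
  filter_upwards [hinv] with v hv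
  rw [hv]
  congr 5
  exact (L.inner_map_map _ _).symm

/-- An axis `ω₀ ⊥ y - y'`, which exists since `d ≥ 2`, would suffice if it were a good one. Good
axes are only known to be dense, so `y'` is perturbed instead. Let `Φ ω` be the reflection of `y`
along `z ω`, the part of `y - y'` orthogonal to `ω`. It shares with `y` the norm and the component
along `ω`, and it tends to `y'` as `ω → ω₀`. Continuity of the transform concludes. -/
lemma sphereFourier_radial (hd : 2 ≤ d) {h : UnitSphere d → ℂ}
    (hh : Integrable h (surfaceMeasure d)) (hz : ∀ᵐ ω : UnitSphere d ∂(surfaceMeasure d),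
      ∃ H : ℝ → ℂ, ∀ᵐ v : UnitSphere d ∂(surfaceMeasure d), h v = H ⟪(v : Space d), (ω : Space d)⟫) {y y' : Space d}
    (hn : ‖y‖ = ‖y'‖) : sphereFourier h y = sphereFourier h y' := by
  rcases eq_or_ne y y' with rfl | hne
  · rfl
  obtain ⟨ω₀, hω₀⟩ : ∃ ω : UnitSphere d, ⟪y - y', (ω : Space d)⟫ = 0 := by
    have hbot : (ℝ ∙ (y - y'))ᗮ ≠ ⊥ := by
      rw [Ne, Submodule.orthogonal_eq_bot_iff]
      intro htop
      have h1 := finrank_span_singleton (K := ℝ) (sub_ne_zero.2 hne)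
      rw [htop, finrank_top, finrank_euclideanSpace_fin] at h1
      omega
    obtain ⟨u, hu, hu0⟩ := Submodule.exists_mem_ne_zero_of_ne_bot hbot
    refine ⟨⟨‖u‖⁻¹ • u, ?_⟩, ?_⟩
    · rw [mem_sphere_zero_iff_norm, norm_smul, norm_inv, norm_norm,
        inv_mul_cancel₀ (norm_ne_zero_iff.2 hu0)]
    · rw [inner_smul_right, Submodule.mem_orthogonal_singleton_iff_inner_right.1 hu, mul_zero]
  set z : UnitSphere d → Space d := fun ω => (y - y') - ⟪y - y', (ω : Space d)⟫ • (ω : Space d)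
    with hzdef
  set Φ : UnitSphere d → Space d := fun ω => y - (2 * ⟪z ω, y⟫ / ‖z ω‖ ^ 2) • z ω with hΦ
  have hzω : ∀ ω : UnitSphere d, ⟪z ω, (ω : Space d)⟫ = 0 := by
    intro ω
    simp [hzdef, inner_sub_left, inner_smul_left]
  have hz0 : z ω₀ = y - y' := by simp [hzdef, hω₀]
  have hΦ0 : Φ ω₀ = y' := by
    have h1 : ‖y - y'‖ ^ 2 ≠ 0 := by
      simpa [sub_eq_zero] using hne
    have h2 : 2 * ⟪y - y', y⟫ = ‖y - y'‖ ^ 2 := by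
      rw [norm_sub_sq_real, inner_sub_left, real_inner_self_eq_norm_sq, ← hn, real_inner_comm]
      ring
    simp only [hΦ, hz0, h2, div_self h1, one_smul, sub_sub_cancel]
  have hΦn : ∀ ω, ‖y‖ = ‖Φ ω‖ := by
    intro ω
    rw [← sq_eq_sq₀ (norm_nonneg _) (norm_nonneg _), hΦ]
    simp only
    rw [norm_sub_sq_real, inner_smul_right, norm_smul, mul_pow, Real.norm_eq_abs, sq_abs,
      real_inner_comm y]
    by_cases hzz : z ω = 0
    · simp [hzz]
    · have : ‖z ω‖ ≠ 0 := norm_ne_zero_iff.2 hzz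
      rw [real_inner_comm]
      field_simp
      ring
  have hΦi : ∀ ω : UnitSphere d, ⟪y, (ω : Space d)⟫ = ⟪Φ ω, (ω : Space d)⟫ := by
    intro ω
    simp only [hΦ]
    rw [inner_sub_left, inner_smul_left, hzω, mul_zero, sub_zero]
  set S : Set (UnitSphere d) := {ω : UnitSphere d | ∃ H : ℝ → ℂ,
      ∀ᵐ v : UnitSphere d ∂(surfaceMeasure d), h v = H ⟪(v : Space d), (ω : Space d)⟫} with hS
  have hdense : Dense S := by
    have : (surfaceMeasure d).IsOpenPosMeasure :=
      inferInstanceAs (volume : Measure (Space d)).toSphere.IsOpenPosMeasure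
    exact Measure.dense_of_ae hz
  have hzc : Continuous z := by fun_prop
  have hΦc : ContinuousAt Φ ω₀ := by
    have hq : ContinuousAt (fun ω => 2 * ⟪z ω, y⟫ / ‖z ω‖ ^ 2) ω₀ := by
      refine ContinuousAt.div ?_ ?_ ?_
      · exact (by fun_prop : Continuous fun ω => 2 * ⟪z ω, y⟫).continuousAt
      · exact (by fun_prop : Continuous fun ω => ‖z ω‖ ^ 2).continuousAt
      · rw [hz0]
        simpa [sub_eq_zero] using hne
    have hm := hq.smul hzc.continuousAt
    exact continuousAt_const.sub hm
  have hlim : Filter.Tendsto (fun ω => sphereFourier h (Φ ω)) (𝓝[S] ω₀)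
      (𝓝 (sphereFourier h (Φ ω₀))) :=
    (((continuous_sphereFourier hh).continuousAt.comp hΦc).tendsto).mono_left nhdsWithin_le_nhds
  have hconst : Filter.Tendsto (fun ω => sphereFourier h (Φ ω)) (𝓝[S] ω₀)
      (𝓝 (sphereFourier h y)) := by
    refine tendsto_const_nhds.congr' ?_
    filter_upwards [self_mem_nhdsWithin] with ω hω
    obtain ⟨H, hH⟩ := hω
    exact sphereFourier_eq_of_zonal hH (hΦn ω) (hΦi ω)
  have : (𝓝[S] ω₀).NeBot := mem_closure_iff_nhdsWithin_neBot.1 (hdense ω₀)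
  rw [← hΦ0]
  exact tendsto_nhds_unique hconst hlim

/-- A function on the sphere that is zonal about almost every axis is constant. -/
theorem ae_eq_const_of_zonal (hd : 2 ≤ d) {h : UnitSphere d → ℂ}
    (hh : Integrable h (surfaceMeasure d)) (hz : ∀ᵐ ω : UnitSphere d ∂(surfaceMeasure d),
      ∃ H : ℝ → ℂ, ∀ᵐ v : UnitSphere d ∂(surfaceMeasure d), h v = H ⟪(v : Space d), (ω : Space d)⟫) :
    ∀ᵐ v ∂(surfaceMeasure d), h v = ⨍ u, h u ∂(surfaceMeasure d) := by
  have : NeZero d := ⟨by omega⟩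
  set c := ⨍ u, h u ∂(surfaceMeasure d) with hc
  have hA : (sphereArea d : ℂ) ≠ 0 := by exact_mod_cast sphereArea_pos.ne'
  have hc' : ∫ u, h u ∂(surfaceMeasure d) = sphereArea d * c := by
    have harea : (surfaceMeasure d).real univ = sphereArea d := rfl
    rw [hc, average_eq, Complex.real_smul, ← mul_assoc, harea, Complex.ofReal_inv]
    rw [mul_inv_cancel₀ hA, one_mul]
  have hint := hh.sub (integrable_const c)
  have := ae_eq_zero_of_sphereFourier_eq_zero hint fun y => ?_
  · filter_upwards [this] with v hv
    simpa [sub_eq_zero] using hv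
  set e : UnitSphere d → UnitSphere d → ℂ := fun v ω => Complex.exp
    (-(Complex.I * ((⟪(v : Space d), ‖y‖ • (ω : Space d)⟫ : ℝ) : ℂ))) with he
  have hprod : Integrable (Function.uncurry fun ω v => h v * e v ω)
      ((surfaceMeasure d).prod (surfaceMeasure d)) := by
    refine (hh.comp_snd (surfaceMeasure d)).mul_bdd (c := 1)
      (Continuous.aestronglyMeasurable (by fun_prop)) (ae_of_all _ fun p => ?_)
    simp only [he, norm_exp_neg_I_mul, le_refl]
  -- The transform is averaged over the sphere of radius `‖y‖`. Radiality returns its value at `y`,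
  -- while Fubini and rotation invariance of the kernel (`h2`) factor the average into `∫ h` times
  -- the transform of `1`. So `h` and its mean have the same transform.
  have h1 : sphereArea d * sphereFourier h y =
      ∫ ω : UnitSphere d, sphereFourier h (‖y‖ • (ω : Space d)) ∂(surfaceMeasure d) := by
    rw [integral_congr_ae (g := fun _ => sphereFourier h y) (ae_of_all _ fun ω =>
      sphereFourier_radial hd hh hz (by simp [norm_smul])), integral_const, Complex.real_smul]
    rfl
  have h2 : ∀ v : UnitSphere d, ∫ ω, e v ω ∂(surfaceMeasure d) = sphereFourier (fun _ => 1) y := by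
    intro v
    obtain ⟨L, hL⟩ := exists_isometry_map_eq (x := y) (y := ‖y‖ • (v : Space d))
      (by simp [norm_smul])
    have hmp := measurePreserving_sphereMap L
    have hemb : MeasurableEmbedding (sphereMap L) :=
      (MeasurableEquiv.mk ⟨sphereMap L, sphereMap L.symm,
        fun u => Subtype.ext (L.symm_apply_apply _), fun u => Subtype.ext (L.apply_symm_apply _)⟩
        hmp.measurable (measurePreserving_sphereMap L.symm).measurable).measurableEmbedding
    rw [sphereFourier, surfaceMeasure, ← hmp.integral_comp hemb]
    refine integral_congr_ae (ae_of_all _ fun ω => ?_)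
    simp only [he, one_mul]
    congr 4
    change ⟪(v : Space d), ‖y‖ • L (ω : Space d)⟫ = _
    rw [inner_smul_right, ← real_inner_smul_left, ← hL, L.inner_map_map, real_inner_comm]
  have h3 : sphereArea d * sphereFourier h y = sphereArea d * c * sphereFourier (fun _ => 1) y := by
    rw [h1, ← hc']
    simp only [sphereFourier]
    rw [integral_integral_swap hprod, ← integral_mul_const]
    refine integral_congr_ae (ae_of_all _ fun v => ?_)
    simp only
    rw [integral_const_mul, h2 v]
    rfl
  have h4 : sphereFourier h y = c * sphereFourier (fun _ => 1) y := by
    apply mul_left_cancel₀ hA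
    rw [h3]
    ring
  have h5 : sphereFourier (h - fun _ => c) y =
      sphereFourier h y - c * sphereFourier (fun _ => 1) y := by
    simp only [sphereFourier, Pi.sub_apply, sub_mul]
    rw [integral_sub (integrable_sphereFourier hh y)
      (integrable_sphereFourier (integrable_const c) y), ← integral_const_mul]
    simp
  rw [h5, h4, sub_self]

end Rigidity

/-! ### The case of equality and sharpness. -/

section Equality

variable {d : ℕ}

lemma ae_phase_of_ae_ae {P : Space d × UnitSphere d → Prop} (hP : MeasurableSet {p | P p})
    (h : ∀ᵐ v ∂(surfaceMeasure d), ∀ᵐ x : Space d, P (x, v)) : ∀ᵐ p ∂(phaseMeasure d), P p := by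
  rw [phaseMeasure, Measure.ae_prod_iff_ae_ae hP]
  exact (Measure.ae_ae_comm (p := fun v x => P (x, v)) (measurable_swap hP)).1 h

lemma ae_ae_of_ae_phase {P : Space d × UnitSphere d → Prop} (h : ∀ᵐ p ∂(phaseMeasure d), P p) :
    ∀ᵐ v ∂(surfaceMeasure d), ∀ᵐ x : Space d, P (x, v) := by
  have h1 : MeasurePreserving Prod.swap ((surfaceMeasure d).prod (volume : Measure (Space d)))
      (phaseMeasure d) := Measure.measurePreserving_swap
  exact Measure.ae_ae_of_ae_prod (h1.quasiMeasurePreserving.ae h)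

lemma ae_phase_sliceMap_iff [NeZero d] (hd : 2 ≤ d) {P : (Space d × ℝ) × UnitSphere d → Prop}
    (hP : MeasurableSet {q | P q}) : (∀ᵐ p ∂(phaseMeasure d), P (sliceMap p)) ↔
      ∀ᵐ ζ ∂(sliceMeasure d), ∀ᵐ v ∂(velocityKernel d ζ), P (ζ, v) := by
  rw [← ae_map_iff measurable_sliceMap.aemeasurable hP, map_sliceMap hd,
    Measure.ae_compProd_iff hP]

instance [NeZero d] : (ae (surfaceMeasure d)).NeBot := ae_neBot.2 surfaceMeasure_ne_zero

/-- If almost all slices of `F` have the same radial profile, this profile can be taken to be a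
slice of `F`. -/
lemma exists_slice_profile [NeZero d] {F : ℝ × UnitSphere d → ℂ} {c : ℝ → ℂ}
    (h : ∀ᵐ v ∂(surfaceMeasure d), ∀ᵐ x : Space d, F (‖x‖, v) = c ‖x‖) :
    ∃ v₀, ∀ᵐ v ∂(surfaceMeasure d), ∀ᵐ x : Space d, F (‖x‖, v) = F (‖x‖, v₀) := by
  obtain ⟨v₀, hv₀⟩ := h.exists
  refine ⟨v₀, ?_⟩
  filter_upwards [h] with v hv
  filter_upwards [hv, hv₀] with x h1 h2
  rw [h1, h2]

/-- Each slice and its transform determine one another, so all slices are compared with that of one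
good velocity `v₀`. -/
lemma exists_profile_iff [NeZero d] {F G : ℝ × UnitSphere d → ℂ}
    (hFG : ∀ᵐ v ∂(surfaceMeasure d),
      IsL2Fourier (fun x : Space d => F (‖x‖, v)) (fun ξ : Space d => G (‖ξ‖, v))) :
    (∃ c : ℝ → ℂ, ∀ᵐ v ∂(surfaceMeasure d), ∀ᵐ x : Space d, F (‖x‖, v) = c ‖x‖) ↔
      ∃ c : ℝ → ℂ, ∀ᵐ v ∂(surfaceMeasure d), ∀ᵐ x : Space d, G (‖x‖, v) = c ‖x‖ := by
  constructor
  · rintro ⟨c, hc⟩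
    obtain ⟨v₀, hv₀, h₀⟩ := (hc.and hFG).exists
    refine ⟨fun r => G (r, v₀), ?_⟩
    filter_upwards [hc, hFG] with v hv h
    refine h.ae_eq (h₀.congr ?_ Filter.EventuallyEq.rfl)
    filter_upwards [hv, hv₀] with x h1 h2
    rw [h1, h2]
  · rintro ⟨c, hc⟩
    obtain ⟨v₀, hv₀, h₀⟩ := (hc.and hFG).exists
    refine ⟨fun r => F (r, v₀), ?_⟩
    filter_upwards [hc, hFG] with v hv h
    refine h.ae_eq_left (h₀.congr Filter.EventuallyEq.rfl ?_)
    filter_upwards [hv, hv₀] with x h1 h2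
    rw [h1, h2]

lemma mem_L2RadXV_iff [NeZero d] {f : Space d × UnitSphere d → ℂ} (hf : MemLp f 2 (phaseMeasure d))
    {F : ℝ × UnitSphere d → ℂ} (hF : Measurable F)
    (hfF : f =ᵐ[phaseMeasure d] fun p => F (‖p.1‖, p.2)) : f ∈ L2RadXV d ↔
      ∃ c : ℝ → ℂ, ∀ᵐ v ∂(surfaceMeasure d), ∀ᵐ x : Space d, F (‖x‖, v) = c ‖x‖ := by
  constructor
  · rintro ⟨-, f₀, h₀⟩
    refine ⟨f₀, ae_ae_of_ae_phase (P := fun p => F (‖p.1‖, p.2) = f₀ ‖p.1‖) ?_⟩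
    filter_upwards [h₀, hfF] with p h1 h2
    rw [← h1, h2]
  · rintro ⟨c, hc⟩
    -- The profile `c` need not be measurable. A slice of `F` is, and the passage from iterated to
    -- joint almost-everywhere statements requires it.
    obtain ⟨v₀, h⟩ := exists_slice_profile hc
    refine ⟨hf, fun r => F (r, v₀), ?_⟩
    have := ae_phase_of_ae_ae (P := fun p => F (‖p.1‖, p.2) = F (‖p.1‖, v₀))
      (measurableSet_eq_fun (hF.comp (by fun_prop)) (hF.comp (by fun_prop))) h
    filter_upwards [this, hfF] with p h1 h2
    rw [h2, h1]

lemma measurable_sliceDefect_integrand [NeZero d] (βp βm : ℝ) {g : Space d × UnitSphere d → ℂ}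
    (hg : Measurable g) : Measurable fun p : Space d × UnitSphere d =>
      ENNReal.ofReal (angularWeight d βp βm (-⟪(p.2 : Space d), p.1⟫ / ‖p.1‖)) *
        ‖g p - sliceAverage g (p.1, -⟪(p.2 : Space d), p.1⟫)‖ₑ ^ 2 :=
  ((measurable_angularWeight βp βm).ennreal_ofReal.comp (by fun_prop)).mul
    ((hg.sub ((measurable_sliceAverage hg).comp (by fun_prop))).enorm.pow_const 2)

lemma sliceDefect_eq_zero_iff_ae [NeZero d] (hd : 2 ≤ d) (βp βm : ℝ)
    {g : Space d × UnitSphere d → ℂ} (hg : Measurable g) : sliceDefect βp βm g = 0 ↔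
      ∀ᵐ p ∂(phaseMeasure d), g p = sliceAverage g (p.1, -⟪(p.2 : Space d), p.1⟫) := by
  rw [sliceDefect, lintegral_eq_zero_iff (measurable_sliceDefect_integrand βp βm hg)]
  constructor
  · intro h
    filter_upwards [h, ae_phase_angularWeight_pos hd βp βm] with p h1 h2
    have h3 := (mul_eq_zero.1 h1).resolve_left (ENNReal.ofReal_pos.2 h2.2).ne'
    simpa [sub_eq_zero] using h3
  · intro h
    filter_upwards [h] with p h1
    rw [← h1]
    simp

lemma sliceDefect_eq_zero_of_profile [NeZero d] (hd : 2 ≤ d) (βp βm : ℝ)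
    {G : ℝ × UnitSphere d → ℂ} (hG : Measurable G) {c : ℝ → ℂ}
    (h : ∀ᵐ v ∂(surfaceMeasure d), ∀ᵐ x : Space d, G (‖x‖, v) = c ‖x‖) :
    sliceDefect βp βm (fun p : Space d × UnitSphere d => G (‖p.1‖, p.2)) = 0 := by
  have hgm : Measurable fun p : Space d × UnitSphere d => G (‖p.1‖, p.2) := hG.comp (by fun_prop)
  rw [sliceDefect_eq_zero_iff_ae hd βp βm hgm]
  obtain ⟨v₀, h⟩ := exists_slice_profile h
  have h1 := ae_phase_of_ae_ae (P := fun p => G (‖p.1‖, p.2) = G (‖p.1‖, v₀))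
    (measurableSet_eq_fun hgm (hG.comp (by fun_prop))) h
  have h2 := (ae_phase_sliceMap_iff hd (P := fun q => G (‖q.1.1‖, q.2) = G (‖q.1.1‖, v₀))
    (measurableSet_eq_fun (hG.comp (by fun_prop)) (hG.comp (by fun_prop)))).1 h1
  have h3 := (ae_phase_sliceMap_iff hd (P := fun q =>
    sliceAverage (fun p : Space d × UnitSphere d => G (‖p.1‖, p.2)) q.1 = G (‖q.1.1‖, v₀))
    (measurableSet_eq_fun ((measurable_sliceAverage hgm).comp measurable_fst)
      (hG.comp (by fun_prop)))).2 (by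
      filter_upwards [h2] with ζ hζ
      refine ae_of_all _ fun _ => ?_
      simp only [sliceAverage]
      rw [integral_congr_ae hζ]
      simp)
  filter_upwards [h1, h3] with p h4 h5
  rw [h4]
  exact h5.symm

/-- Write `ξ = rω`. A vanishing defect makes `G(r,v)` a function of `rω` and `v·ω` for almost all
`(r,ω,v)`. With `r` frozen, `G(r,·)` is zonal about almost every `ω`, hence equals its mean. -/
lemma exists_profile_of_sliceDefect_eq_zero [NeZero d] (hd : 2 ≤ d) {βp βm : ℝ}
    {G : ℝ × UnitSphere d → ℂ} (hG : Measurable G)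
    (hg : MemLp (fun p : Space d × UnitSphere d => G (‖p.1‖, p.2)) 2 (phaseMeasure d))
    (h : sliceDefect βp βm (fun p : Space d × UnitSphere d => G (‖p.1‖, p.2)) = 0) :
    ∃ c : ℝ → ℂ, ∀ᵐ v ∂(surfaceMeasure d), ∀ᵐ x : Space d, G (‖x‖, v) = c ‖x‖ := by
  set g : Space d × UnitSphere d → ℂ := fun p => G (‖p.1‖, p.2) with hgdef
  have hgm : Measurable g := hG.comp (by fun_prop)
  rw [sliceDefect_eq_zero_iff_ae hd βp βm hgm] at h
  set ν := Measure.volumeIoiPow (d - 1) with hν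
  have hpol := measurePreserving_polarMap_space (d := d)
  have hmp : MeasurePreserving (Prod.map (polarMap (Space d)) id)
      (((surfaceMeasure d).prod ν).prod (surfaceMeasure d)) (phaseMeasure d) :=
    hpol.prod (MeasurePreserving.id _)
  have hswap : MeasurePreserving Prod.swap (ν.prod (surfaceMeasure d))
      ((surfaceMeasure d).prod ν) := Measure.measurePreserving_swap
  have h1 := Measure.ae_ae_of_ae_prod (hswap.quasiMeasurePreserving.ae
    (Measure.ae_ae_of_ae_prod (hmp.quasiMeasurePreserving.ae h)))
  have hG2 : MemLp (fun q : (UnitSphere d × Ioi (0 : ℝ)) × UnitSphere d => G (q.1.2, q.2)) 2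
      (((surfaceMeasure d).prod ν).prod (surfaceMeasure d)) := by
    have := hg.comp_measurePreserving hmp
    simpa only [hgdef, Function.comp_def, Prod.map_fst, Prod.map_snd, id, norm_polarMap] using this
  have hm2 : Measurable fun q : (UnitSphere d × Ioi (0 : ℝ)) × UnitSphere d =>
      ‖G (q.1.2, q.2)‖ₑ ^ 2 := (hG.comp (by fun_prop)).enorm.pow_const 2
  have hfin : ∀ᵐ z ∂((surfaceMeasure d).prod ν),
      ∫⁻ v, ‖G (z.2, v)‖ₑ ^ 2 ∂(surfaceMeasure d) < ⊤ := by
    refine ae_lt_top hm2.lintegral_prod_right' ?_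
    rw [← lintegral_prod _ hm2.aemeasurable, lintegral_enorm_sq_eq_norm hG2]
    exact ENNReal.ofReal_ne_top
  have h2 := Measure.ae_ae_of_ae_prod (hswap.quasiMeasurePreserving.ae hfin)
  refine ⟨fun r => ⨍ u, G (r, u) ∂(surfaceMeasure d), ?_⟩
  have hcm : Measurable fun r : ℝ => ⨍ u, G (r, u) ∂(surfaceMeasure d) := by
    simp_rw [average_eq]
    exact (hG.stronglyMeasurable.integral_prod_right').measurable.const_smul _
  have h3 : ∀ᵐ r : Ioi (0 : ℝ) ∂ν, ∀ᵐ v ∂(surfaceMeasure d),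
      G ((r : ℝ), v) = ⨍ u, G ((r : ℝ), u) ∂(surfaceMeasure d) := by
    filter_upwards [h1, h2] with r hr1 hr2
    obtain ⟨ω₀, hω₀⟩ := hr2.exists
    have hmem : MemLp (fun v => G ((r : ℝ), v)) 2 (surfaceMeasure d) := by
      refine ⟨(hG.comp (by fun_prop)).aestronglyMeasurable, ?_⟩
      rw [eLpNorm_lt_top_iff_lintegral_rpow_enorm_lt_top (by simp) (by simp)]
      simpa using hω₀
    refine ae_eq_const_of_zonal hd (hmem.integrable (by norm_num)) ?_
    filter_upwards [hr1] with ω hω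
    -- The slice through `v` at `ξ = rω` is `τ = -r (v·ω)`.
    refine ⟨fun s => sliceAverage g ((r : ℝ) • (ω : Space d), -((r : ℝ) * s)), ?_⟩
    filter_upwards [hω] with v hv
    simp only [hgdef, Prod.map_fst, Prod.map_snd, id, Prod.swap_prod_mk, norm_polarMap] at hv
    rw [hv]
    simp only [polarMap, inner_smul_right]
    rfl
  have h4 := (Measure.ae_ae_comm (p := fun (r : Ioi (0 : ℝ)) v =>
    G ((r : ℝ), v) = ⨍ u, G ((r : ℝ), u) ∂(surfaceMeasure d))
    (measurableSet_eq_fun (hG.comp (by fun_prop)) (hcm.comp (by fun_prop)))).1 h3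
  filter_upwards [h4] with v hv
  rw [← hpol.map_eq, measurableEmbedding_polarMap.ae_map_iff]
  filter_upwards [Measure.quasiMeasurePreserving_snd.ae hv] with z hz
  rw [norm_polarMap]
  exact hz

lemma ofReal_sqNorm {α : Type*} [MeasurableSpace α] {μ : Measure α} {f : α → ℂ}
    (hf : MemLp f 2 μ) : ENNReal.ofReal (sqNorm μ f) = ∫⁻ a, ‖f a‖ₑ ^ 2 ∂μ := by
  rw [sqNorm, ofReal_integral_eq_lintegral_ofReal ((memLp_two_iff_integrable_sq_norm hf.1).1 hf)
    (ae_of_all _ fun a => by positivity)]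
  refine lintegral_congr fun a => ?_
  rw [ENNReal.ofReal_pow (norm_nonneg _), ofReal_norm]

lemma memLp_two_of_lintegral_lt_top {α : Type*} [MeasurableSpace α] {μ : Measure α} {f : α → ℂ}
    (hm : AEStronglyMeasurable f μ) (h : ∫⁻ a, ‖f a‖ₑ ^ 2 ∂μ < ⊤) : MemLp f 2 μ := by
  refine ⟨hm, ?_⟩
  rw [eLpNorm_lt_top_iff_lintegral_rpow_enorm_lt_top (by simp) (by simp)]
  simpa using h

/-- The space-time Fourier transform of the velocity average of a function that is radial in `x`,
with the energy identity for it. -/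
theorem exists_velocityAverage_fourier (hd : 2 ≤ d) {βp βm : ℝ} (hsum : βp + βm = 1 / 2)
    (hβ : (2 - (d : ℝ)) / 2 < βm) {f : Space d × UnitSphere d → ℂ} (hf : f ∈ L2RadX d) :
    ∃ (U : Space d × ℝ → ℂ) (D : ENNReal), HasFourierTransform (velocityAverage f) U ∧
      MemLp (fun ζ => (hyperbolicMultiplier βp βm ζ : ℂ) * U ζ) 2 ∧
      (D = 0 ↔ f ∈ L2RadXV d) ∧
      (∫⁻ ζ, ‖(hyperbolicMultiplier βp βm ζ : ℂ) * U ζ‖ₑ ^ 2) +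
        ENNReal.ofReal ((2 * Real.pi) ^ 2) * D =
        ENNReal.ofReal ((2 * Real.pi) ^ (d + 1)) *
          ENNReal.ofReal (sharpRadialConstant d βp βm * sqNorm (phaseMeasure d) f) := by
  have : NeZero d := ⟨by omega⟩
  obtain ⟨F, hF, hfF⟩ := exists_measurable_profile hf
  have hF2 := hf.1.ae_eq hfF
  obtain ⟨G, hG, hFG⟩ := exists_partialFourier hF hF2
  have hFm : Measurable fun p : Space d × UnitSphere d => F (‖p.1‖, p.2) := hF.comp (by fun_prop)
  have hgm : Measurable fun p : Space d × UnitSphere d => G (‖p.1‖, p.2) := hG.comp (by fun_prop)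
  have hnorm : ∫⁻ p : Space d × UnitSphere d, ‖G (‖p.1‖, p.2)‖ₑ ^ 2 ∂(phaseMeasure d) =
      ENNReal.ofReal ((2 * Real.pi) ^ d) * ENNReal.ofReal (sqNorm (phaseMeasure d) f) := by
    have hfn : ∫⁻ p, ‖f p‖ₑ ^ 2 ∂(phaseMeasure d) =
        ∫⁻ p : Space d × UnitSphere d, ‖F (‖p.1‖, p.2)‖ₑ ^ 2 ∂(phaseMeasure d) :=
      lintegral_congr_ae (hfF.mono fun p hp => by simp only [hp])
    rw [ofReal_sqNorm hf.1, hfn, phaseMeasure,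
      lintegral_prod_symm' _ (hgm.enorm.pow_const 2), lintegral_prod_symm' _ (hFm.enorm.pow_const 2),
      ← lintegral_const_mul' _ _ ENNReal.ofReal_ne_top]
    refine lintegral_congr_ae ?_
    filter_upwards [hFG] with v hv
    have := hv.lintegral_eq
    rwa [finrank_euclideanSpace, Fintype.card_fin] at this
  have hg : MemLp (fun p : Space d × UnitSphere d => G (‖p.1‖, p.2)) 2 (phaseMeasure d) := by
    refine memLp_two_of_lintegral_lt_top hgm.aestronglyMeasurable ?_
    rw [hnorm]
    exact ENNReal.mul_lt_top ENNReal.ofReal_lt_top ENNReal.ofReal_lt_top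
  have hA0 : surfaceMeasure d univ ≠ 0 := by simpa using surfaceMeasure_ne_zero
  have hE := energy_identity hd hsum hG hg
  set U := averageFourier fun p : Space d × UnitSphere d => G (‖p.1‖, p.2) with hU
  set D := sliceDefect βp βm fun p : Space d × UnitSphere d => G (‖p.1‖, p.2) with hD
  have hE' : (∫⁻ ζ, ‖(hyperbolicMultiplier βp βm ζ : ℂ) * U ζ‖ₑ ^ 2) +
        ENNReal.ofReal ((2 * Real.pi) ^ 2) * D =
        ENNReal.ofReal ((2 * Real.pi) ^ (d + 1)) *
          ENNReal.ofReal (sharpRadialConstant d βp βm * sqNorm (phaseMeasure d) f) := by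
    -- The sphere area is restored so that the energy identity applies. It cancels because it is
    -- positive and finite.
    rw [← ENNReal.mul_right_inj hA0 (measure_ne_top _ _), mul_add, ← mul_assoc, hE, hnorm,
      ENNReal.ofReal_mul (sharpRadialConstant_nonneg _ _), pow_succ (2 * Real.pi) d,
      ENNReal.ofReal_mul (by positivity)]
    have hC := sharpRadialConstant_mul_sphereArea hd hsum hβ
    calc _ = ENNReal.ofReal (2 * Real.pi) * (ENNReal.ofReal (2 * Real.pi) *
          angularConstant d βp βm) * (ENNReal.ofReal ((2 * Real.pi) ^ d) *
            ENNReal.ofReal (sqNorm (phaseMeasure d) f)) := by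
          rw [sq, ENNReal.ofReal_mul Real.two_pi_pos.le]
          ring
      _ = _ := by
          rw [← hC]
          ring
  refine ⟨U, D, ?_, ?_, ?_, hE'⟩
  · refine hasFourierTransform_velocityAverage hd hf.1 hgm hg ?_
    filter_upwards [hFG, ae_ae_of_ae_phase hfF] with v hv hv'
    exact hv.congr (Filter.EventuallyEq.symm hv') Filter.EventuallyEq.rfl
  · refine memLp_two_of_lintegral_lt_top ((Complex.measurable_ofReal.comp
      (measurable_hyperbolicMultiplier βp βm)).mul
        (measurable_averageFourier hgm)).aestronglyMeasurable ?_
    refine lt_of_le_of_lt (le_self_add.trans_eq hE') ?_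
    exact ENNReal.mul_lt_top ENNReal.ofReal_lt_top ENNReal.ofReal_lt_top
  · rw [mem_L2RadXV_iff hf.1 hF hfF, exists_profile_iff hFG]
    exact ⟨exists_profile_of_sliceDefect_eq_zero hd hG hg, fun ⟨c, hc⟩ =>
      sliceDefect_eq_zero_of_profile hd βp βm hG hc⟩

theorem exists_isHyperbolicDerivative (hd : 2 ≤ d) {βp βm : ℝ} (hsum : βp + βm = 1 / 2)
    (hβ : (2 - (d : ℝ)) / 2 < βm) {f : Space d × UnitSphere d → ℂ} (hf : f ∈ L2RadX d) :
    ∃ w, IsHyperbolicDerivative βp βm (velocityAverage f) w := by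
  obtain ⟨U, -, hU, hV, -, -⟩ := exists_velocityAverage_fourier hd hsum hβ hf
  obtain ⟨w, hw, hwV⟩ := exists_hasFourierTransform hV
  exact ⟨w, hw, U, hU, hwV⟩

/-- By uniqueness of transforms and Plancherel, the energy identity reads `(2π)^{d+1} ‖w‖² + (2π)² D
= (2π)^{d+1} C₀ ‖f‖²` with `D ≥ 0`. Dropping `D` gives the bound, and equality means `D = 0`. -/
theorem sqNorm_hyperbolicDerivative (hd : 2 ≤ d) {βp βm : ℝ} (hsum : βp + βm = 1 / 2)
    (hβ : (2 - (d : ℝ)) / 2 < βm) {f : Space d × UnitSphere d → ℂ} (hf : f ∈ L2RadX d)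
    {w : Space d × ℝ → ℂ} (hw : IsHyperbolicDerivative βp βm (velocityAverage f) w) :
    sqNorm volume w ≤ sharpRadialConstant d βp βm * sqNorm (phaseMeasure d) f ∧
      (sqNorm volume w = sharpRadialConstant d βp βm * sqNorm (phaseMeasure d) f ↔
        f ∈ L2RadXV d) := by
  obtain ⟨U, D, hU, -, hD, hE⟩ := exists_velocityAverage_fourier hd hsum hβ hf
  obtain ⟨hw2, U', hU', hwU'⟩ := hw
  have hwU := hwU'.congr_right (V := fun ζ => (hyperbolicMultiplier βp βm ζ : ℂ) * U ζ)
    ((hU'.ae_eq hU).mono fun ζ hζ => by simp only [hζ])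
  have hP : ENNReal.ofReal ((2 * Real.pi) ^ (d + 1)) ≠ 0 :=
    (ENNReal.ofReal_pos.2 (by positivity)).ne'
  have hP2 : ENNReal.ofReal ((2 * Real.pi) ^ 2) ≠ 0 := (ENNReal.ofReal_pos.2 (by positivity)).ne'
  have hN : 0 ≤ sharpRadialConstant d βp βm * sqNorm (phaseMeasure d) f :=
    mul_nonneg (sharpRadialConstant_nonneg _ _) (integral_nonneg fun _ => by positivity)
  have hw0 : 0 ≤ sqNorm volume w := integral_nonneg fun _ => by positivity
  rw [hwU.lintegral_eq hw2, ← ofReal_sqNorm hw2] at hE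
  refine ⟨?_, ?_⟩
  · rw [← ENNReal.ofReal_le_ofReal_iff hN, ← ENNReal.mul_le_mul_iff_right hP ENNReal.ofReal_ne_top,
      ← hE]
    exact le_self_add
  · rw [← hD, ← ENNReal.ofReal_eq_ofReal_iff hw0 hN,
      ← ENNReal.mul_right_inj hP ENNReal.ofReal_ne_top, ← hE]
    constructor
    · intro h
      have h1 := (ENNReal.add_right_inj (ENNReal.mul_ne_top ENNReal.ofReal_ne_top
        ENNReal.ofReal_ne_top)).1 ((add_zero _).trans h)
      exact (mul_eq_zero.1 h1.symm).resolve_left hP2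
    · intro h
      rw [h, mul_zero, add_zero]

lemma L2RadXV_subset_L2RadX : L2RadXV d ⊆ L2RadX d := fun _ ⟨hf, f₀, h⟩ => ⟨hf, fun r _ => f₀ r, h⟩

/-- A nonzero extremiser, needed for sharpness: the indicator of the unit ball in `x`. -/
lemma exists_mem_L2RadXV_sqNorm_pos [NeZero d] :
    ∃ f ∈ L2RadXV d, 0 < sqNorm (phaseMeasure d) f := by
  set B : Set (Space d × UnitSphere d) := Metric.ball 0 1 ×ˢ univ with hB
  have hBm : MeasurableSet B := measurableSet_ball.prod MeasurableSet.univ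
  have hμ : phaseMeasure d B = volume (Metric.ball (0 : Space d) 1) * surfaceMeasure d univ := by
    rw [hB, phaseMeasure, Measure.prod_prod]
  have hA0 : surfaceMeasure d univ ≠ 0 := by simpa using surfaceMeasure_ne_zero
  have hfin : phaseMeasure d B ≠ ⊤ := by
    rw [hμ]
    exact ENNReal.mul_ne_top measure_ball_lt_top.ne (measure_ne_top _ _)
  refine ⟨B.indicator fun _ => 1, ⟨memLp_indicator_const 2 hBm 1 (Or.inr hfin),
    (Iio 1).indicator fun _ => 1, ae_of_all _ fun p => ?_⟩, ?_⟩
  · by_cases hp : ‖p.1‖ < 1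
    · rw [indicator_of_mem (by simpa [hB] using hp), indicator_of_mem (by simpa using hp)]
    · rw [indicator_of_notMem (by simpa [hB] using hp), indicator_of_notMem (by simpa using hp)]
  · have h1 : ∀ p, ‖B.indicator (fun _ => (1 : ℂ)) p‖ ^ 2 = B.indicator (fun _ => (1 : ℝ)) p := by
      intro p
      by_cases hp : p ∈ B <;> simp [hp]
    simp_rw [sqNorm, h1]
    rw [integral_indicator hBm, setIntegral_const, smul_eq_mul, mul_one]
    refine ENNReal.toReal_pos ?_ hfin
    rw [hμ]
    exact mul_ne_zero (Metric.measure_ball_pos _ _ one_pos).ne' hA0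

end Equality

end KineticTransport

end

theorem theorem7p7 (d : ℕ) (hd : 2 ≤ d) (βp βm : ℝ) (hsum : βp + βm = 1 / 2)
    (hβ : (2 - (d : ℝ)) / 2 < βm) :
    (∀ f ∈ KineticTransport.L2RadX d, ∃ w : KineticTransport.Space d × ℝ → ℂ,
      KineticTransport.IsHyperbolicDerivative βp βm (KineticTransport.velocityAverage f) w) ∧
    IsLeast
      {C : ℝ | ∀ f ∈ KineticTransport.L2RadX d, ∀ w : KineticTransport.Space d × ℝ → ℂ,
        KineticTransport.IsHyperbolicDerivative βp βm (KineticTransport.velocityAverage f) w →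
        KineticTransport.sqNorm volume w ≤
          C * KineticTransport.sqNorm (KineticTransport.phaseMeasure d) f}
      (KineticTransport.sharpRadialConstant d βp βm) ∧
    ∀ f ∈ KineticTransport.L2RadX d, ∀ w : KineticTransport.Space d × ℝ → ℂ,
      KineticTransport.IsHyperbolicDerivative βp βm (KineticTransport.velocityAverage f) w →
      (KineticTransport.sqNorm volume w =
          KineticTransport.sharpRadialConstant d βp βm *
            KineticTransport.sqNorm (KineticTransport.phaseMeasure d) f ↔
        f ∈ KineticTransport.L2RadXV d) := by
  have : NeZero d := ⟨by omega⟩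
  refine ⟨fun f hf => KineticTransport.exists_isHyperbolicDerivative hd hsum hβ hf,
    ⟨fun f hf w hw => (KineticTransport.sqNorm_hyperbolicDerivative hd hsum hβ hf hw).1,
      fun C hC => ?_⟩,
    fun f hf w hw => (KineticTransport.sqNorm_hyperbolicDerivative hd hsum hβ hf hw).2⟩
  -- Equality holds for this `f`, so an admissible `C` satisfies `C₀ ‖f‖² ≤ C ‖f‖²` with `‖f‖² > 0`.
  obtain ⟨f, hf, hpos⟩ := KineticTransport.exists_mem_L2RadXV_sqNorm_pos (d := d)
  have hfX := KineticTransport.L2RadXV_subset_L2RadX hf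
  obtain ⟨w, hw⟩ := KineticTransport.exists_isHyperbolicDerivative hd hsum hβ hfX
  have h := hC f hfX w hw
  rw [(KineticTransport.sqNorm_hyperbolicDerivative hd hsum hβ hfX hw).2.2 hf] at h
  exact le_of_mul_le_mul_right h hpos
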